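/- Let $d\ge 2$ and let $x_i=\theta_i+z_i$, $i=1,\dots,d$, with $z_1,\dots,z_d$ i.i.d. $N(0,1)$ and $\theta\in\mathbb R^d$ unknown. For an estimator $\hat\theta$ let $R(\hat\theta,\theta)=d^{-1}\sum_{i=1}^d E(\hat\theta_i-\theta_i)^2$. Block estimators. For an integer $1\le L\le\sqrt d$ divide the coordinates into $m=\lceil d/L\rceil$ consecutive blocks of length $L$, the last one being shorter if $L$ does not divide $d$. Let $\ell_b$ be the length of the $b$-th block (so $\ell_b=L$ for every $b$ if $L$ divides $d$), $\underline x_b$ the vector of observations in it, and $S_b^2=\|\underline x_b\|_2^2$. For $\lambda\ge 0$ the blockwise James–Stein estimator is $\hat\theta_b(\lambda,L)=(1-\lambda/S_b^2)_+\,\underline x_b$, and Stein's unbiased risk estimate is $$\mathrm{SURE}(x,\lambda,L)=\sum_{b=1}^m\Big(\ell_b+\frac{\lambda^2-2\lambda(\ell_b-2)}{S_b^2}\,I(S_b^2>\lambda)+(S_b^2-2\ell_b)\,I(S_b^2\le\lambda)\Big).$$ SureBlock estimator. Let $T_d=d^{-1}\sum_i(x_i^2-1)$ and $\gamma_d=d^{-1/2}(\log_2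 d)^{3/2}$, and let $(\lambda^*,L^*)=(\lambda^*(x),L^*(x))$ be a minimizer of $\mathrm{SURE}(x,\lambda,L)$ over the integers $1\le L\le\sqrt d$ and the reals $\max\{L-2,0\}\le\lambda\le 2L\log d$. The SureBlock estimator $\hat\theta^*$ equals $\hat\theta(\lambda^*,L^*)$ if $T_d>\gamma_d$, and equals the nonnegative garrote $\hat\theta^*_i=(1-2\log d/x_i^2)_+\,x_i$ if $T_d\le\gamma_d$. Oracle risks. Let $$R_{\mathrm{block.oracle}}(\theta)=\inf\{R(\hat\theta(\lambda,L),\theta):\ 1\le L\le\sqrt d,\ \lambda\ge\max\{L-2,0\}\},\qquad R_{\mathrm{linear.oracle}}(\theta)=\frac{\|\theta\|_2^2}{\|\theta\|_2^2+d}.$$ **Theorem.** There is an absolute constant $c>0$, in particular not depending on $d$, $\theta$ or the choice of the minimizers, such that for all $d\ge 2$: (a) $R(\hat\theta^*,\theta)\le R_{\mathrm{block.oracle}}(\theta)+c\,d^{-1/4}(\log d)^{5/2}$ for all $\theta\in\mathbb R^d$; (b) $R(\hat\theta^*,\theta)\le R_{\mathrm{linear.oracle}}(\theta)+c\,d^{-1/4}(\log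 d)^{5/2}$ for all $\theta\in\mathbb R^d$; (c) $R(\hat\theta^*,\theta)\le d^{-1}\sum_{i=1}^d\min(\theta_i^2,\,2\log d)+c\,d^{-1}(\log d)^{-1/2}$ for all $\theta\in\mathbb R^d$ with $\|\theta\|_2^2/d\le\gamma_d/3$. -/

import Mathlib

open MeasureTheory ProbabilityTheory

namespace SureBlock

noncomputable section

/-- The law of the noise `z = (z_1, …, z_d)`: independent standard normal coordinates. -/
def noise (d : ℕ) : Measure (Fin d → ℝ) := Measure.pi fun _ => gaussianReal 0 1

/-- Average mean squared error `d⁻¹ E ∑ᵢ (θ̂ᵢ(x) - θᵢ)²` of `est` under `x = θ + z`, valued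
in `[0, ∞]`. -/
def risk {d : ℕ} (est : (Fin d → ℝ) → (Fin d → ℝ)) (θ : Fin d → ℝ) : ENNReal :=
  (d : ENNReal)⁻¹ * ∫⁻ z, ENNReal.ofReal (∑ i, (est (θ + z) i - θ i) ^ 2) ∂(noise d)

/-- The `b`-th block (`b = 0, 1, …`) of `L` consecutive coordinates. If `L` does not divide `d`,
the last block is shorter. -/
def block (d L b : ℕ) : Finset (Fin d) := Finset.univ.filter fun i => i.val / L = b

/-- `S_b²`, the sum of the squares of the observations in the `b`-th block. -/
def blockSq {d : ℕ} (x : Fin d → ℝ) (L b : ℕ) : ℝ := ∑ i ∈ block d L b, x i ^ 2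

/-- The number `⌈d / L⌉` of blocks. -/
def numBlocks (d L : ℕ) : ℕ := (d + L - 1) / L

/-- The blockwise James–Stein estimator with threshold `lam` and block size `L`. (Where the sum
of squares of a block vanishes, so do the observations in it, and the value is `0`.) -/
def blockJS {d : ℕ} (lam : ℝ) (L : ℕ) (x : Fin d → ℝ) : Fin d → ℝ :=
  fun i => max (1 - lam / blockSq x L (i.val / L)) 0 * x i

/-- Stein's unbiased risk estimate for one block of `l` coordinates with sum of squares `s`. -/
def sureTerm (l s lam : ℝ) : ℝ :=
  l + (if lam < s then (lam ^ 2 - 2 * lam * (l - 2)) / s else 0)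
    + (if s ≤ lam then s - 2 * l else 0)

/-- Stein's unbiased risk estimate of the blockwise James–Stein estimator; each block enters
with its own number of coordinates, which is `L` except perhaps for the last block. -/
def sure {d : ℕ} (x : Fin d → ℝ) (lam : ℝ) (L : ℕ) : ℝ :=
  ∑ b ∈ Finset.range (numBlocks d L), sureTerm ((block d L b).card : ℝ) (blockSq x L b) lam

/-- The search range: integers `1 ≤ L ≤ √d` and `max (L - 2) 0 ≤ lam ≤ 2 L log d`. -/
def InSearchRange (d : ℕ) (lam : ℝ) (L : ℕ) : Prop :=
  1 ≤ L ∧ (L : ℝ) ≤ √(d : ℝ) ∧ max ((L : ℝ) - 2) 0 ≤ lam ∧ lam ≤ 2 * (L : ℝ) * Real.log d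

/-- `(lam, L)` minimizes SURE over the search range, at the observation `x`. -/
def IsSureMinimizer {d : ℕ} (x : Fin d → ℝ) (lam : ℝ) (L : ℕ) : Prop :=
  InSearchRange d lam L ∧
    ∀ (lam' : ℝ) (L' : ℕ), InSearchRange d lam' L' → sure x lam L ≤ sure x lam' L'

/-- `T_d = d⁻¹ ∑ᵢ (xᵢ² - 1)`. -/
def sparsityStat {d : ℕ} (x : Fin d → ℝ) : ℝ := (d : ℝ)⁻¹ * ∑ i, (x i ^ 2 - 1)

/-- `γ_d = d^{-1/2} (log₂ d)^{3/2}`. -/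
def sparsityLevel (d : ℕ) : ℝ := (d : ℝ) ^ (-(1 / 2) : ℝ) * Real.logb 2 d ^ (3 / 2 : ℝ)

/-- The nonnegative garrote with threshold `2 log d`. -/
def garrote {d : ℕ} (x : Fin d → ℝ) : Fin d → ℝ :=
  fun i => max (1 - 2 * Real.log d / x i ^ 2) 0 * x i

open Classical in
/-- The hybrid estimator built from the threshold `lam x` and the block size `L x` chosen from
the data `x`. -/
def hybrid {d : ℕ} (lam : (Fin d → ℝ) → ℝ) (L : (Fin d → ℝ) → ℕ) (x : Fin d → ℝ) : Fin d → ℝ :=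
  if sparsityLevel d < sparsityStat x then blockJS (lam x) (L x) x else garrote x

/-- `est` is a SureBlock estimator: the hybrid estimator whose threshold and block size
minimize SURE. -/
def IsSureBlock {d : ℕ} (est : (Fin d → ℝ) → (Fin d → ℝ)) : Prop :=
  ∃ (lam : (Fin d → ℝ) → ℝ) (L : (Fin d → ℝ) → ℕ),
    (∀ x, IsSureMinimizer x (lam x) (L x)) ∧ est = hybrid lam L

/-- The block thresholding oracle risk: the infimum of the risks of the blockwise James–Stein
estimators with fixed `1 ≤ L ≤ √d` and `lam ≥ max (L - 2) 0`. -/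
def blockOracle {d : ℕ} (θ : Fin d → ℝ) : ENNReal :=
  ⨅ (L : ℕ) (lam : ℝ) (_ : 1 ≤ L ∧ (L : ℝ) ≤ √(d : ℝ) ∧ max ((L : ℝ) - 2) 0 ≤ lam),
    risk (blockJS lam L) θ

/-- The linear shrinkage oracle risk `‖θ‖² / (‖θ‖² + d)`. -/
def linearOracle {d : ℕ} (θ : Fin d → ℝ) : ℝ := (∑ i, θ i ^ 2) / (∑ i, θ i ^ 2 + d)

theorem sureTerm_lsc {l s : ℝ} (hl : 0 ≤ l) (hs : 0 ≤ s) :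
    LowerSemicontinuous (sureTerm l s) := by
  intro a y hy
  have e1 : ∀ t, s ≤ t → sureTerm l s t = l + (s - 2 * l) := by
    intro t ht
    simp [sureTerm, ht, not_lt.2 ht]
  have e2 : ∀ t, t < s → sureTerm l s t = l + (t ^ 2 - 2 * t * (l - 2)) / s := by
    intro t ht
    simp [sureTerm, ht, not_le.2 ht]
  have hc : ∀ a, ContinuousAt (fun t : ℝ => l + (t ^ 2 - 2 * t * (l - 2)) / s) a := by
    intro a
    fun_prop
  rcases lt_trichotomy a s with h | h | h
  · rw [e2 a h] at hy
    filter_upwards [(hc a).eventually_const_lt hy, eventually_lt_nhds h] with t h1 h2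
    rw [e2 t h2]
    exact h1
  · subst h
    rw [e1 a le_rfl] at hy
    have hq : y < l + (a ^ 2 - 2 * a * (l - 2)) / a := by
      rcases hs.eq_or_lt with h0 | h0
      · subst h0
        simp
        linarith
      · have : (a ^ 2 - 2 * a * (l - 2)) / a = a - 2 * (l - 2) := by
          field_simp
        rw [this]
        linarith
    filter_upwards [(hc a).eventually_const_lt hq] with t h1
    rcases lt_or_ge t a with ht | ht
    · rw [e2 t ht]
      exact h1
    · rw [e1 t ht]
      exact hy
  · rw [e1 a h.le] at hy
    filter_upwards [eventually_gt_nhds h] with t h1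
    rw [e1 t h1.le]
    exact hy

theorem sure_lsc {d : ℕ} (x : Fin d → ℝ) (L : ℕ) :
    LowerSemicontinuous fun lam => sure x lam L := by
  unfold sure
  exact lowerSemicontinuous_sum fun b _ =>
    sureTerm_lsc (Nat.cast_nonneg _) (Finset.sum_nonneg fun i _ => sq_nonneg (x i))

/-- The minimum of SURE over the search range is attained, at every observation. -/
theorem exists_isSureMinimizer {d : ℕ} (hd : 2 ≤ d) (x : Fin d → ℝ) :
    ∃ (lam : ℝ) (L : ℕ), IsSureMinimizer x lam L := by
  have hd' : (2 : ℝ) ≤ d := by exact_mod_cast hd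
  have hlog : (1 / 2 : ℝ) ≤ Real.log d := by
    have h1 := Real.log_two_gt_d9
    have h2 : Real.log 2 ≤ Real.log d := Real.log_le_log (by norm_num) hd'
    linarith
  have hmin : ∀ L : ℕ, ∃ lam ∈ Set.Icc (max ((L : ℝ) - 2) 0) (2 * (L : ℝ) * Real.log d),
      ∀ t ∈ Set.Icc (max ((L : ℝ) - 2) 0) (2 * (L : ℝ) * Real.log d),
        sure x lam L ≤ sure x t L := by
    intro L
    have hL : (0 : ℝ) ≤ L := Nat.cast_nonneg L
    have hne : (Set.Icc (max ((L : ℝ) - 2) 0) (2 * (L : ℝ) * Real.log d)).Nonempty := by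
      rw [Set.nonempty_Icc]
      apply max_le <;> nlinarith
    obtain ⟨a, ha, h⟩ := ((sure_lsc x L).lowerSemicontinuousOn _).exists_isMinOn hne isCompact_Icc
    exact ⟨a, ha, fun t ht => h ht⟩
  choose f hf hfm using hmin
  have hfin : ((Finset.Icc 1 d).filter fun L : ℕ => (L : ℝ) ≤ √(d : ℝ)).Nonempty := by
    refine ⟨1, ?_⟩
    simp only [Finset.mem_filter, Finset.mem_Icc, Nat.cast_one, Real.one_le_sqrt]
    exact ⟨⟨le_rfl, by omega⟩, by linarith⟩
  obtain ⟨L, hL, h⟩ := Finset.exists_min_image _ (fun L => sure x (f L) L) hfin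
  simp only [Finset.mem_filter, Finset.mem_Icc] at hL h
  refine ⟨f L, L, ⟨hL.1.1, hL.2, (hf L).1, (hf L).2⟩, ?_⟩
  rintro t L' ⟨h1, h2, h3, h4⟩
  refine (h L' ⟨⟨h1, ?_⟩, h2⟩).trans (hfm L' t ⟨h3, h4⟩)
  have : √(d : ℝ) ≤ d := by
    rw [Real.sqrt_le_left (by linarith)]
    nlinarith
  exact_mod_cast h2.trans this

/-- A SureBlock estimator exists. -/
theorem exists_isSureBlock {d : ℕ} (hd : 2 ≤ d) :
    ∃ est : (Fin d → ℝ) → (Fin d → ℝ), IsSureBlock est := by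
  choose lam L h using fun x : Fin d → ℝ => exists_isSureMinimizer hd x
  exact ⟨_, lam, L, h, rfl⟩

end

end SureBlock

namespace SureBlock

/-! ### The one-dimensional standard normal law -/

section OneDim

/-! Call loss the sum of squared errors. On one block, loss minus SURE is `groupDev`, which has mean
zero by Stein's identity (`integral_groupDev`). The core is a pathwise, uniform version
(`exists_envelope`): almost surely loss ≤ SURE + G at all pairs of the search range at once, where G
does not depend on the pair and has mean O(d^{3/4} (log d)²). As the selected pair minimizes SURE,
its loss is at most SURE + G at every fixed pair, and the mean of SURE there is the risk. The
selection enters only through this inequality, so the minimizers need not be measurable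
(`risk_le_of_ae_le`).

For G, fix a pair first. The block deviations are independent and centered, and up to rare large
noise they are O(L log d), so their sum is sub-Gaussian with variance proxy O((d/L) (L log d)²) ≤
O(d^{3/2} (log d)²) because L ≤ √d. A union bound over polynomially many pairs costs a factor of
order log d in the exponent, and moving a threshold up to the next point of a grid of mesh d⁻² costs
little (`groupDev_le_of_lt`). When the hybrid falls back on the garrote, the failed test itself
bounds ‖θ‖², and hence the loss, by a variable of mean O(√d (log d)²)
(`sqLoss_garrote_le_fallbackBound`).

(a) A pair within the search range is covered by the above. A larger threshold is replaced by 2 L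
log d: averaged over the reflection z ↦ -z, the loss does not decrease with the threshold unless the
noise in the block is large (`groupLoss_symm_le`).

(b) Take L = ⌊√d⌋ and threshold L. The mean SURE of a full block is at most its ideal linear risk
plus O(√L); in each block the ideal linear risk is at most the risk of the shrinkage that is optimal
for the whole vector. The O(√d) blocks contribute an error O(d^{3/4}).

(c) For sparse θ the test chooses the block estimator with a probability below any power of 1/d
(`integral_detectionBound_le`). Otherwise the garrote is used. Where θᵢ² ≤ 2 log d its loss is at
most θᵢ² plus a Gaussian tail; where θᵢ² > 2 log d, SURE shows its risk to be at most 2 log d once d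
is large (`exists_integral_groupLoss_singleton_le`). -/

theorem stdPDF_eq (x : ℝ) :
    gaussianPDFReal 0 1 x = (√(2 * Real.pi))⁻¹ * Real.exp (-(x ^ 2 / 2)) := by
  simp [gaussianPDFReal, neg_div]

theorem stdPDF_le (x : ℝ) : gaussianPDFReal 0 1 x ≤ Real.exp (-(x ^ 2 / 2)) := by
  rw [stdPDF_eq]
  refine mul_le_of_le_one_left (Real.exp_pos _).le (inv_le_one_of_one_le₀ ?_)
  rw [Real.one_le_sqrt]
  nlinarith [Real.pi_gt_three]

theorem stdPDF_le_one (x : ℝ) : gaussianPDFReal 0 1 x ≤ 1 :=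
  (stdPDF_le x).trans (Real.exp_le_one_iff.2 (by nlinarith [sq_nonneg x]))

theorem integrable_stdNormal_iff {g : ℝ → ℝ} :
    Integrable g (gaussianReal 0 1) ↔ Integrable fun x => gaussianPDFReal 0 1 x * g x := by
  rw [gaussianReal_of_var_ne_zero 0 one_ne_zero]
  rw [integrable_withDensity_iff_integrable_smul' (measurable_gaussianPDF 0 1)
    (Filter.Eventually.of_forall fun x => gaussianPDF_lt_top)]
  simp only [toReal_gaussianPDF, smul_eq_mul]

theorem integral_stdNormal (g : ℝ → ℝ) :
    ∫ x, g x ∂(gaussianReal 0 1) = ∫ x, gaussianPDFReal 0 1 x * g x := by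
  simpa using integral_gaussianReal_eq_integral_smul (μ := 0) (v := 1) (f := g) one_ne_zero

theorem integrable_abs_pow_stdNormal (n : ℕ) :
    Integrable (fun x : ℝ => |x| ^ n) (gaussianReal 0 1) := by
  simpa using (memLp_id_gaussianReal' (μ := 0) (v := 1) n (by simp)).integrable_norm_pow' 

theorem integrable_pow_stdNormal (n : ℕ) :
    Integrable (fun x : ℝ => x ^ n) (gaussianReal 0 1) :=
  (integrable_abs_pow_stdNormal n).mono' (by fun_prop)
    (Filter.Eventually.of_forall fun x => by simp)

theorem integral_sq_stdNormal : ∫ x, x ^ 2 ∂(gaussianReal 0 1) = 1 := by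
  have h := variance_id_gaussianReal (μ := 0) (v := 1)
  rw [variance_eq_integral (by fun_prop)] at h
  simpa using h

theorem hasDerivAt_stdPDF (x : ℝ) :
    HasDerivAt (gaussianPDFReal 0 1) (-x * gaussianPDFReal 0 1 x) x := by
  have h : HasDerivAt (fun x : ℝ => (√(2 * Real.pi))⁻¹ * Real.exp (-(x ^ 2 / 2)))
      ((√(2 * Real.pi))⁻¹ * (Real.exp (-(x ^ 2 / 2)) * (-(2 * x / 2)))) x := by
    have h1 : HasDerivAt (fun x : ℝ => -(x ^ 2 / 2)) (-(2 * x / 2)) x := by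
      simpa using ((hasDerivAt_pow 2 x).div_const 2).fun_neg
    exact h1.exp.const_mul _
  convert h using 1
  · ext y; exact stdPDF_eq y
  · rw [stdPDF_eq]; ring

/-- Stein's identity for bounded functions that are differentiable off a countable set. -/
theorem integral_mul_eq_integral_deriv {f f' : ℝ → ℝ} {s : Set ℝ} {C : ℝ}
    (hf : Continuous f) (hs : s.Countable) (hd : ∀ x ∉ s, HasDerivAt f (f' x) x)
    (hC : ∀ x, |f x| ≤ C) (hf' : Integrable f' (gaussianReal 0 1)) :
    ∫ x, x * f x ∂(gaussianReal 0 1) = ∫ x, f' x ∂(gaussianReal 0 1) := by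
  set p := gaussianPDFReal 0 1 with hp
  have hcp : Continuous p := continuous_iff_continuousAt.2 fun x => (hasDerivAt_stdPDF x).continuousAt
  have hxf : Integrable (fun x => x * f x) (gaussianReal 0 1) := by
    refine ((integrable_abs_pow_stdNormal 1).mul_const C).mono' (by fun_prop) ?_
    refine Filter.Eventually.of_forall fun x => ?_
    rw [Real.norm_eq_abs, abs_mul, pow_one]
    exact mul_le_mul_of_nonneg_left (hC x) (abs_nonneg _)
  have hI : Integrable fun x => p x * f' x - p x * (x * f x) :=
    (integrable_stdNormal_iff.1 hf').sub (integrable_stdNormal_iff.1 hxf)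
  -- Since p' = -x p, the integrand is the derivative of p f. The boundary terms vanish in the limit
  -- because f is bounded.
  have hFTC : ∀ n : ℕ, ∫ x in (-(n : ℝ))..n, (p x * f' x - p x * (x * f x))
      = p n * f n - p (-n) * f (-n) := by
    intro n
    refine integral_eq_of_hasDerivAt_off_countable (fun x => p x * f x) _ hs
      (hcp.mul hf).continuousOn ?_ hI.intervalIntegrable
    intro x hx
    convert! (hasDerivAt_stdPDF x).mul (hd x hx.2) using 1
    ring
  have hn : Filter.Tendsto (fun n : ℕ => (n : ℝ)) Filter.atTop Filter.atTop :=
    tendsto_natCast_atTop_atTop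
  have hlim := intervalIntegral_tendsto_integral hI
    (Filter.tendsto_neg_atTop_atBot.comp hn) hn
  have h0 : Filter.Tendsto (fun n : ℕ => p n * f n - p (-n) * f (-n)) Filter.atTop (nhds 0) := by
    have hb : Filter.Tendsto (fun n : ℕ => 2 * C * Real.exp (-(n : ℝ))) Filter.atTop (nhds 0) := by
      have := (Real.tendsto_exp_neg_atTop_nhds_zero.comp hn).const_mul (2 * C)
      simpa using this
    refine squeeze_zero_norm' ?_ hb
    filter_upwards [Filter.eventually_ge_atTop 2] with n hn2
    have hn2' : (2 : ℝ) ≤ n := by exact_mod_cast hn2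
    have hpn : ∀ y : ℝ, y ^ 2 = (n : ℝ) ^ 2 → |p y * f y| ≤ C * Real.exp (-(n : ℝ)) := by
      intro y hy
      rw [abs_mul, abs_of_nonneg (gaussianPDFReal_nonneg 0 1 y), mul_comm C]
      refine mul_le_mul ?_ (hC y) (abs_nonneg _) (Real.exp_pos _).le
      refine (stdPDF_le y).trans (Real.exp_le_exp.2 ?_)
      rw [hy]; nlinarith
    have h1 := hpn n rfl
    have h2 := hpn (-n) (by ring)
    rw [Real.norm_eq_abs]
    calc |p n * f n - p (-n) * f (-n)| ≤ |p n * f n| + |p (-n) * f (-n)| := abs_sub _ _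
      _ ≤ 2 * C * Real.exp (-(n : ℝ)) := by linarith
  have huniq := tendsto_nhds_unique (hlim.congr fun n => by simpa using hFTC n) h0
  rw [integral_sub (integrable_stdNormal_iff.1 hf') (integrable_stdNormal_iff.1 hxf)] at huniq
  rw [integral_stdNormal, integral_stdNormal]
  linarith

theorem integrable_max_sq_sub (a : ℝ) :
    Integrable (fun x : ℝ => max (x ^ 2 - a) 0) (gaussianReal 0 1) :=
  ((integrable_pow_stdNormal 2).sub (integrable_const a)).pos_part

/-- The Gaussian tail bound `E (z² - a)₊ ≤ 10 e^{-a/2} / √a`. -/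
theorem integral_max_sq_sub_le {a : ℝ} (ha : 0 < a) :
    ∫ x, max (x ^ 2 - a) 0 ∂(gaussianReal 0 1) ≤ 10 * Real.exp (-(a / 2)) / √a := by
  set r := √a with hr
  have hr0 : 0 < r := Real.sqrt_pos.2 ha
  have hra : r ^ 2 = a := Real.sq_sqrt ha.le
  -- Write |x| = r + v, so x² - a = v² + 2 r v and e^{-x²/2} = e^{-a/2} e^{-v²/2} e^{-rv}. The
  -- factor e^{-v²/2} and half of e^{-rv} absorb the polynomial, leaving the constant 5; the other
  -- half integrates to 2/r, which is the source of 1/√a.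
  set g : ℝ → ℝ := fun y => (5 * Real.exp (-(a / 2))) * (Set.Ioi r).indicator
    (fun y => Real.exp (-(r / 2) * (y - r))) y / 2 with hg
  have key : ∀ x : ℝ, gaussianPDFReal 0 1 x * max (x ^ 2 - a) 0 ≤ g |x| := by
    intro x
    rcases le_or_gt |x| r with hx | hx
    · have h1 : x ^ 2 ≤ a := by rw [← hra, ← sq_abs x]; gcongr
      rw [max_eq_right (by linarith)]
      simp [hg, hx]
    · have h1 : a ≤ x ^ 2 := by rw [← hra, ← sq_abs x]; gcongr
      rw [max_eq_left (by linarith)]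
      simp only [hg, Set.indicator, Set.mem_Ioi, hx, if_true]
      set v := |x| - r with hv
      have hv0 : 0 < v := by linarith
      have hxv : x ^ 2 = v ^ 2 + 2 * r * v + a := by rw [← sq_abs x, ← hra, hv]; ring
      rw [stdPDF_eq, hxv]
      have e1 : Real.exp (-((v ^ 2 + 2 * r * v + a) / 2)) = Real.exp (-(a / 2)) *
          (Real.exp (-(v ^ 2 / 2)) * (Real.exp (-(r / 2 * v)) * Real.exp (-(r / 2) * v))) := by
        rw [← Real.exp_add, ← Real.exp_add, ← Real.exp_add]; congr 1; ring
      rw [e1]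
      have hpi : (√(2 * Real.pi))⁻¹ ≤ 1 / 2 := by
        rw [one_div]
        refine inv_anti₀ (by norm_num) (Real.le_sqrt_of_sq_le ?_)
        nlinarith [Real.pi_gt_three]
      have b1 : v ^ 2 * Real.exp (-(v ^ 2 / 2)) ≤ 1 := by
        rw [Real.exp_neg, ← div_eq_mul_inv, div_le_one (Real.exp_pos _)]
        have := Real.quadratic_le_exp_of_nonneg (x := v ^ 2 / 2) (by positivity)
        nlinarith [sq_nonneg (v ^ 2 - 2)]
      have b2 : r * v * Real.exp (-(r / 2 * v)) ≤ 2 := by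
        rw [Real.exp_neg, ← div_eq_mul_inv, div_le_iff₀ (Real.exp_pos _)]
        have := Real.add_one_le_exp (r / 2 * v)
        nlinarith
      have c1 : Real.exp (-(v ^ 2 / 2)) ≤ 1 := Real.exp_le_one_iff.2 (by nlinarith)
      have c2 : Real.exp (-(r / 2 * v)) ≤ 1 := Real.exp_le_one_iff.2 (by nlinarith [mul_pos hr0 hv0])
      set E1 := Real.exp (-(v ^ 2 / 2))
      set E2 := Real.exp (-(r / 2 * v))
      have p1 : 0 < E1 := Real.exp_pos _
      have p2 : 0 < E2 := Real.exp_pos _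
      have hsum : (v ^ 2 + 2 * r * v) * (E1 * E2) ≤ 5 := by
        have t1 : v ^ 2 * E1 * E2 ≤ 1 * 1 := mul_le_mul b1 c2 p2.le zero_le_one
        have t2 : r * v * E2 * E1 ≤ 2 * 1 := mul_le_mul b2 c1 p1.le zero_le_two
        nlinarith
      have hrv : (0:ℝ) ≤ v ^ 2 + 2 * r * v := by positivity
      calc (√(2 * Real.pi))⁻¹ * (Real.exp (-(a / 2)) * (E1 * (E2 * Real.exp (-(r / 2) * v))))
            * (v ^ 2 + 2 * r * v + a - a)
          = (√(2 * Real.pi))⁻¹ * ((v ^ 2 + 2 * r * v) * (E1 * E2))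
            * (Real.exp (-(a / 2)) * Real.exp (-(r / 2) * v)) := by ring
        _ ≤ (1 / 2) * 5 * (Real.exp (-(a / 2)) * Real.exp (-(r / 2) * v)) := by gcongr
        _ = _ := by ring
  have hgi : IntegrableOn (fun y => Real.exp (-(r / 2) * (y - r))) (Set.Ioi r) := by
    have h : IntegrableOn (fun y => Real.exp (r / 2 * r) * Real.exp (-(r / 2) * y)) (Set.Ioi r) :=
      (integrableOn_exp_mul_Ioi (a := -(r / 2)) (by linarith) r).const_mul _
    refine h.congr_fun (fun y _ => ?_) measurableSet_Ioi
    dsimp only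
    rw [← Real.exp_add]; congr 1; ring
  have hgv : ∫ y in Set.Ioi r, Real.exp (-(r / 2) * (y - r)) = 2 / r := by
    have h := integral_exp_mul_Ioi (a := -(r / 2)) (by linarith) r
    have e : ∀ y, Real.exp (-(r / 2) * (y - r)) = Real.exp (r / 2 * r) * Real.exp (-(r / 2) * y) := by
      intro y; rw [← Real.exp_add]; congr 1; ring
    simp_rw [e]
    rw [integral_const_mul, h, neg_div_neg_eq, ← mul_div_assoc, ← Real.exp_add]
    rw [show r / 2 * r + -(r / 2) * r = 0 by ring, Real.exp_zero]
    field_simp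
  have hgint : Integrable g := by
    have := ((integrable_indicator_iff measurableSet_Ioi).2 hgi).const_mul (5 * Real.exp (-(a / 2)))
    exact this.div_const 2
  have habs : Integrable fun x => g |x| := by
    rw [← integrableOn_univ, ← Set.Iic_union_Ioi (a := (0:ℝ))]
    have hpos : IntegrableOn (fun x => g |x|) (Set.Ioi 0) :=
      hgint.integrableOn.congr_fun (fun x hx => by rw [abs_of_pos hx]) measurableSet_Ioi
    refine IntegrableOn.union ?_ hpos
    have h := (hgint.comp_neg).integrableOn (s := Set.Iic 0)
    exact h.congr_fun (fun x hx => by rw [abs_of_nonpos hx]) measurableSet_Iic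
  rw [integral_stdNormal]
  calc ∫ x, gaussianPDFReal 0 1 x * max (x ^ 2 - a) 0
      ≤ ∫ x, g |x| := integral_mono (integrable_stdNormal_iff.1 (integrable_max_sq_sub a)) habs key
    _ = 2 * ∫ x in Set.Ioi 0, g x := integral_comp_abs
    _ ≤ 2 * ∫ x, g x := by
        have : ∫ x in Set.Ioi 0, g x ≤ ∫ x, g x := by
          refine setIntegral_le_integral hgint (Filter.Eventually.of_forall fun y => ?_)
          have : 0 ≤ (Set.Ioi r).indicator (fun y => Real.exp (-(r / 2) * (y - r))) y :=
            Set.indicator_nonneg (fun _ _ => (Real.exp_pos _).le) _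
          simp only [hg, Pi.zero_apply]; positivity
        linarith
    _ = 10 * Real.exp (-(a / 2)) / r := by
        simp only [hg]
        rw [integral_div, integral_const_mul, integral_indicator measurableSet_Ioi, hgv]
        field_simp; norm_num

/-- The law of `θ + z` puts mass at most `2 δ` on `[-δ, δ]`. -/
theorem stdNormal_abs_add_le (θ : ℝ) {δ : ℝ} (hδ : 0 ≤ δ) :
    (gaussianReal 0 1).real {z | |θ + z| ≤ δ} ≤ 2 * δ := by
  have hset : {z : ℝ | |θ + z| ≤ δ} = Set.Icc (-δ - θ) (δ - θ) := by
    ext z; simp only [Set.mem_ofPred_eq, abs_le, Set.mem_Icc]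
    constructor <;> rintro ⟨h1, h2⟩ <;> constructor <;> linarith
  rw [hset, measureReal_def, gaussianReal_apply_eq_integral 0 one_ne_zero,
    ENNReal.toReal_ofReal (integral_nonneg fun x => gaussianPDFReal_nonneg 0 1 x)]
  calc ∫ x in Set.Icc (-δ - θ) (δ - θ), gaussianPDFReal 0 1 x
      ≤ ∫ x in Set.Icc (-δ - θ) (δ - θ), (1 : ℝ) :=
        setIntegral_mono (integrable_gaussianPDFReal 0 1).integrableOn
          (by simp) fun x => stdPDF_le_one x
    _ = 2 * δ := by
        simp only [setIntegral_const, smul_eq_mul, mul_one, Real.volume_real_Icc]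
        rw [max_eq_left (by linarith)]; ring

/-- A bound for the moment generating function of `z² - 1` near the origin. -/
theorem integral_exp_sq_le {t : ℝ} (h0 : 0 ≤ t) (ht : t ≤ 1 / 4) :
    Integrable (fun x : ℝ => Real.exp (t * (x ^ 2 - 1))) (gaussianReal 0 1) ∧
    ∫ x, Real.exp (t * (x ^ 2 - 1)) ∂(gaussianReal 0 1) ≤ Real.exp (2 * t ^ 2) := by
  have hb : 0 < 1 / 2 - t := by linarith
  have e : ∀ x : ℝ, gaussianPDFReal 0 1 x * Real.exp (t * (x ^ 2 - 1))
      = ((√(2 * Real.pi))⁻¹ * Real.exp (-t)) * Real.exp (-(1 / 2 - t) * x ^ 2) := by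
    intro x
    rw [stdPDF_eq, mul_assoc, mul_assoc, ← Real.exp_add, ← Real.exp_add]
    congr 2; ring
  constructor
  · rw [integrable_stdNormal_iff]
    simp_rw [e]
    exact (integrable_exp_neg_mul_sq hb).const_mul _
  · rw [integral_stdNormal]
    simp_rw [e]
    rw [integral_const_mul, integral_gaussian]
    have h2 : (√(2 * Real.pi))⁻¹ * √(Real.pi / (1 / 2 - t)) = √(1 / (1 - 2 * t)) := by
      rw [← Real.sqrt_inv, ← Real.sqrt_mul (by positivity)]
      congr 1
      have : (1 - 2 * t) ≠ 0 := by linarith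
      have := Real.pi_ne_zero
      field_simp
    rw [mul_assoc, mul_comm (Real.exp _), ← mul_assoc, h2]
    -- Squared, this is 1/(1 - 2t) ≤ e^u with u = 2t + 4t², obtained from 1 + u + u²/2 ≤ e^u; t ≤
    -- 1/4 is used in `h4`.
    have h3 : √(1 / (1 - 2 * t)) ≤ Real.exp (t + 2 * t ^ 2) := by
      refine Real.sqrt_le_iff.2 ⟨(Real.exp_pos _).le, ?_⟩
      rw [← Real.exp_nat_mul, one_div]
      have h4 : (1 - 2 * t)⁻¹ ≤ 1 + (2 * t + 4 * t ^ 2) +  (2 * t + 4 * t ^ 2) ^ 2 / 2 := by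
        rw [inv_le_iff_one_le_mul₀ (by linarith)]
        nlinarith [pow_nonneg h0 2, pow_nonneg h0 3, pow_nonneg h0 4,
          mul_nonneg (pow_nonneg h0 2) hb.le, mul_nonneg (pow_nonneg h0 3) hb.le,
          mul_nonneg (pow_nonneg h0 4) hb.le]
      refine h4.trans ?_
      have := Real.quadratic_le_exp_of_nonneg (x := 2 * t + 4 * t ^ 2) (by positivity)
      refine this.trans (Real.exp_le_exp.2 ?_)
      push_cast; nlinarith
    calc √(1 / (1 - 2 * t)) * Real.exp (-t) ≤ Real.exp (t + 2 * t ^ 2) * Real.exp (-t) := by gcongr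
      _ = Real.exp (2 * t ^ 2) := by rw [← Real.exp_add]; congr 1; ring

end OneDim

end SureBlock

namespace SureBlock

/-! ### The noise measure -/

section Noise

variable {d : ℕ}

instance : IsProbabilityMeasure (noise d) := by unfold noise; infer_instance

theorem integrable_noise_eval {f : ℝ → ℝ} (hf : Integrable f (gaussianReal 0 1)) (i : Fin d) :
    Integrable (fun z : Fin d → ℝ => f (z i)) (noise d) :=
  integrable_comp_eval hf

theorem integral_noise_eval {f : ℝ → ℝ} (hf : Measurable f) (i : Fin d) :
    ∫ z, f (z i) ∂(noise d) = ∫ x, f x ∂(gaussianReal 0 1) :=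
  integral_comp_eval hf.aestronglyMeasurable

theorem noise_real_eval {s : Set ℝ} (hs : MeasurableSet s) (i : Fin d) :
    (noise d).real {z | z i ∈ s} = (gaussianReal 0 1).real s := by
  have h := measurePreserving_eval (fun _ : Fin d => gaussianReal 0 1) i
  exact h.measureReal_preimage hs.nullMeasurableSet

/-- Resampling one coordinate independently does not change the law. This is Fubini in a single
coordinate, in the form in which the one-dimensional Stein identity is applied below. -/
theorem measurePreserving_update (i : Fin d) :
    MeasurePreserving (fun p : (Fin d → ℝ) × ℝ => Function.update p.1 i p.2)
      ((noise d).prod (gaussianReal 0 1)) (noise d) := by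
  have hm : Measurable fun p : (Fin d → ℝ) × ℝ => Function.update p.1 i p.2 := by
    refine measurable_pi_iff.2 fun j => ?_
    by_cases hj : j = i
    · subst hj; simpa using measurable_snd
    · simp only [ne_eq, hj, not_false_eq_true, Function.update_of_ne]
      exact (measurable_pi_apply j).comp measurable_fst
  refine ⟨hm, ?_⟩
  unfold noise
  refine (Measure.pi_eq fun s hs => ?_).symm
  rw [Measure.map_apply hm (MeasurableSet.univ_pi hs)]
  have hpre : (fun p : (Fin d → ℝ) × ℝ => Function.update p.1 i p.2) ⁻¹' (Set.univ.pi s)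
      = (Set.univ.pi (Function.update s i Set.univ)) ×ˢ s i := by
    ext ⟨z, y⟩
    simp only [Set.mem_preimage, Set.mem_pi, Set.mem_univ, true_implies, Set.mem_prod]
    constructor
    · intro h
      refine ⟨fun j => ?_, by simpa using h i⟩
      by_cases hj : j = i
      · subst hj; simp
      · simpa [hj] using h j
    · rintro ⟨h1, h2⟩ j
      by_cases hj : j = i
      · subst hj; simpa using h2
      · simpa [hj] using h1 j
  rw [hpre, Measure.prod_prod, Measure.pi_pi, ← Finset.mul_prod_erase _ _ (Finset.mem_univ i),
    ← Finset.mul_prod_erase _ (fun j => (gaussianReal 0 1) (s j)) (Finset.mem_univ i)]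
  simp only [Function.update_self, measure_univ, one_mul]
  rw [mul_comm]
  congr 1
  exact Finset.prod_congr rfl fun j hj => by
    rw [Function.update_of_ne (Finset.ne_of_mem_erase hj)]

/-- A function whose mean in one coordinate vanishes has mean zero. -/
theorem integral_noise_eq_zero_of_update {g : (Fin d → ℝ) → ℝ} (hg : Integrable g (noise d))
    (i : Fin d) (h : ∀ z, ∫ y, g (Function.update z i y) ∂(gaussianReal 0 1) = 0) :
    ∫ z, g z ∂(noise d) = 0 := by
  have hmp := measurePreserving_update i
  rw [← hmp.map_eq, integral_map hmp.measurable.aemeasurable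
    (by rw [hmp.map_eq]; exact hg.aestronglyMeasurable)]
  rw [integral_prod _ (by exact hmp.integrable_comp_of_integrable hg)]
  simp [h]

theorem measurePreserving_neg_noise :
    MeasurePreserving (fun z : Fin d → ℝ => -z) (noise d) (noise d) := by
  have h1 : MeasurePreserving (fun x : ℝ => -x) (gaussianReal 0 1) (gaussianReal 0 1) :=
    ⟨measurable_neg, by simp [gaussianReal_map_neg]⟩
  exact measurePreserving_pi _ _ fun _ => h1

theorem integral_noise_neg (f : (Fin d → ℝ) → ℝ) :
    ∫ z, f (-z) ∂(noise d) = ∫ z, f z ∂(noise d) :=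
  measurePreserving_neg_noise.integral_comp (MeasurableEquiv.neg _).measurableEmbedding f

/-- Discards the null set on which a block could have sum of squares zero and the conventions for
division by zero would matter. -/
theorem ae_add_ne_zero (θ : Fin d → ℝ) : ∀ᵐ z ∂(noise d), ∀ i, (θ + z) i ≠ 0 := by
  rw [ae_all_iff]
  intro i
  have h := measurePreserving_eval (fun _ : Fin d => gaussianReal 0 1) i
  have hna := nullSingletonClass_gaussianReal (μ := 0) (v := 1) one_ne_zero
  have h0 : ∀ᵐ x ∂(gaussianReal 0 1), x ≠ -θ i := by
    rw [ae_iff]; simp [hna.measure_singleton]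
  filter_upwards [h.quasiMeasurePreserving.ae h0] with z hz hc
  exact hz (by simp only [Pi.add_apply] at hc; simp only [Function.eval]; linarith)

theorem memLp_two_pow_stdNormal (n : ℕ) : MemLp (fun x : ℝ => x ^ n) 2 (gaussianReal 0 1) := by
  rw [memLp_two_iff_integrable_sq (by fun_prop)]
  simpa [← pow_mul] using integrable_pow_stdNormal (n * 2)

/-- Second moment of a sum of independent centered terms. -/
theorem integral_sq_sum_noise {f : Fin d → ℝ → ℝ} (hf : ∀ i, MemLp (f i) 2 (gaussianReal 0 1))
    (h0 : ∀ i, ∫ x, f i x ∂(gaussianReal 0 1) = 0) :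
    Integrable (fun z : Fin d → ℝ => (∑ i, f i (z i)) ^ 2) (noise d) ∧
    ∫ z, (∑ i, f i (z i)) ^ 2 ∂(noise d) = ∑ i, ∫ x, f i x ^ 2 ∂(gaussianReal 0 1) := by
  have hL : ∀ i, MemLp (fun z : Fin d → ℝ => f i (z i)) 2 (noise d) := fun i =>
    (hf i).comp_measurePreserving (measurePreserving_eval (fun _ : Fin d => gaussianReal 0 1) i)
  have hLs : MemLp (fun z : Fin d → ℝ => ∑ i, f i (z i)) 2 (noise d) :=
    memLp_finsetSum _ fun i _ => hL i
  refine ⟨hLs.integrable_sq, ?_⟩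
  have h := variance_sum_pi (μ := fun _ : Fin d => gaussianReal 0 1) (X := f) hf
  have e : (∑ i, fun z : Fin d → ℝ => f i (z i)) = fun z => ∑ i, f i (z i) := by
    ext z; simp
  rw [e, ← noise, variance_of_integral_eq_zero hLs.aestronglyMeasurable.aemeasurable] at h
  · rw [h]
    refine Finset.sum_congr rfl fun i _ => ?_
    rw [variance_of_integral_eq_zero (hf i).aestronglyMeasurable.aemeasurable (h0 i)]
  · change ∫ z, ∑ i, f i (z i) ∂(noise d) = 0
    rw [integral_finsetSum _ fun i _ => (hL i).integrable (by norm_num)]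
    refine Finset.sum_eq_zero fun i _ => ?_
    rw [← h0 i]
    exact integral_comp_eval (hf i).aestronglyMeasurable

/-- The second moment of `z² - 1`. -/
noncomputable def chiVar : ℝ := ∫ x, (x ^ 2 - 1) ^ 2 ∂(gaussianReal 0 1)

theorem chiVar_nonneg : 0 ≤ chiVar := integral_nonneg fun _ => sq_nonneg _

theorem integral_sq_chi (B : Finset (Fin d)) :
    Integrable (fun z : Fin d → ℝ => (∑ i ∈ B, (z i ^ 2 - 1)) ^ 2) (noise d) ∧
    ∫ z, (∑ i ∈ B, (z i ^ 2 - 1)) ^ 2 ∂(noise d) = B.card * chiVar := by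
  have hL : MemLp (fun x : ℝ => x ^ 2 - 1) 2 (gaussianReal 0 1) :=
    (memLp_two_pow_stdNormal 2).sub (memLp_const 1)
  have h := integral_sq_sum_noise (d := d)
    (f := fun i x => if i ∈ B then x ^ 2 - 1 else 0)
    (fun i => by by_cases hi : i ∈ B <;> simp [hi, hL])
    (fun i => by
      by_cases hi : i ∈ B
      · simp only [hi, if_true]
        rw [integral_sub (integrable_pow_stdNormal 2) (integrable_const 1), integral_sq_stdNormal]
        simp
      · simp [hi])
  simp only [Finset.sum_ite_mem, Finset.univ_inter] at h
  refine ⟨h.1, h.2.trans ?_⟩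
  have : ∀ i, ∫ x, (if i ∈ B then x ^ 2 - 1 else 0) ^ 2 ∂(gaussianReal 0 1)
      = if i ∈ B then chiVar else 0 := by
    intro i; by_cases hi : i ∈ B <;> simp [hi, chiVar]
  simp only [this, Finset.sum_ite_mem, Finset.univ_inter, Finset.sum_const, nsmul_eq_mul]

theorem integral_sq_lin (θ : Fin d → ℝ) (B : Finset (Fin d)) :
    Integrable (fun z : Fin d → ℝ => (∑ i ∈ B, z i * θ i) ^ 2) (noise d) ∧
    ∫ z, (∑ i ∈ B, z i * θ i) ^ 2 ∂(noise d) = ∑ i ∈ B, θ i ^ 2 := by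
  have hL : MemLp (fun x : ℝ => x) 2 (gaussianReal 0 1) := by
    simpa using memLp_two_pow_stdNormal 1
  have h := integral_sq_sum_noise (d := d)
    (f := fun i x => if i ∈ B then x * θ i else 0)
    (fun i => by by_cases hi : i ∈ B <;> simp [hi, hL.mul_const])
    (fun i => by
      by_cases hi : i ∈ B
      · simp only [hi, if_true]
        rw [integral_mul_const, integral_id_gaussianReal, zero_mul]
      · simp [hi])
  simp only [Finset.sum_ite_mem, Finset.univ_inter] at h
  refine ⟨h.1, h.2.trans ?_⟩
  have : ∀ i, ∫ x, (if i ∈ B then x * θ i else 0) ^ 2 ∂(gaussianReal 0 1)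
      = if i ∈ B then θ i ^ 2 else 0 := by
    intro i
    by_cases hi : i ∈ B
    · simp only [hi, if_true, mul_pow]
      rw [integral_mul_const, integral_sq_stdNormal, one_mul]
    · simp [hi]
  simp only [this, Finset.sum_ite_mem, Finset.univ_inter]

theorem integrable_exp_sum_noise {f : Fin d → ℝ → ℝ}
    (hf : ∀ i, Integrable (fun x => Real.exp (f i x)) (gaussianReal 0 1)) :
    Integrable (fun z : Fin d → ℝ => Real.exp (∑ i, f i (z i))) (noise d) := by
  simp_rw [Real.exp_sum]
  exact Integrable.fintype_prod (f := fun i x => Real.exp (f i x)) hf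

theorem integral_exp_sum_noise (f : Fin d → ℝ → ℝ) :
    ∫ z, Real.exp (∑ i, f i (z i)) ∂(noise d) = ∏ i, ∫ x, Real.exp (f i x) ∂(gaussianReal 0 1) := by
  simp_rw [Real.exp_sum]
  exact integral_fintype_prod_eq_prod (μ := fun _ : Fin d => gaussianReal 0 1)
    fun i x => Real.exp (f i x)

/-- A function of the coordinates in S factors through the restriction to S (extend by zero
outside), and restrictions to disjoint sets are independent. -/
theorem indepFun_of_dependsOn {X Y : (Fin d → ℝ) → ℝ} (hX : Measurable X) (hY : Measurable Y)
    {S T : Finset (Fin d)} (hST : Disjoint S T) (hXS : DependsOn X (S : Set (Fin d)))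
    (hYT : DependsOn Y (T : Set (Fin d))) : IndepFun X Y (noise d) := by
  have hind : iIndepFun (fun (i : Fin d) (z : Fin d → ℝ) => z i) (noise d) :=
    iIndepFun_pi (X := fun (_ : Fin d) (x : ℝ) => x) fun _ => aemeasurable_id
  have h := hind.indepFun_finset S T hST fun i => measurable_pi_apply i
  have ext_meas : ∀ U : Finset (Fin d), Measurable
      fun (y : U → ℝ) (i : Fin d) => if hi : i ∈ U then y ⟨i, hi⟩ else 0 := by
    intro U
    refine measurable_pi_iff.2 fun i => ?_
    by_cases hi : i ∈ U
    · simpa [hi] using measurable_pi_apply _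
    · simp [hi]
  have h2 := h.comp (hX.comp (ext_meas S)) (hY.comp (ext_meas T))
  convert! h2 using 1
  · ext z; exact hXS fun i hi => by simp [Finset.mem_coe.1 hi]
  · ext z; exact hYT fun i hi => by simp [Finset.mem_coe.1 hi]

/-- A sum of centered bounded functions of disjoint groups of coordinates is sub-Gaussian. -/
theorem hasSubgaussianMGF_sum_of_dependsOn {X : ℕ → (Fin d → ℝ) → ℝ} {B : ℕ → Finset (Fin d)}
    {M : ℝ} (hM : 0 ≤ M) (hX : ∀ b, Measurable (X b)) (hB : ∀ a b, a ≠ b → Disjoint (B a) (B b))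
    (hXB : ∀ b, DependsOn (X b) (B b : Set (Fin d))) (hb : ∀ b z, |X b z| ≤ M) (n : ℕ) :
    HasSubgaussianMGF (fun z => ∑ b ∈ Finset.range n, (X b z - ∫ y, X b y ∂(noise d)))
      (n * (M ^ 2).toNNReal) (noise d) := by
  -- Hoeffding's lemma on [-M, M], with parameter (2M/2)² = M².
  have hone : ∀ b, HasSubgaussianMGF (fun z => X b z - ∫ y, X b y ∂(noise d))
      (M ^ 2).toNNReal (noise d) := by
    intro b
    have h := hasSubgaussianMGF_of_mem_Icc (μ := noise d) (X := X b) (a := -M) (b := M)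
      (hX b).aemeasurable (Filter.Eventually.of_forall fun z => abs_le.1 (hb b z))
    convert! h using 1
    ext
    simp only [Real.coe_toNNReal _ (sq_nonneg M), NNReal.coe_pow, NNReal.coe_div, coe_nnnorm, NNReal.coe_ofNat,
      Real.norm_eq_abs]
    rw [sub_neg_eq_add, abs_of_nonneg (by linarith)]; ring
  induction n with
  | zero => simp
  | succ n ih =>
    simp_rw [Finset.sum_range_succ]
    have hdep : DependsOn (fun z => ∑ b ∈ Finset.range n, (X b z - ∫ y, X b y ∂(noise d)))
        ((Finset.range n).biUnion B : Set (Fin d)) := by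
      intro x y hxy
      refine Finset.sum_congr rfl fun b hb' => ?_
      congr 1
      exact hXB b fun i hi => hxy i (by
        simp only [Finset.coe_biUnion, Set.mem_iUnion]
        exact ⟨b, hb', hi⟩)
    have hdep' : DependsOn (fun z => X n z - ∫ y, X n y ∂(noise d)) (B n : Set (Fin d)) := by
      intro x y hxy
      simp only [hXB n hxy]
    have hdisj : Disjoint ((Finset.range n).biUnion B) (B n) := by
      rw [Finset.disjoint_biUnion_left]
      intro b hb'
      exact hB b n (Finset.mem_range.1 hb').ne
    have hdep2 : DependsOn (fun z => ∑ b ∈ Finset.range n, (X b z - ∫ y, X b y ∂(noise d)))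
        (((Finset.range n).biUnion B : Finset (Fin d)) : Set (Fin d)) := by
      simpa using hdep
    have hi := indepFun_of_dependsOn
      (X := fun z => ∑ b ∈ Finset.range n, (X b z - ∫ y, X b y ∂(noise d)))
      (Y := fun z => X n z - ∫ y, X n y ∂(noise d))
      (Finset.measurable_fun_sum _ fun b _ => (hX b).sub_const _) ((hX n).sub_const _)
      hdisj hdep2 hdep'
    have h := ih.add_of_indepFun (hone n) hi
    convert! h using 1
    push_cast; ring

end Noise

end SureBlock

namespace SureBlock

noncomputable section

/-! ### Loss, SURE and their difference on one group of coordinates -/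

section BlockAlgebra

variable {d : ℕ}

/-- The fraction of the observations removed by shrinkage at threshold `lam`. -/
def shrinkWeight (lam s : ℝ) : ℝ := lam / max s lam

/-- The sum of squares of the observations in a group of coordinates. -/
def groupSq (x : Fin d → ℝ) (B : Finset (Fin d)) : ℝ := ∑ i ∈ B, x i ^ 2

/-- The squared error of James–Stein shrinkage on a group of coordinates. -/
def groupLoss (θ : Fin d → ℝ) (B : Finset (Fin d)) (lam : ℝ) (z : Fin d → ℝ) : ℝ :=
  ∑ i ∈ B, (z i - shrinkWeight lam (groupSq (θ + z) B) * (θ i + z i)) ^ 2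

/-- The difference of the squared error and SURE on a group of coordinates. -/
def groupDev (θ : Fin d → ℝ) (B : Finset (Fin d)) (lam : ℝ) (z : Fin d → ℝ) : ℝ :=
  ∑ i ∈ B, (z i ^ 2 - 1) + 2 * (B.card - 2 - ∑ i ∈ B, z i * (θ i + z i)) *
    shrinkWeight lam (groupSq (θ + z) B) + if groupSq (θ + z) B ≤ lam then 4 else 0

theorem groupSq_nonneg (x : Fin d → ℝ) (B : Finset (Fin d)) : 0 ≤ groupSq x B :=
  Finset.sum_nonneg fun _ _ => sq_nonneg _

theorem groupSq_pos {x : Fin d → ℝ} {B : Finset (Fin d)} (hB : B.Nonempty)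
    (hx : ∀ i, x i ≠ 0) : 0 < groupSq x B :=
  Finset.sum_pos (fun i _ => pow_pos_of_ne_zero_sq (hx i)) hB
where
  pow_pos_of_ne_zero_sq {a : ℝ} (h : a ≠ 0) : 0 < a ^ 2 := by positivity

theorem shrinkWeight_nonneg {lam s : ℝ} (hl : 0 ≤ lam) : 0 ≤ shrinkWeight lam s :=
  div_nonneg hl (hl.trans (le_max_right _ _))

theorem shrinkWeight_le_one {lam s : ℝ} (hl : 0 ≤ lam) : shrinkWeight lam s ≤ 1 :=
  div_le_one_of_le₀ (le_max_right _ _) (hl.trans (le_max_right _ _))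

theorem shrinkWeight_of_le {lam s : ℝ} (hs : 0 < s) (h : s ≤ lam) : shrinkWeight lam s = 1 := by
  rw [shrinkWeight, max_eq_right h, div_self (by linarith)]

theorem shrinkWeight_of_ge {lam s : ℝ} (h : lam ≤ s) : shrinkWeight lam s = lam / s := by
  rw [shrinkWeight, max_eq_left h]

/-- The part that shrinkage removes from the observations has squared norm λ²/s if s ≥ λ and s
otherwise. This bound, free of θ, controls losses and deviations throughout. -/
theorem shrinkWeight_sq_mul_le {lam s : ℝ} (hl : 0 ≤ lam) (hs : 0 ≤ s) :
    shrinkWeight lam s ^ 2 * s ≤ lam := by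
  rcases le_total lam s with h | h
  · rw [shrinkWeight_of_ge h]
    rcases hs.eq_or_lt with h0 | h0
    · subst h0; simpa using hl
    · rw [div_pow, div_mul_eq_mul_div, div_le_iff₀ (by positivity)]
      nlinarith [mul_nonneg hl hs]
  · have h1 := shrinkWeight_le_one (s := s) hl
    have h0 := shrinkWeight_nonneg (s := s) hl
    nlinarith [mul_le_mul h1 h1 h0 zero_le_one]

theorem groupLoss_eq (θ : Fin d → ℝ) (B : Finset (Fin d)) (lam : ℝ) (z : Fin d → ℝ) :
    groupLoss θ B lam z = ∑ i ∈ B, z i ^ 2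
      - 2 * shrinkWeight lam (groupSq (θ + z) B) * ∑ i ∈ B, z i * (θ i + z i)
      + shrinkWeight lam (groupSq (θ + z) B) ^ 2 * groupSq (θ + z) B := by
  unfold groupLoss
  set w := shrinkWeight lam (groupSq (θ + z) B)
  simp only [groupSq, Finset.mul_sum, Pi.add_apply]
  rw [← Finset.sum_sub_distrib, ← Finset.sum_add_distrib]
  exact Finset.sum_congr rfl fun i _ => by ring

theorem groupLoss_nonneg (θ : Fin d → ℝ) (B : Finset (Fin d)) (lam : ℝ) (z : Fin d → ℝ) :
    0 ≤ groupLoss θ B lam z := Finset.sum_nonneg fun _ _ => sq_nonneg _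

theorem groupLoss_le (θ : Fin d → ℝ) (B : Finset (Fin d)) {lam : ℝ} (hl : 0 ≤ lam)
    (z : Fin d → ℝ) : groupLoss θ B lam z ≤ 2 * ∑ i ∈ B, z i ^ 2 + 2 * lam := by
  have h := shrinkWeight_sq_mul_le hl (groupSq_nonneg (θ + z) B)
  calc groupLoss θ B lam z
      ≤ ∑ i ∈ B, (2 * z i ^ 2
          + 2 * (shrinkWeight lam (groupSq (θ + z) B) ^ 2 * (θ + z) i ^ 2)) := by
        refine Finset.sum_le_sum fun i _ => ?_
        simp only [Pi.add_apply]
        nlinarith [sq_nonneg (z i + shrinkWeight lam (groupSq (θ + z) B) * (θ i + z i))]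
    _ = 2 * ∑ i ∈ B, z i ^ 2
          + 2 * (shrinkWeight lam (groupSq (θ + z) B) ^ 2 * groupSq (θ + z) B) := by
        rw [Finset.sum_add_distrib, ← Finset.mul_sum, ← Finset.mul_sum, ← Finset.mul_sum]; rfl
    _ ≤ _ := by linarith

/-- Algebra in the two regimes. The James–Stein correction -2 to the dimension belongs to s > λ
only; for s ≤ λ the summand 4 in `groupDev` takes it away again. -/
theorem groupLoss_eq_sureTerm_add {θ : Fin d → ℝ} {B : Finset (Fin d)} {lam : ℝ} {z : Fin d → ℝ}
    (hs : 0 < groupSq (θ + z) B) :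
    groupLoss θ B lam z = sureTerm B.card (groupSq (θ + z) B) lam + groupDev θ B lam z := by
  rw [groupLoss_eq, groupDev, sureTerm]
  have hq : ∑ i ∈ B, (z i ^ 2 - 1) = ∑ i ∈ B, z i ^ 2 - B.card := by
    rw [Finset.sum_sub_distrib]; simp
  rw [hq]
  set s := groupSq (θ + z) B
  rcases le_or_gt s lam with h | h
  · simp only [h, not_lt.2 h, if_true, if_false, shrinkWeight_of_le hs h]; ring
  · simp only [h, not_le.2 h, if_true, if_false, shrinkWeight_of_ge h.le]
    field_simp; ring

theorem sq_sum_mul_le (θ z : Fin d → ℝ) (B : Finset (Fin d)) :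
    (∑ i ∈ B, z i * (θ i + z i)) ^ 2 ≤ (∑ i ∈ B, z i ^ 2) * groupSq (θ + z) B :=
  Finset.sum_mul_sq_le_sq_mul_sq B z (θ + z)

/-- The only dangerous term is ⟨z, x⟩ w, with w the weight. By Cauchy–Schwarz its square is at most
‖z‖² w² s ≤ ‖z‖² λ, so the bound does not involve θ. -/
theorem abs_groupDev_le (θ : Fin d → ℝ) (B : Finset (Fin d)) {lam : ℝ} (hl : 0 ≤ lam)
    (z : Fin d → ℝ) :
    |groupDev θ B lam z| ≤ 2 * ∑ i ∈ B, z i ^ 2 + 3 * B.card + 8 + lam := by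
  have hq : ∑ i ∈ B, (z i ^ 2 - 1) = ∑ i ∈ B, z i ^ 2 - B.card := by
    rw [Finset.sum_sub_distrib]; simp
  rw [groupDev, hq]
  have hcs := sq_sum_mul_le θ z B
  have hw := shrinkWeight_sq_mul_le hl (groupSq_nonneg (θ + z) B)
  have hw1 := shrinkWeight_le_one (s := groupSq (θ + z) B) hl
  have hw0 := shrinkWeight_nonneg (s := groupSq (θ + z) B) hl
  have hq0 : 0 ≤ ∑ i ∈ B, z i ^ 2 := Finset.sum_nonneg fun _ _ => sq_nonneg _
  have hite : (0 : ℝ) ≤ (if groupSq (θ + z) B ≤ lam then 4 else 0) ∧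
      (if groupSq (θ + z) B ≤ lam then (4 : ℝ) else 0) ≤ 4 := by split_ifs <;> norm_num
  have hl0 : (0 : ℝ) ≤ B.card := Nat.cast_nonneg _
  set s := groupSq (θ + z) B
  set w := shrinkWeight lam s
  set q := ∑ i ∈ B, z i ^ 2
  set v := ∑ i ∈ B, z i * (θ i + z i)
  have hvw : |v * w| ≤ (q + lam) / 2 := by
    refine abs_le_of_sq_le_sq ?_ (by positivity)
    have : (v * w) ^ 2 ≤ q * lam := by
      calc (v * w) ^ 2 = v ^ 2 * w ^ 2 := by ring
        _ ≤ q * s * w ^ 2 := by gcongr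
        _ = q * (w ^ 2 * s) := by ring
        _ ≤ q * lam := by gcongr
    nlinarith [sq_nonneg (q - lam)]
  have h2 := abs_le.1 hvw
  have h3 : (B.card : ℝ) * w ≤ B.card := mul_le_of_le_one_right hl0 hw1
  have h4 : 0 ≤ (B.card : ℝ) * w := mul_nonneg hl0 hw0
  rw [abs_le]
  constructor <;> nlinarith [hite.1, hite.2]

theorem sq_sum_abs_ge (z : Fin d → ℝ) (B : Finset (Fin d)) :
    ∑ i ∈ B, z i ^ 2 ≤ (∑ i ∈ B, |z i|) ^ 2 := by
  have h := Finset.sum_sq_le_sq_sum_of_nonneg (s := B) (f := fun i => |z i|) fun i _ => abs_nonneg _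
  simpa using h

/-- Passing to a slightly larger threshold decreases the difference of loss and SURE by little. -/
theorem groupDev_le_of_lt {θ : Fin d → ℝ} {B : Finset (Fin d)} {lam lam' η : ℝ} {z : Fin d → ℝ}
    (hB : B.Nonempty) (hx : ∀ i, (θ + z) i ≠ 0) (h0 : 0 ≤ lam) (h1 : lam < lam')
    (h2 : lam' ≤ lam + η) (h3 : η ≤ lam') :
    groupDev θ B lam z ≤ groupDev θ B lam' z
      + 2 * ∑ i ∈ B, (√η * |z i| + min (η / (θ + z) i ^ 2) 1) := by
  have hs := groupSq_pos hB hx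
  have hcs := sq_sum_mul_le θ z B
  have hη : 0 < η := by linarith
  have hcard : (1 : ℝ) ≤ B.card := by exact_mod_cast hB.card_pos
  have hq0 : 0 ≤ ∑ i ∈ B, z i ^ 2 := Finset.sum_nonneg fun _ _ => sq_nonneg _
  have hqa := sq_sum_abs_ge z B
  have hsi : ∀ i ∈ B, (θ + z) i ^ 2 ≤ groupSq (θ + z) B := fun i hi =>
    Finset.single_le_sum (f := fun i => (θ + z) i ^ 2) (fun _ _ => sq_nonneg _) hi
  have hia : (0 : ℝ) ≤ ∑ i ∈ B, |z i| := Finset.sum_nonneg fun _ _ => abs_nonneg _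
  unfold groupDev
  set s := groupSq (θ + z) B
  set v := ∑ i ∈ B, z i * (θ i + z i)
  set q := ∑ i ∈ B, z i ^ 2
  set A := ∑ i ∈ B, |z i|
  set δ := shrinkWeight lam' s - shrinkWeight lam s with hδ
  have hm : 0 < max s lam' := lt_max_of_lt_left hs
  -- The weight grows by at most (λ' - λ)/max(s, λ'), including when s lies between the two
  -- thresholds.
  have hδ2 : 0 ≤ δ ∧ δ ≤ (lam' - lam) / max s lam' := by
    rcases le_or_gt s lam with h | h
    · rw [hδ, shrinkWeight_of_le hs h, shrinkWeight_of_le hs (h.trans h1.le)]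
      simp only [sub_self, le_refl, true_and]
      exact div_nonneg (by linarith) hm.le
    · rcases le_or_gt s lam' with h' | h'
      · rw [hδ, shrinkWeight_of_ge h.le, shrinkWeight_of_le hs h', max_eq_right h']
        constructor
        · rw [sub_nonneg, div_le_one hs]; exact h.le
        · rw [sub_div, div_self (by linarith)]
          have := div_le_div_of_nonneg_left h0 hs h'
          linarith
      · rw [hδ, shrinkWeight_of_ge h.le, shrinkWeight_of_ge h'.le, max_eq_left h'.le, sub_div]
        refine ⟨?_, le_rfl⟩
        rw [← sub_div]; exact div_nonneg (by linarith) hs.le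
  have hδη : δ ≤ η / max s lam' := hδ2.2.trans (by gcongr; linarith)
  have hvδ : |v| * δ ≤ √η * A := by
    refine (sq_le_sq₀ (mul_nonneg (abs_nonneg _) hδ2.1) (by positivity)).1 ?_
    rw [mul_pow, mul_pow, sq_abs, Real.sq_sqrt hη.le]
    have e1 : δ ^ 2 ≤ (η / max s lam') ^ 2 := pow_le_pow_left₀ hδ2.1 hδη 2
    have e2 : (η / max s lam') ^ 2 * s ≤ η := by
      have h5 : s ≤ max s lam' := le_max_left _ _
      have h6 : η ≤ max s lam' := h3.trans (le_max_right _ _)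
      rw [div_pow, div_mul_eq_mul_div, div_le_iff₀ (by positivity)]
      calc η ^ 2 * s = η * (η * s) := by ring
        _ ≤ η * (max s lam' * max s lam') := by gcongr
        _ = η * max s lam' ^ 2 := by ring
    calc v ^ 2 * δ ^ 2 ≤ (q * s) * (η / max s lam') ^ 2 := by gcongr
      _ = q * ((η / max s lam') ^ 2 * s) := by ring
      _ ≤ A ^ 2 * η := by gcongr
      _ = η * A ^ 2 := by ring
  -- Here δ can be as large as 1 when all observations in the block are small; the minimum records
  -- that this needs small observations, which are rare.
  have hcδ : (B.card : ℝ) * δ ≤ ∑ i ∈ B, min (η / (θ + z) i ^ 2) 1 := by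
    rw [← nsmul_eq_mul]
    refine Finset.card_nsmul_le_sum _ _ _ fun i hi => ?_
    have hpos : 0 < (θ + z) i ^ 2 := by have := hx i; positivity
    refine le_min ?_ ?_
    · refine hδη.trans (div_le_div_of_nonneg_left hη.le hpos ?_)
      exact (hsi i hi).trans (le_max_left _ _)
    · have := shrinkWeight_le_one (s := s) (h0.trans h1.le)
      have := shrinkWeight_nonneg (s := s) h0
      linarith
  -- The jump term of `groupDev` can only grow with the threshold. Hence the move to the grid must
  -- go upwards.
  have hite : (if s ≤ lam then (4 : ℝ) else 0) ≤ if s ≤ lam' then 4 else 0 := by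
    split_ifs <;> linarith
  rw [Finset.sum_add_distrib, ← Finset.mul_sum]
  have hv := abs_le.1 (le_refl |v|)
  have e : shrinkWeight lam' s = shrinkWeight lam s + δ := by rw [hδ]; ring
  rw [e]
  have e3 : v * δ ≤ |v| * δ := mul_le_mul_of_nonneg_right hv.2 hδ2.1
  nlinarith [mul_le_mul_of_nonneg_right hcard hδ2.1]

/-- Here A, q, p stand for ‖θ‖², ‖z‖², ⟨z, θ⟩ on a block, and the two summands are the changes of
the loss at z and at -z; at -z the sum of squares t is the smaller one. If t ≤ λ, nothing changes at
-z and the loss at z does not decrease. If t > λ, raise the threshold first to min(λ', t): the cross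
terms of the two changes combine to the nonnegative 8 p². From there on only the loss at z changes,
and 3p ≤ A, that is q + p ≤ t, makes it increase. -/
theorem sub_mul_div_nonneg_of_symm {A q p lam lam' : ℝ} (hp : 0 ≤ p) (hq : 0 ≤ q)
    (hl : q ≤ lam) (hll : lam ≤ lam') (hA : 3 * p ≤ A) (hs' : 0 < A + q - 2 * p) :
    0 ≤ (min lam' (A + q + 2 * p) - min lam (A + q + 2 * p)) *
        (min lam' (A + q + 2 * p) + min lam (A + q + 2 * p) - 2 * (q + p)) / (A + q + 2 * p)
      + (min lam' (A + q - 2 * p) - min lam (A + q - 2 * p)) *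
        (min lam' (A + q - 2 * p) + min lam (A + q - 2 * p) - 2 * (q - p)) / (A + q - 2 * p) := by
  set s := A + q + 2 * p with hs
  set t := A + q - 2 * p with ht
  have hst : t ≤ s := by linarith
  have hs0 : 0 < s := by linarith
  have hvt : q + p ≤ t := by linarith
  rcases le_or_gt t lam with h | h
  · rw [min_eq_right h, min_eq_right (h.trans hll)]
    simp only [sub_self, zero_mul, zero_div, add_zero]
    refine div_nonneg (mul_nonneg ?_ ?_) hs0.le
    · exact sub_nonneg.2 (min_le_min_right _ hll)
    · have h1 : t ≤ min lam s := le_min h hst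
      have h2 : t ≤ min lam' s := le_min (h.trans hll) hst
      linarith
  · rw [min_eq_left h.le, min_eq_left (h.le.trans hst)]
    set σ := min lam' t with hσ
    have hσ1 : lam ≤ σ := le_min hll h.le
    have hσt : σ ≤ t := min_le_right _ _
    have key : 0 ≤ (σ - lam) * (σ + lam - 2 * (q + p)) / s
        + (σ - lam) * (σ + lam - 2 * (q - p)) / t := by
      have : (σ - lam) * (σ + lam - 2 * (q + p)) / s + (σ - lam) * (σ + lam - 2 * (q - p)) / t
          = (σ - lam) * ((σ + lam - 2 * q) * (2 * (A + q)) + 8 * p ^ 2) / (s * t) := by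
        have := hs0.ne'; have := hs'.ne'
        field_simp; rw [hs, ht]; ring
      rw [this]
      have hA0 : 0 ≤ A := by linarith
      have h3 : 0 ≤ σ + lam - 2 * q := by linarith
      have h4 : 0 ≤ σ - lam := by linarith
      positivity
    have mono : (σ - lam) * (σ + lam - 2 * (q + p)) / s
        ≤ (min lam' s - lam) * (min lam' s + lam - 2 * (q + p)) / s := by
      refine div_le_div_of_nonneg_right ?_ hs0.le
      rcases le_or_gt lam' t with h5 | h5
      · rw [hσ, min_eq_left h5, min_eq_left (h5.trans hst)]
      · rw [hσ, min_eq_right h5.le]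
        have h6 : t ≤ min lam' s := le_min h5.le hst
        nlinarith [mul_nonneg (sub_nonneg.2 h6) (show 0 ≤ min lam' s + t - 2 * (q + p) by linarith)]
    linarith

/-- In u = min(λ, s) the loss is the quadratic ‖z‖² - 2 u v/s + u²/s with v = ⟨z, x⟩, so its
increments factor. -/
theorem groupLoss_sub {θ : Fin d → ℝ} {B : Finset (Fin d)} {lam lam' : ℝ} {z : Fin d → ℝ}
    (hs : 0 < groupSq (θ + z) B) :
    groupLoss θ B lam' z - groupLoss θ B lam z
      = (min lam' (groupSq (θ + z) B) - min lam (groupSq (θ + z) B)) *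
        (min lam' (groupSq (θ + z) B) + min lam (groupSq (θ + z) B)
          - 2 * ∑ i ∈ B, z i * (θ i + z i)) / groupSq (θ + z) B := by
  have hw : ∀ t, shrinkWeight t (groupSq (θ + z) B)
      = min t (groupSq (θ + z) B) / groupSq (θ + z) B := by
    intro t
    rcases le_total t (groupSq (θ + z) B) with h | h
    · rw [shrinkWeight_of_ge h, min_eq_left h]
    · rw [shrinkWeight_of_le hs h, min_eq_right h, div_self hs.ne']
  rw [groupLoss_eq, groupLoss_eq, hw, hw]
  field_simp; ring

theorem groupSq_add (θ z : Fin d → ℝ) (B : Finset (Fin d)) :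
    groupSq (θ + z) B = ∑ i ∈ B, θ i ^ 2 + ∑ i ∈ B, z i ^ 2 + 2 * ∑ i ∈ B, z i * θ i := by
  simp only [groupSq, Finset.mul_sum, ← Finset.sum_add_distrib, Pi.add_apply]
  exact Finset.sum_congr rfl fun i _ => by ring

theorem sum_mul_add (θ z : Fin d → ℝ) (B : Finset (Fin d)) :
    ∑ i ∈ B, z i * (θ i + z i) = ∑ i ∈ B, z i ^ 2 + ∑ i ∈ B, z i * θ i := by
  simp only [← Finset.sum_add_distrib]
  exact Finset.sum_congr rfl fun i _ => by ring

/-- Averaged over the reflection `z ↦ -z`, raising the threshold does not decrease the loss, unless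
the noise is large compared with the lower threshold. -/
theorem groupLoss_symm_le {θ : Fin d → ℝ} {B : Finset (Fin d)} {lam lam' : ℝ} {z : Fin d → ℝ}
    (hs : 0 < groupSq (θ + z) B) (hs' : 0 < groupSq (θ + -z) B)
    (hl : 4 * ∑ i ∈ B, z i ^ 2 ≤ lam) (hll : lam ≤ lam') :
    groupLoss θ B lam z + groupLoss θ B lam (-z)
      ≤ groupLoss θ B lam' z + groupLoss θ B lam' (-z) := by
  have h1 := groupLoss_sub (lam := lam) (lam' := lam') hs
  have h2 := groupLoss_sub (lam := lam) (lam' := lam') hs'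
  rw [sum_mul_add, groupSq_add] at h1 h2
  rw [groupSq_add] at hs hs'
  simp only [Pi.neg_apply, neg_mul, even_two, Even.neg_pow, Finset.sum_neg_distrib] at h2 hs'
  have hcs := Finset.sum_mul_sq_le_sq_mul_sq B z θ
  have hq0 : 0 ≤ ∑ i ∈ B, z i ^ 2 := Finset.sum_nonneg fun _ _ => sq_nonneg _
  have hA0 : 0 ≤ ∑ i ∈ B, θ i ^ 2 := Finset.sum_nonneg fun _ _ => sq_nonneg _
  set q := ∑ i ∈ B, z i ^ 2
  set A := ∑ i ∈ B, θ i ^ 2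
  set p := ∑ i ∈ B, z i * θ i
  -- By Cauchy–Schwarz p² ≤ q A. If A ≥ 9q, then 3|p| ≤ A and the symmetrized inequality applies. If
  -- A < 9q, then |p| ≤ 3q, so ⟨z, x⟩ ≤ 4q ≤ λ at both z and -z, and each loss is monotone by
  -- itself; this fixes the factor 4 in `hl`.
  rcases le_or_gt (9 * q) A with hA | hA
  · have h3p : 3 * |p| ≤ A := by
      refine (sq_le_sq₀ (by positivity) hA0).1 ?_
      rw [mul_pow, sq_abs]; nlinarith
    rcases le_total 0 p with hp | hp
    · rw [abs_of_nonneg hp] at h3p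
      have := sub_mul_div_nonneg_of_symm hp hq0 (by linarith : q ≤ lam) hll h3p (by linarith)
      rw [show A + q + 2 * -p = A + q - 2 * p by ring, show q + -p = q - p by ring] at h2
      linarith
    · rw [abs_of_nonpos hp] at h3p
      have := sub_mul_div_nonneg_of_symm (neg_nonneg.2 hp) hq0 (by linarith : q ≤ lam) hll h3p
        (by linarith)
      rw [show A + q - 2 * -p = A + q + 2 * p by ring, show q - -p = q + p by ring] at this
      linarith
  · have hpq : |p| ≤ 3 * q := by
      refine (sq_le_sq₀ (abs_nonneg _) (by positivity)).1 ?_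
      rw [sq_abs]; nlinarith
    have hp := abs_le.1 hpq
    have aux : ∀ s v : ℝ, 0 < s → v ≤ 4 * q →
        0 ≤ (min lam' s - min lam s) * (min lam' s + min lam s - 2 * v) / s := by
      intro s v hs hv
      rcases le_or_gt s lam with h | h
      · rw [min_eq_right h, min_eq_right (h.trans hll)]; simp
      · rw [min_eq_left h.le]
        have h5 : lam ≤ min lam' s := le_min hll h.le
        exact div_nonneg (mul_nonneg (by linarith) (by linarith)) hs.le
    have g1 := aux _ (q + p) hs (by linarith)
    have g2 := aux _ (q + -p) hs' (by linarith)
    linarith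

end BlockAlgebra

/-! ### Unbiasedness of SURE -/

section Unbiased

/-- The derivative of `x ↦ shrinkWeight lam (x² + c) x`. -/
def shrinkDeriv (lam s x : ℝ) : ℝ :=
  shrinkWeight lam s - if lam < s then 2 * lam * x ^ 2 / s ^ 2 else 0

theorem measurable_shrinkWeight (lam : ℝ) : Measurable (shrinkWeight lam) := by
  unfold shrinkWeight; fun_prop

theorem abs_shrinkWeight_mul_le {lam s x : ℝ} (hl : 0 ≤ lam) (hs : x ^ 2 ≤ s) :
    |shrinkWeight lam s * x| ≤ √lam := by
  refine Real.abs_le_sqrt ?_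
  rw [mul_pow]
  exact (mul_le_mul_of_nonneg_left hs (sq_nonneg _)).trans
    (shrinkWeight_sq_mul_le hl ((sq_nonneg x).trans hs))

theorem abs_shrinkDeriv_le {lam s x : ℝ} (hl : 0 ≤ lam) (hs : x ^ 2 ≤ s) :
    |shrinkDeriv lam s x| ≤ 2 := by
  have h0 := shrinkWeight_nonneg (s := s) hl
  have h1 := shrinkWeight_le_one (s := s) hl
  unfold shrinkDeriv
  split_ifs with h
  · have hs0 : 0 < s := hl.trans_lt h
    have h3 : 2 * lam * x ^ 2 / s ^ 2 ≤ 2 := by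
      rw [div_le_iff₀ (by positivity)]
      nlinarith [mul_le_mul h.le hs (sq_nonneg x) hs0.le]
    have h4 : 0 ≤ 2 * lam * x ^ 2 / s ^ 2 := by positivity
    rw [abs_le]; constructor <;> linarith
  · rw [abs_le]; constructor <;> linarith

theorem measurable_shrinkDeriv {α : Type*} [MeasurableSpace α] {s x : α → ℝ} (lam : ℝ)
    (hs : Measurable s) (hx : Measurable x) : Measurable fun a => shrinkDeriv lam (s a) (x a) :=
  ((measurable_shrinkWeight lam).comp hs).sub
    (Measurable.ite (measurableSet_lt measurable_const hs) (by fun_prop) measurable_const)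

/-- Stein's identity in one coordinate, the other coordinates of the block being frozen in c. The
shrunk part is bounded by √λ, so the boundary terms vanish. -/
theorem integral_mul_shrinkWeight {lam c : ℝ} (hl : 0 ≤ lam) (hc : 0 ≤ c) (a : ℝ) :
    ∫ y, y * (shrinkWeight lam ((a + y) ^ 2 + c) * (a + y)) ∂(gaussianReal 0 1)
      = ∫ y, shrinkDeriv lam ((a + y) ^ 2 + c) (a + y) ∂(gaussianReal 0 1) := by
  rcases hl.eq_or_lt with h0 | h0
  · subst h0; simp [shrinkWeight, shrinkDeriv]
  have hxs : ∀ y, (a + y) ^ 2 ≤ (a + y) ^ 2 + c := fun y => by linarith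
  -- The exceptional points are the solutions of (a + y)² + c = λ. If c > λ there are none, and the
  -- value √(λ - c) = 0 only adds a harmless point.
  refine integral_mul_eq_integral_deriv (s := {√(lam - c) - a, -√(lam - c) - a}) (C := √lam)
    ?_ (Set.to_countable _) ?_ (fun y => abs_shrinkWeight_mul_le hl (hxs y)) ?_
  · unfold shrinkWeight
    refine Continuous.mul (Continuous.div continuous_const (by fun_prop) fun y => ?_) (by fun_prop)
    exact (lt_max_of_lt_right h0).ne'
  · intro y hy
    have hne : (a + y) ^ 2 + c ≠ lam := by
      intro he
      apply hy
      have h1 : (a + y) ^ 2 = √(lam - c) ^ 2 := by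
        rw [Real.sq_sqrt (by nlinarith [sq_nonneg (a + y)])]; linarith
      rcases sq_eq_sq_iff_eq_or_eq_neg.1 h1 with h | h
      · left; linarith
      · right; simp only [Set.mem_singleton_iff]; linarith
    have hcont : Continuous fun y => (a + y) ^ 2 + c := by fun_prop
    have hid : HasDerivAt (fun y : ℝ => a + y) 1 y := (hasDerivAt_id y).const_add a
    rcases lt_or_gt_of_ne hne with h | h
    · have hev : (fun y => shrinkWeight lam ((a + y) ^ 2 + c) * (a + y)) =ᶠ[nhds y]
          fun y => a + y := by
        filter_upwards [hcont.continuousAt.eventually_lt_const h] with t ht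
        rw [shrinkWeight, max_eq_right ht.le, div_self h0.ne', one_mul]
      refine (hid.congr_of_eventuallyEq hev).congr_deriv ?_
      rw [shrinkDeriv, if_neg (not_lt.2 h.le), shrinkWeight, max_eq_right h.le, div_self h0.ne',
        sub_zero]
    · have hev : (fun y => shrinkWeight lam ((a + y) ^ 2 + c) * (a + y)) =ᶠ[nhds y]
          fun y => lam * (a + y) / ((a + y) ^ 2 + c) := by
        filter_upwards [hcont.continuousAt.eventually_const_lt h] with t ht
        rw [shrinkWeight_of_ge ht.le]; ring
      have hs0 : (a + y) ^ 2 + c ≠ 0 := (h0.trans h).ne'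
      have hd := (hid.const_mul lam).div ((hid.pow 2).add_const c) (by simpa using hs0)
      refine (hd.congr_of_eventuallyEq hev).congr_deriv ?_
      rw [shrinkDeriv, if_pos h, shrinkWeight_of_ge h.le]
      simp only [Pi.pow_apply]
      field_simp
      push_cast; ring
  · refine Integrable.of_bound (measurable_shrinkDeriv lam (by fun_prop)
      (by fun_prop)).aestronglyMeasurable 2 (Filter.Eventually.of_forall fun y => ?_)
    exact abs_shrinkDeriv_le hl (hxs y)

variable {d : ℕ}

theorem measurable_groupSq (θ : Fin d → ℝ) (B : Finset (Fin d)) :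
    Measurable fun z => groupSq (θ + z) B := by
  unfold groupSq
  simp only [Pi.add_apply]
  fun_prop

theorem measurable_groupLoss (θ : Fin d → ℝ) (B : Finset (Fin d)) (lam : ℝ) :
    Measurable (groupLoss θ B lam) := by
  unfold groupLoss
  have := (measurable_shrinkWeight lam).comp (measurable_groupSq θ B)
  simp only [Function.comp_def] at this
  fun_prop

theorem measurable_groupDev (θ : Fin d → ℝ) (B : Finset (Fin d)) (lam : ℝ) :
    Measurable (groupDev θ B lam) := by
  unfold groupDev
  have := (measurable_shrinkWeight lam).comp (measurable_groupSq θ B)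
  simp only [Function.comp_def] at this
  refine Measurable.add (by fun_prop) (Measurable.ite ?_ measurable_const measurable_const)
  exact measurableSet_le (measurable_groupSq θ B) measurable_const

theorem integrable_sum_sq_noise (B : Finset (Fin d)) :
    Integrable (fun z : Fin d → ℝ => ∑ i ∈ B, z i ^ 2) (noise d) :=
  integrable_finsetSum _ fun i _ => integrable_noise_eval (integrable_pow_stdNormal 2) i

theorem integrable_groupLoss (θ : Fin d → ℝ) (B : Finset (Fin d)) {lam : ℝ} (hl : 0 ≤ lam) :
    Integrable (groupLoss θ B lam) (noise d) :=
  (((integrable_sum_sq_noise B).const_mul 2).add (integrable_const (2 * lam))).mono'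
    (measurable_groupLoss θ B lam).aestronglyMeasurable
    (Filter.Eventually.of_forall fun z => by
      rw [Real.norm_eq_abs, abs_of_nonneg (groupLoss_nonneg θ B lam z)]
      exact groupLoss_le θ B hl z)

theorem integrable_groupDev (θ : Fin d → ℝ) (B : Finset (Fin d)) {lam : ℝ} (hl : 0 ≤ lam) :
    Integrable (groupDev θ B lam) (noise d) :=
  (((integrable_sum_sq_noise B).const_mul 2).add
    (integrable_const (3 * (B.card : ℝ) + 8 + lam))).mono'
    (measurable_groupDev θ B lam).aestronglyMeasurable
    (Filter.Eventually.of_forall fun z => by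
      have := abs_groupDev_le θ B hl z
      rw [Real.norm_eq_abs]; simp only [Pi.add_apply]; linarith)

/-- The contribution of one coordinate to `groupDev`. -/
def coordDev (θ : Fin d → ℝ) (B : Finset (Fin d)) (lam : ℝ) (i : Fin d) (z : Fin d → ℝ) : ℝ :=
  (z i ^ 2 - 1) + 2 * (shrinkDeriv lam (groupSq (θ + z) B) (θ i + z i)
    - z i * (shrinkWeight lam (groupSq (θ + z) B) * (θ i + z i)))

/-- For s > λ the divergence of w x is |B| w - 2λ/s = (|B| - 2) w, which is where the James–Stein
constant arises; for s ≤ λ it is |B|. -/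
theorem sum_coordDev {θ : Fin d → ℝ} {B : Finset (Fin d)} {lam : ℝ} {z : Fin d → ℝ}
    (hs : 0 < groupSq (θ + z) B) : ∑ i ∈ B, coordDev θ B lam i z = groupDev θ B lam z := by
  have e : ∑ i ∈ B, coordDev θ B lam i z = ∑ i ∈ B, (z i ^ 2 - 1)
      + 2 * (B.card * shrinkWeight lam (groupSq (θ + z) B)
        - (if lam < groupSq (θ + z) B then
            2 * lam * groupSq (θ + z) B / groupSq (θ + z) B ^ 2 else 0)
        - shrinkWeight lam (groupSq (θ + z) B) * ∑ i ∈ B, z i * (θ i + z i)) := by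
    have h1 : (if lam < groupSq (θ + z) B then
            2 * lam * groupSq (θ + z) B / groupSq (θ + z) B ^ 2 else 0)
        = ∑ i ∈ B, if lam < groupSq (θ + z) B then
            2 * lam * (θ i + z i) ^ 2 / groupSq (θ + z) B ^ 2 else 0 := by
      split_ifs
      · rw [← Finset.sum_div, ← Finset.mul_sum]; rfl
      · simp
    rw [h1, ← nsmul_eq_mul, ← Finset.sum_const, ← Finset.sum_sub_distrib, Finset.mul_sum,
      ← Finset.sum_sub_distrib, Finset.mul_sum, ← Finset.sum_add_distrib]
    refine Finset.sum_congr rfl fun i _ => ?_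
    rw [coordDev, shrinkDeriv]; ring
  rw [e, groupDev]
  set s := groupSq (θ + z) B
  rcases le_or_gt s lam with h | h
  · simp only [h, not_lt.2 h, if_true, if_false, shrinkWeight_of_le hs h]; ring
  · simp only [h, not_le.2 h, if_true, if_false, shrinkWeight_of_ge h.le]
    field_simp; ring

theorem sq_le_groupSq (x : Fin d → ℝ) {B : Finset (Fin d)} {i : Fin d} (hi : i ∈ B) :
    x i ^ 2 ≤ groupSq x B :=
  Finset.single_le_sum (f := fun i => x i ^ 2) (fun _ _ => sq_nonneg _) hi

theorem integrable_coordDev (θ : Fin d → ℝ) {B : Finset (Fin d)} {lam : ℝ} (hl : 0 ≤ lam)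
    {i : Fin d} (hi : i ∈ B) : Integrable (coordDev θ B lam i) (noise d) := by
  have hx : ∀ z, (θ i + z i) ^ 2 ≤ groupSq (θ + z) B := fun z => sq_le_groupSq (θ + z) hi
  have hms := measurable_groupSq θ B
  have hmw := (measurable_shrinkWeight lam).comp hms
  simp only [Function.comp_def] at hmw
  refine Integrable.add ((integrable_noise_eval (integrable_pow_stdNormal 2) i).sub
    (integrable_const 1)) (Integrable.const_mul (Integrable.sub ?_ ?_) 2)
  · refine Integrable.of_bound (measurable_shrinkDeriv lam hms
      (by fun_prop)).aestronglyMeasurable 2 (Filter.Eventually.of_forall fun z => ?_)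
    exact abs_shrinkDeriv_le hl (hx z)
  · refine ((integrable_noise_eval (integrable_abs_pow_stdNormal 1) i).mul_const (√lam)).mono'
      (by fun_prop) (Filter.Eventually.of_forall fun z => ?_)
    rw [Real.norm_eq_abs, abs_mul, pow_one]
    exact mul_le_mul_of_nonneg_left (abs_shrinkWeight_mul_le hl (hx z)) (abs_nonneg _)

/-- Average over coordinate i alone. The summand z_i² - 1 is centered, and the bracket vanishes in
mean by Stein's identity, whatever the other coordinates are. -/
theorem integral_coordDev (θ : Fin d → ℝ) {B : Finset (Fin d)} {lam : ℝ} (hl : 0 ≤ lam)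
    {i : Fin d} (hi : i ∈ B) : ∫ z, coordDev θ B lam i z ∂(noise d) = 0 := by
  refine integral_noise_eq_zero_of_update (integrable_coordDev θ hl hi) i fun z => ?_
  set c := ∑ j ∈ B.erase i, (θ j + z j) ^ 2 with hcdef
  have hc : 0 ≤ c := Finset.sum_nonneg fun _ _ => sq_nonneg _
  have hs : ∀ y, groupSq (θ + Function.update z i y) B = (θ i + y) ^ 2 + c := by
    intro y
    rw [groupSq, ← Finset.add_sum_erase _ _ hi]
    congr 1
    · simp
    · refine Finset.sum_congr rfl fun j hj => ?_
      simp [Function.update_of_ne (Finset.ne_of_mem_erase hj)]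
  have hxs : ∀ y, (θ i + y) ^ 2 ≤ (θ i + y) ^ 2 + c := fun y => by linarith
  simp only [coordDev, hs, Function.update_self]
  have hmw : Measurable fun y => shrinkWeight lam ((θ i + y) ^ 2 + c) :=
    (measurable_shrinkWeight lam).comp (by fun_prop)
  have i1 : Integrable (fun y => shrinkDeriv lam ((θ i + y) ^ 2 + c) (θ i + y))
      (gaussianReal 0 1) := by
    refine Integrable.of_bound (measurable_shrinkDeriv lam (by fun_prop)
      (by fun_prop)).aestronglyMeasurable 2 (Filter.Eventually.of_forall fun z => ?_)
    exact abs_shrinkDeriv_le hl (hxs z)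
  have i2 : Integrable (fun y => y * (shrinkWeight lam ((θ i + y) ^ 2 + c) * (θ i + y)))
      (gaussianReal 0 1) := by
    refine ((integrable_abs_pow_stdNormal 1).mul_const (√lam)).mono'
      (by fun_prop) (Filter.Eventually.of_forall fun z => ?_)
    rw [Real.norm_eq_abs, abs_mul, pow_one]
    exact mul_le_mul_of_nonneg_left (abs_shrinkWeight_mul_le hl (hxs z)) (abs_nonneg _)
  have i3 : Integrable (fun y : ℝ => y ^ 2 - 1) (gaussianReal 0 1) :=
    (integrable_pow_stdNormal 2).sub (integrable_const 1)
  have i4 : Integrable (fun y => 2 * (shrinkDeriv lam ((θ i + y) ^ 2 + c) (θ i + y)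
      - y * (shrinkWeight lam ((θ i + y) ^ 2 + c) * (θ i + y)))) (gaussianReal 0 1) :=
    (i1.sub i2).const_mul 2
  rw [integral_add i3 i4, integral_sub (integrable_pow_stdNormal 2) (integrable_const 1),
    integral_const_mul, integral_sub i1 i2, integral_mul_shrinkWeight hl hc,
    integral_sq_stdNormal]
  simp

theorem integral_groupDev (θ : Fin d → ℝ) {B : Finset (Fin d)} (hB : B.Nonempty) {lam : ℝ}
    (hl : 0 ≤ lam) : ∫ z, groupDev θ B lam z ∂(noise d) = 0 := by
  have h : (fun z => groupDev θ B lam z) =ᵐ[noise d] fun z => ∑ i ∈ B, coordDev θ B lam i z := by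
    filter_upwards [ae_add_ne_zero θ] with z hz
    exact (sum_coordDev (groupSq_pos hB hz)).symm
  rw [integral_congr_ae h, integral_finsetSum _ fun i hi => integrable_coordDev θ hl hi]
  exact Finset.sum_eq_zero fun i hi => integral_coordDev θ hl hi

end Unbiased

/-! ### The partition into blocks -/

section Blocks

variable {d : ℕ}

/-- The sum of squared errors of an estimator. -/
def sqLoss (est : (Fin d → ℝ) → (Fin d → ℝ)) (θ z : Fin d → ℝ) : ℝ :=
  ∑ i, (est (θ + z) i - θ i) ^ 2

theorem div_mem_range_numBlocks {L : ℕ} (hL : 1 ≤ L) (i : Fin d) :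
    i.val / L ∈ Finset.range (numBlocks d L) := by
  rw [Finset.mem_range, numBlocks, Nat.div_lt_iff_lt_mul (by omega)]
  have h1 := Nat.div_add_mod (d + L - 1) L
  have h2 := Nat.mod_lt (d + L - 1) (show 0 < L by omega)
  have h3 := i.isLt
  rw [mul_comm] at h1
  omega

theorem sum_blocks {L : ℕ} (hL : 1 ≤ L) (f : Fin d → ℝ) :
    ∑ b ∈ Finset.range (numBlocks d L), ∑ i ∈ block d L b, f i = ∑ i, f i :=
  Finset.sum_fiberwise_of_maps_to (fun i _ => div_mem_range_numBlocks hL i) f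

theorem block_disjoint (L : ℕ) {a b : ℕ} (h : a ≠ b) : Disjoint (block d L a) (block d L b) := by
  rw [Finset.disjoint_left]
  intro i hi hj
  simp only [block, Finset.mem_filter] at hi hj
  exact h (hi.2.symm.trans hj.2)

theorem mul_lt_of_lt_numBlocks {L b : ℕ} (hL : 1 ≤ L) (hb : b < numBlocks d L) : b * L < d := by
  have h1 : (b + 1) * L ≤ d + L - 1 := by
    have := (Nat.le_div_iff_mul_le (by omega)).1 (show b + 1 ≤ (d + L - 1) / L from hb)
    exact this
  rw [add_mul, one_mul] at h1
  omega

theorem block_nonempty {L b : ℕ} (hL : 1 ≤ L) (hb : b < numBlocks d L) :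
    (block d L b).Nonempty :=
  ⟨⟨b * L, mul_lt_of_lt_numBlocks hL hb⟩, by simp [block, Nat.mul_div_cancel _ (show 0 < L by omega)]⟩

theorem block_eq_map (d L b : ℕ) (hL : 1 ≤ L) :
    (block d L b).map Fin.valEmbedding = (Finset.Ico (b * L) ((b + 1) * L)).filter (· < d) := by
  ext j
  simp only [block, Finset.mem_map, Finset.mem_filter, Finset.mem_univ, true_and,
    Fin.valEmbedding_apply, Finset.mem_Ico]
  constructor
  · rintro ⟨i, hi, rfl⟩
    rw [Nat.div_eq_iff (by omega)] at hi
    rw [add_mul, one_mul]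
    have := i.isLt
    omega
  · rintro ⟨⟨h1, h2⟩, h3⟩
    refine ⟨⟨j, h3⟩, ?_, rfl⟩
    rw [add_mul, one_mul] at h2
    simp only
    rw [Nat.div_eq_iff (by omega)]
    omega

theorem block_card_le {L : ℕ} (hL : 1 ≤ L) (b : ℕ) : (block d L b).card ≤ L := by
  rw [← Finset.card_map Fin.valEmbedding, block_eq_map d L b hL]
  refine (Finset.card_filter_le _ _).trans ?_
  simp [add_mul]

theorem block_card_of_le {L b : ℕ} (hL : 1 ≤ L) (hb : (b + 1) * L ≤ d) :
    (block d L b).card = L := by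
  rw [← Finset.card_map Fin.valEmbedding, block_eq_map d L b hL, Finset.filter_true_of_mem]
  · simp [add_mul]
  · intro j hj
    have := (Finset.mem_Ico.1 hj).2
    omega

theorem numBlocks_mul_le (d L : ℕ) : numBlocks d L * L ≤ d + L - 1 :=
  Nat.div_mul_le_self _ _

theorem max_one_sub_div {lam s : ℝ} (hs : 0 < s) :
    max (1 - lam / s) 0 = 1 - shrinkWeight lam s := by
  rcases le_total lam s with h | h
  · rw [shrinkWeight_of_ge h, max_eq_left]
    rw [sub_nonneg, div_le_one hs]; exact h
  · rw [shrinkWeight_of_le hs h, sub_self, max_eq_right]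
    rw [sub_nonpos, one_le_div hs]; exact h

theorem sqLoss_blockJS {θ z : Fin d → ℝ} {lam : ℝ} {L : ℕ} (hL : 1 ≤ L)
    (hx : ∀ i, (θ + z) i ≠ 0) :
    sqLoss (blockJS lam L) θ z
      = ∑ b ∈ Finset.range (numBlocks d L), groupLoss θ (block d L b) lam z := by
  rw [sqLoss, ← sum_blocks hL]
  refine Finset.sum_congr rfl fun b hb => Finset.sum_congr rfl fun i hi => ?_
  have hs := groupSq_pos (block_nonempty hL (Finset.mem_range.1 hb)) hx
  have hib : i.val / L = b := (Finset.mem_filter.1 hi).2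
  rw [blockJS, hib, show blockSq (θ + z) L b = groupSq (θ + z) (block d L b) from rfl,
    max_one_sub_div hs]
  simp only [Pi.add_apply]
  ring

theorem sqLoss_blockJS_eq_sure_add {θ z : Fin d → ℝ} {lam : ℝ} {L : ℕ} (hL : 1 ≤ L)
    (hx : ∀ i, (θ + z) i ≠ 0) :
    sqLoss (blockJS lam L) θ z = sure (θ + z) lam L
      + ∑ b ∈ Finset.range (numBlocks d L), groupDev θ (block d L b) lam z := by
  rw [sqLoss_blockJS hL hx, sure, ← Finset.sum_add_distrib]
  refine Finset.sum_congr rfl fun b hb => ?_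
  exact groupLoss_eq_sureTerm_add (groupSq_pos (block_nonempty hL (Finset.mem_range.1 hb)) hx)

theorem integrable_sqLoss_blockJS (θ : Fin d → ℝ) {lam : ℝ} {L : ℕ} (hl : 0 ≤ lam) (hL : 1 ≤ L) :
    Integrable (sqLoss (blockJS lam L) θ) (noise d) := by
  refine (integrable_finsetSum (Finset.range (numBlocks d L))
    fun b _ => integrable_groupLoss θ (block d L b) hl).congr ?_
  filter_upwards [ae_add_ne_zero θ] with z hz
  exact (sqLoss_blockJS hL hz).symm

/-- SURE is an unbiased estimate of the risk of the blockwise James–Stein estimator. -/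
theorem integral_sure (θ : Fin d → ℝ) {lam : ℝ} {L : ℕ} (hl : 0 ≤ lam) (hL : 1 ≤ L) :
    Integrable (fun z => sure (θ + z) lam L) (noise d) ∧
    ∫ z, sure (θ + z) lam L ∂(noise d) = ∫ z, sqLoss (blockJS lam L) θ z ∂(noise d) := by
  have i1 := integrable_sqLoss_blockJS θ hl hL
  have i2 : Integrable (fun z => ∑ b ∈ Finset.range (numBlocks d L),
      groupDev θ (block d L b) lam z) (noise d) :=
    integrable_finsetSum _ fun b _ => integrable_groupDev θ (block d L b) hl
  have h : (fun z => sure (θ + z) lam L) =ᵐ[noise d] fun z => sqLoss (blockJS lam L) θ z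
      - ∑ b ∈ Finset.range (numBlocks d L), groupDev θ (block d L b) lam z := by
    filter_upwards [ae_add_ne_zero θ] with z hz
    rw [sqLoss_blockJS_eq_sure_add hL hz]; ring
  refine ⟨(i1.sub i2).congr h.symm, ?_⟩
  rw [integral_congr_ae h, integral_sub i1 i2,
    integral_finsetSum _ fun b _ => integrable_groupDev θ (block d L b) hl,
    Finset.sum_eq_zero fun b hb => integral_groupDev θ
      (block_nonempty hL (Finset.mem_range.1 hb)) hl, sub_zero]

end Blocks

/-! ### Uniform comparison of loss and SURE -/

section Envelope

variable {d : ℕ}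

/-- Since log d is bounded away from 0, all constants and lower powers of log d can be absorbed into
(log d)², down to d = 2. -/
theorem half_le_log {d : ℕ} (hd : 2 ≤ d) : 1 / 2 ≤ Real.log d := by
  have h1 := Real.log_two_gt_d9
  have h2 : Real.log 2 ≤ Real.log d := Real.log_le_log (by norm_num) (by exact_mod_cast hd)
  linarith

theorem log_le_self {d : ℕ} (hd : 2 ≤ d) : Real.log d ≤ d := by
  have : (0 : ℝ) < d := by exact_mod_cast (by omega : 0 < d)
  linarith [Real.log_le_sub_one_of_pos this]

theorem integral_abs_stdNormal_le : ∫ x, |x| ∂(gaussianReal 0 1) ≤ 1 := by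
  have h1 : Integrable (fun x : ℝ => (1 + x ^ 2) / 2) (gaussianReal 0 1) :=
    ((integrable_const 1).add (integrable_pow_stdNormal 2)).div_const 2
  calc ∫ x, |x| ∂(gaussianReal 0 1) ≤ ∫ x, (1 + x ^ 2) / 2 ∂(gaussianReal 0 1) := by
        refine integral_mono (by simpa using integrable_abs_pow_stdNormal 1) h1 fun x => ?_
        have := sq_abs x
        simp only
        nlinarith [sq_nonneg (|x| - 1)]
    _ = 1 := by
        rw [integral_div, integral_add (integrable_const 1) (integrable_pow_stdNormal 2),
          integral_sq_stdNormal]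
        simp

/-- Very small observations are rare. -/
theorem integral_min_div_sq_le (θ : ℝ) {δ : ℝ} (hδ : 0 < δ) :
    Integrable (fun z : ℝ => min (δ ^ 4 / (θ + z) ^ 2) 1) (gaussianReal 0 1) ∧
    ∫ z, min (δ ^ 4 / (θ + z) ^ 2) 1 ∂(gaussianReal 0 1) ≤ 2 * δ + δ ^ 2 := by
  have hm : Measurable fun z : ℝ => min (δ ^ 4 / (θ + z) ^ 2) 1 := by fun_prop
  have hi : Integrable (fun z : ℝ => min (δ ^ 4 / (θ + z) ^ 2) 1) (gaussianReal 0 1) :=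
    Integrable.of_bound hm.aestronglyMeasurable 1 (Filter.Eventually.of_forall fun z => by
      rw [Real.norm_eq_abs, abs_of_nonneg (by positivity)]; exact min_le_right _ _)
  refine ⟨hi, ?_⟩
  have hS : MeasurableSet {z : ℝ | |θ + z| ≤ δ} :=
    measurableSet_le (by fun_prop) measurable_const
  have hind : Integrable ({z : ℝ | |θ + z| ≤ δ}.indicator fun _ => (1 : ℝ)) (gaussianReal 0 1) :=
    (integrable_const 1).indicator hS
  calc ∫ z, min (δ ^ 4 / (θ + z) ^ 2) 1 ∂(gaussianReal 0 1)
      -- Split at |θ + z| = δ: beyond it the integrand is at most δ⁴/δ², and the rest has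
      -- probability at most 2δ.
      ≤ ∫ z, ({z : ℝ | |θ + z| ≤ δ}.indicator (fun _ => (1 : ℝ)) z + δ ^ 2)
          ∂(gaussianReal 0 1) := by
        refine integral_mono hi (hind.add (integrable_const _)) fun z => ?_
        by_cases hz : |θ + z| ≤ δ
        · simp only [Set.indicator, Set.mem_ofPred_eq, hz, if_true]
          have := min_le_right (δ ^ 4 / (θ + z) ^ 2) 1
          nlinarith [sq_nonneg δ]
        · simp only [Set.indicator, Set.mem_ofPred_eq, hz, if_false, zero_add]
          refine (min_le_left _ _).trans ?_
          have h1 : δ ^ 2 ≤ (θ + z) ^ 2 := by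
            rw [← sq_abs (θ + z)]; exact pow_le_pow_left₀ hδ.le (not_le.1 hz).le 2
          rw [div_le_iff₀ (by nlinarith [pow_pos hδ 2])]
          nlinarith [mul_le_mul_of_nonneg_left h1 (sq_nonneg δ)]
    _ ≤ 2 * δ + δ ^ 2 := by
        rw [integral_add hind (integrable_const _), integral_indicator hS]
        have := stdNormal_abs_add_le θ hδ.le
        simp only [smul_eq_mul, mul_one, integral_const, probReal_univ, one_mul,
          measureReal_restrict_apply_univ]
        linarith

/-- The total excess of the squared noise over a level. -/
def noiseExcess (a : ℝ) (z : Fin d → ℝ) : ℝ := ∑ i, max (z i ^ 2 - a) 0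

theorem integrable_noiseExcess (a : ℝ) : Integrable (noiseExcess (d := d) a) (noise d) :=
  integrable_finsetSum _ fun i _ => integrable_noise_eval (integrable_max_sq_sub a) i

theorem integral_noiseExcess_le {a : ℝ} (ha : 0 < a) :
    ∫ z, noiseExcess a z ∂(noise d) ≤ d * (10 * Real.exp (-(a / 2)) / √a) := by
  unfold noiseExcess
  rw [integral_finsetSum _ fun i _ => integrable_noise_eval (integrable_max_sq_sub a) i]
  calc ∑ i : Fin d, ∫ z : Fin d → ℝ, max (z i ^ 2 - a) 0 ∂(noise d)
      ≤ ∑ i : Fin d, (10 * Real.exp (-(a / 2)) / √a) := by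
        refine Finset.sum_le_sum fun i _ => ?_
        rw [integral_noise_eval (f := fun x => max (x ^ 2 - a) 0) (by fun_prop) i]
        exact integral_max_sq_sub_le ha
    _ = _ := by simp

theorem sum_sq_sub_le_excess (a : ℝ) (z : Fin d → ℝ) (B : Finset (Fin d)) :
    ∑ i ∈ B, z i ^ 2 - B.card * a ≤ ∑ i ∈ B, max (z i ^ 2 - a) 0 := by
  rw [← nsmul_eq_mul, ← Finset.sum_const, ← Finset.sum_sub_distrib]
  exact Finset.sum_le_sum fun i _ => le_max_left _ _

theorem groupDev_dependsOn (θ : Fin d → ℝ) (B : Finset (Fin d)) (lam : ℝ) :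
    DependsOn (groupDev θ B lam) (B : Set (Fin d)) := by
  intro x y hxy
  have h1 : groupSq (θ + x) B = groupSq (θ + y) B :=
    Finset.sum_congr rfl fun i hi => by simp [hxy i hi]
  have h2 : ∑ i ∈ B, (x i ^ 2 - 1) = ∑ i ∈ B, (y i ^ 2 - 1) :=
    Finset.sum_congr rfl fun i hi => by simp [hxy i hi]
  have h3 : ∑ i ∈ B, x i * (θ i + x i) = ∑ i ∈ B, y i * (θ i + y i) :=
    Finset.sum_congr rfl fun i hi => by simp [hxy i hi]
  simp only [groupDev, h1, h2, h3]

/-- At a fixed threshold and block size, the excess of the loss over SURE is bounded by a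
sub-Gaussian variable up to a remainder that does not depend on threshold and block size. -/
theorem exists_subGaussian_bound (hd : 2 ≤ d) (θ : Fin d → ℝ) {lam : ℝ} {L : ℕ} (hL : 1 ≤ L)
    (hLd : (L : ℝ) ≤ √d) (h0 : 0 ≤ lam) (hlam : lam ≤ 4 * L * Real.log d) :
    ∃ X : (Fin d → ℝ) → ℝ, (∀ t, Integrable (fun z => Real.exp (t * X z)) (noise d)) ∧
      (∀ t, ∫ z, Real.exp (t * X z) ∂(noise d)
        ≤ Real.exp (1156 * (d * √d * Real.log d ^ 2) * t ^ 2)) ∧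
      ∀ z, ∑ b ∈ Finset.range (numBlocks d L), groupDev θ (block d L b) lam z
        ≤ X z + 2 * ∫ y, noiseExcess (4 * Real.log d) y ∂(noise d)
          + 2 * noiseExcess (4 * Real.log d) z := by
  set l := Real.log d with hl
  have hl2 : 1 / 2 ≤ l := half_le_log hd
  have hL1 : (1 : ℝ) ≤ L := by exact_mod_cast hL
  -- When no squared noise exceeds 4l, `abs_groupDev_le` gives 8Ll + 3L + 8 + 4Ll, and 1 ≤ 2l turns
  -- this into (8 + 6 + 16 + 4) L l.
  set M := 34 * L * l with hM
  have hM0 : 0 ≤ M := by positivity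
  set U : ℕ → (Fin d → ℝ) → ℝ := fun b => groupDev θ (block d L b) lam with hU
  set P : ℕ → (Fin d → ℝ) → ℝ := fun b z => ∑ i ∈ block d L b, max (z i ^ 2 - 4 * l) 0 with hP
  -- The deviation truncated at ±M. Truncation moves it by at most twice the noise excess P in the
  -- block, so the mean of V is at most 2 E P, as U is centered.
  set V : ℕ → (Fin d → ℝ) → ℝ := fun b z => max (-M) (min (U b z) M) with hV
  have hP0 : ∀ b z, 0 ≤ P b z := fun b z => Finset.sum_nonneg fun _ _ => le_max_right _ _
  have hPs : ∀ z, ∑ b ∈ Finset.range (numBlocks d L), P b z = noiseExcess (4 * l) z :=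
    fun z => sum_blocks hL _
  have hUb : ∀ b z, |U b z| ≤ 2 * P b z + M := by
    intro b z
    have h1 := abs_groupDev_le θ (block d L b) h0 z
    have h2 := sum_sq_sub_le_excess (4 * l) z (block d L b)
    have h3 : ((block d L b).card : ℝ) ≤ L := by exact_mod_cast block_card_le hL b
    have h4 : ((block d L b).card : ℝ) * (4 * l) ≤ L * (4 * l) := by gcongr
    have h5 : (L : ℝ) * 1 ≤ L * (2 * l) := by gcongr; linarith
    simp only [hU, hP, hM]
    nlinarith
  have hVU : ∀ b z, U b z ≤ V b z + 2 * P b z ∧ V b z ≤ U b z + 2 * P b z := by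
    intro b z
    have h1 := abs_le.1 (hUb b z)
    have h2 := hP0 b z
    simp only [hV]
    constructor
    · rcases le_total (U b z) M with h | h
      · rw [min_eq_left h]; linarith [le_max_right (-M) (U b z)]
      · rw [min_eq_right h]; linarith [le_max_right (-M) M]
    · exact max_le (by linarith) ((min_le_left _ _).trans (by linarith))
  have hVM : ∀ b z, |V b z| ≤ M := by
    intro b z
    rw [abs_le]
    exact ⟨le_max_left _ _, max_le (by linarith) (min_le_right _ _)⟩
  have hUm : ∀ b, Measurable (U b) := fun b => measurable_groupDev _ _ _
  have hVm : ∀ b, Measurable (V b) := fun b =>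
    measurable_const.max ((hUm b).min measurable_const)
  have hVd : ∀ b, DependsOn (V b) (block d L b : Set (Fin d)) := by
    intro b x y hxy
    simp only [hV, hU, groupDev_dependsOn θ (block d L b) lam hxy]
  have hsub := hasSubgaussianMGF_sum_of_dependsOn hM0 hVm (fun a b h => block_disjoint L h) hVd hVM
    (numBlocks d L)
  have hPi : ∀ b, Integrable (P b) (noise d) := fun b =>
    integrable_finsetSum _ fun i _ => integrable_noise_eval (integrable_max_sq_sub _) i
  have hVi : ∀ b, Integrable (V b) (noise d) := fun b =>
    Integrable.of_bound (hVm b).aestronglyMeasurable M (Filter.Eventually.of_forall (hVM b))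
  have hEV : ∀ b ∈ Finset.range (numBlocks d L),
      ∫ z, V b z ∂(noise d) ≤ 2 * ∫ z, P b z ∂(noise d) := by
    intro b hb
    have hUi : Integrable (U b) (noise d) := integrable_groupDev θ _ h0
    calc ∫ z, V b z ∂(noise d) ≤ ∫ z, (U b z + 2 * P b z) ∂(noise d) :=
          integral_mono (hVi b) (hUi.add ((hPi b).const_mul 2)) fun z => (hVU b z).2
      _ = 2 * ∫ z, P b z ∂(noise d) := by
          rw [integral_add hUi ((hPi b).const_mul 2), integral_const_mul,
            integral_groupDev θ (block_nonempty hL (Finset.mem_range.1 hb)) h0, zero_add]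
  refine ⟨fun z => ∑ b ∈ Finset.range (numBlocks d L), (V b z - ∫ y, V b y ∂(noise d)),
    hsub.integrable_exp_mul, fun t => ?_, fun z => ?_⟩
  · refine (hsub.mgf_le t).trans (Real.exp_le_exp.2 ?_)
    push_cast
    rw [Real.coe_toNNReal _ (sq_nonneg M)]
    have h1 : (numBlocks d L : ℝ) * L ≤ 2 * d := by
      have h2 := numBlocks_mul_le d L
      have h3 : L ≤ d := by
        have : √(d : ℝ) ≤ d := Real.sqrt_le_left (by positivity) |>.2 (by
          have : (1 : ℝ) ≤ d := by exact_mod_cast (by omega : 1 ≤ d)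
          nlinarith)
        exact_mod_cast hLd.trans this
      have : numBlocks d L * L ≤ 2 * d := by omega
      exact_mod_cast this
    -- The variance proxy is of order d L (log d)²; L ≤ √d makes it d^{3/2} (log d)², the origin of
    -- the rate d^{3/4}.
    have h4 : (numBlocks d L : ℝ) * M ^ 2 ≤ 2 * (1156 * (d * √d * l ^ 2)) := by
      calc (numBlocks d L : ℝ) * M ^ 2 = 1156 * l ^ 2 * ((numBlocks d L * L) * L) := by
            rw [hM]; ring
        _ ≤ 1156 * l ^ 2 * ((2 * d) * √d) := by gcongr
        _ = _ := by ring
    nlinarith [mul_le_mul_of_nonneg_right h4 (sq_nonneg t)]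
  · have e1 : ∑ b ∈ Finset.range (numBlocks d L), U b z
        ≤ ∑ b ∈ Finset.range (numBlocks d L), (V b z - ∫ y, V b y ∂(noise d)
          + 2 * (∫ y, P b y ∂(noise d)) + 2 * P b z) := by
      refine Finset.sum_le_sum fun b hb => ?_
      have := (hVU b z).1
      have := hEV b hb
      linarith
    refine e1.trans (le_of_eq ?_)
    rw [Finset.sum_add_distrib, Finset.sum_add_distrib, ← Finset.mul_sum, ← Finset.mul_sum,
      hPs, ← integral_finsetSum _ fun b _ => hPi b]
    simp only [hPs]

/-! ### Union bound over a grid of thresholds -/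

theorem card_grid_le (hd : 2 ≤ d) : ((2 * d ^ 4 + 2) * (d + 1) : ℝ) ≤ (d : ℝ) ^ 8 := by
  have h : (2 : ℝ) ≤ d := by exact_mod_cast hd
  have h1 : (2 * d ^ 4 + 2 : ℝ) ≤ (d : ℝ) ^ 6 := by
    have h2 : (16 : ℝ) ≤ (d : ℝ) ^ 4 := by
      calc (16 : ℝ) = 2 ^ 4 := by norm_num
        _ ≤ (d : ℝ) ^ 4 := by gcongr
    have h3 : (4 : ℝ) ≤ (d : ℝ) ^ 2 := by nlinarith
    calc (2 * d ^ 4 + 2 : ℝ) ≤ 4 * (d : ℝ) ^ 4 := by linarith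
      _ ≤ (d : ℝ) ^ 2 * (d : ℝ) ^ 4 := by gcongr
      _ = (d : ℝ) ^ 6 := by ring
  have h4 : (d + 1 : ℝ) ≤ (d : ℝ) ^ 2 := by nlinarith
  calc ((2 * d ^ 4 + 2) * (d + 1) : ℝ) ≤ (d : ℝ) ^ 6 * (d : ℝ) ^ 2 := by gcongr
    _ = (d : ℝ) ^ 8 := by ring

/-- An exponential-moment bound on the maximum of finitely many variables. -/
theorem exists_integrable_upper_bound {Ω ι : Type*} [MeasurableSpace Ω] {μ : Measure Ω}
    [IsProbabilityMeasure μ] (S : Finset ι) (X : ι → Ω → ℝ) {t a κ : ℝ} (ht : 0 < t)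
    (hi : ∀ j ∈ S, Integrable (fun ω => Real.exp (t * X j ω)) μ)
    (hX : ∀ j ∈ S, ∫ ω, Real.exp (t * X j ω) ∂μ ≤ Real.exp κ)
    (ha : S.card * Real.exp κ ≤ Real.exp a) :
    ∃ W : Ω → ℝ, Integrable W μ ∧ ∫ ω, W ω ∂μ ≤ t⁻¹ * (a + 1) ∧ ∀ j ∈ S, ∀ ω, X j ω ≤ W ω := by
  have hsi : Integrable (fun ω => ∑ j ∈ S, Real.exp (t * X j ω)) μ := integrable_finsetSum _ hi
  have hWi : Integrable (fun ω => a + Real.exp (-a) * ∑ j ∈ S, Real.exp (t * X j ω)) μ :=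
    (integrable_const a).add (hsi.const_mul _)
  -- A soft maximum without logarithm: u ≤ a + e^{u-a} at u = t X_j, and the single exponential is
  -- dominated by the sum of all of them.
  refine ⟨fun ω => t⁻¹ * (a + Real.exp (-a) * ∑ j ∈ S, Real.exp (t * X j ω)),
    hWi.const_mul _, ?_, fun j hj ω => ?_⟩
  · rw [integral_const_mul, integral_add (integrable_const a) (hsi.const_mul _),
      integral_const_mul, integral_finsetSum _ hi]
    have h1 : ∑ j ∈ S, ∫ ω, Real.exp (t * X j ω) ∂μ ≤ Real.exp a := by
      refine (Finset.sum_le_sum hX).trans ?_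
      simpa using ha
    have h2 : Real.exp (-a) * ∑ j ∈ S, ∫ ω, Real.exp (t * X j ω) ∂μ ≤ 1 := by
      calc _ ≤ Real.exp (-a) * Real.exp a := by gcongr
        _ = 1 := by rw [← Real.exp_add]; simp
    simp only [integral_const, probReal_univ, one_smul]
    gcongr
  · have h1 : Real.exp (t * X j ω) ≤ ∑ j ∈ S, Real.exp (t * X j ω) :=
      Finset.single_le_sum (f := fun j => Real.exp (t * X j ω)) (fun _ _ => (Real.exp_pos _).le) hj
    have h2 : t * X j ω - a ≤ Real.exp (-a) * Real.exp (t * X j ω) := by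
      rw [← Real.exp_add]
      have := Real.add_one_le_exp (-a + t * X j ω)
      linarith
    have h3 : t * X j ω ≤ a + Real.exp (-a) * ∑ j ∈ S, Real.exp (t * X j ω) := by
      have := mul_le_mul_of_nonneg_left h1 (Real.exp_pos (-a)).le
      linarith
    simp only
    rw [inv_mul_eq_div, le_div_iff₀ ht]
    linarith

theorem sqrt_natCast_le_self (d : ℕ) : √(d : ℝ) ≤ d := by
  rcases Nat.eq_zero_or_pos d with h | h
  · simp [h]
  · rw [Real.sqrt_le_left (by positivity)]
    have : (1 : ℝ) ≤ d := by exact_mod_cast h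
    nlinarith

theorem rpow_three_quarters_sq {x : ℝ} (hx : 0 < x) : (x ^ (3 / 4 : ℝ)) ^ 2 = x * √x := by
  rw [← Real.rpow_natCast, ← Real.rpow_mul hx.le, Real.sqrt_eq_rpow]
  nth_rewrite 2 [← Real.rpow_one x]
  rw [← Real.rpow_add hx]; norm_num

theorem sqrt_le_rpow_three_quarters {x : ℝ} (hx : 1 ≤ x) : √x ≤ x ^ (3 / 4 : ℝ) := by
  rw [Real.sqrt_eq_rpow]
  exact Real.rpow_le_rpow_of_exponent_le hx (by norm_num)

theorem integral_noiseExcess_four_log_le (hd : 2 ≤ d) :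
    ∫ z, noiseExcess (4 * Real.log d) z ∂(noise d) ≤ 10 := by
  have hl2 := half_le_log hd
  have hd1 : (1 : ℝ) ≤ d := by exact_mod_cast (by omega : 1 ≤ d)
  set l := Real.log d
  refine (integral_noiseExcess_le (by linarith : 0 < 4 * l)).trans ?_
  have e1 : Real.exp (-(4 * l / 2)) = ((d : ℝ) ^ 2)⁻¹ := by
    rw [Real.exp_neg, show 4 * l / 2 = l * 2 by ring, Real.exp_mul, Real.exp_log (by linarith)]
    norm_cast
  have e2 : 1 ≤ √(4 * l) := Real.one_le_sqrt.2 (by linarith)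
  rw [e1]
  calc d * (10 * ((d : ℝ) ^ 2)⁻¹ / √(4 * l)) ≤ d * (10 * ((d : ℝ) ^ 2)⁻¹) := by
        gcongr; exact div_le_self (by positivity) e2
    _ = 10 * (d * ((d : ℝ) ^ 2)⁻¹) := by ring
    _ ≤ 10 * 1 := by
        gcongr; rw [← div_eq_mul_inv, div_le_one (by positivity)]; nlinarith
    _ = 10 := by norm_num

/-- The error made by moving a threshold to the next point of a grid of mesh `d⁻²`. -/
def gridError (θ z : Fin d → ℝ) : ℝ :=
  ∑ i, ((d : ℝ)⁻¹ * |z i| + min (((d : ℝ) ^ 2)⁻¹ / (θ + z) i ^ 2) 1)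

theorem integrable_gridError (hd : 2 ≤ d) (θ : Fin d → ℝ) :
    Integrable (gridError θ) (noise d) ∧ ∫ z, gridError θ z ∂(noise d) ≤ 2 + 2 * √d := by
  have hd0 : (0 : ℝ) < d := by exact_mod_cast (by omega : 0 < d)
  -- The mesh is d⁻² = δ⁴, so small observations cost at most 2δ + δ² per coordinate, in total
  -- O(√d), which is below d^{3/4}.
  set δ := (√(d : ℝ))⁻¹ with hδ
  have hδ0 : 0 < δ := by positivity
  have hδ2 : δ ^ 2 = (d : ℝ)⁻¹ := by rw [hδ, inv_pow, Real.sq_sqrt hd0.le]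
  have hδ4 : δ ^ 4 = ((d : ℝ) ^ 2)⁻¹ := by
    rw [show δ ^ 4 = (δ ^ 2) ^ 2 by ring, hδ2, inv_pow]
  have hi1 : ∀ i : Fin d, Integrable (fun z : Fin d → ℝ => (d : ℝ)⁻¹ * |z i|) (noise d) := fun i =>
    (integrable_noise_eval (f := fun x => |x|) (by simpa using integrable_abs_pow_stdNormal 1) i
      ).const_mul _
  have hi2 : ∀ i : Fin d, Integrable
      (fun z : Fin d → ℝ => min (((d : ℝ) ^ 2)⁻¹ / (θ + z) i ^ 2) 1) (noise d) := fun i => by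
    have h := (integral_min_div_sq_le (θ i) hδ0).1
    rw [hδ4] at h
    exact integrable_noise_eval h i
  refine ⟨integrable_finsetSum _ fun i _ => (hi1 i).add (hi2 i), ?_⟩
  have hi3 : ∀ i ∈ Finset.univ, Integrable (fun z : Fin d → ℝ => (d : ℝ)⁻¹ * |z i|
      + min (((d : ℝ) ^ 2)⁻¹ / (θ + z) i ^ 2) 1) (noise d) := fun i _ => (hi1 i).add (hi2 i)
  unfold gridError
  rw [integral_finsetSum _ hi3]
  calc ∑ i : Fin d, ∫ z : Fin d → ℝ, ((d : ℝ)⁻¹ * |z i|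
          + min (((d : ℝ) ^ 2)⁻¹ / (θ + z) i ^ 2) 1) ∂(noise d)
      ≤ ∑ i : Fin d, (δ ^ 2 + (2 * δ + δ ^ 2)) := by
        refine Finset.sum_le_sum fun i _ => ?_
        rw [integral_add (hi1 i) (hi2 i), integral_const_mul,
          integral_noise_eval (f := fun x => |x|) (by fun_prop) i, ← hδ2]
        have h1 := integral_abs_stdNormal_le
        have h2 := (integral_min_div_sq_le (θ i) hδ0).2
        rw [hδ4] at h2
        have h3 := integral_noise_eval (d := d)
          (f := fun x => min (((d : ℝ) ^ 2)⁻¹ / (θ i + x) ^ 2) 1) (by fun_prop) i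
        simp only [Pi.add_apply] at h3 ⊢
        rw [h3]
        have h4 : δ ^ 2 * ∫ x, |x| ∂(gaussianReal 0 1) ≤ δ ^ 2 * 1 := by gcongr
        linarith
    _ = d * (2 * δ ^ 2 + 2 * δ) := by simp; ring
    _ = 2 + 2 * √d := by
        have h5 : (d : ℝ) * δ = √d := by
          rw [hδ, ← div_eq_mul_inv, Real.div_sqrt]
        have h6 : (d : ℝ) * δ ^ 2 = 1 := by rw [hδ2, mul_inv_cancel₀ hd0.ne']
        linear_combination 2 * h6 + 2 * h5

/-- The point is (⌊λ d²⌋ + 1) d⁻², strictly above λ and at least one mesh away from 0, as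
`groupDev_le_of_lt` requires. It may leave the search range slightly, hence 4 L log d in place of 2
L log d. -/
theorem exists_grid_point (hd : 2 ≤ d) {lam : ℝ} {L : ℕ} (h : InSearchRange d lam L) :
    ∃ k : ℕ, k < 2 * d ^ 4 + 2 ∧ L < d + 1 ∧ lam < k * ((d : ℝ) ^ 2)⁻¹ ∧
      k * ((d : ℝ) ^ 2)⁻¹ ≤ lam + ((d : ℝ) ^ 2)⁻¹ ∧ ((d : ℝ) ^ 2)⁻¹ ≤ k * ((d : ℝ) ^ 2)⁻¹ ∧
      k * ((d : ℝ) ^ 2)⁻¹ ≤ 4 * L * Real.log d := by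
  obtain ⟨hL, hLd, hlo, hhi⟩ := h
  have hl2 := half_le_log hd
  have hld := log_le_self hd
  have hsqrtd := sqrt_natCast_le_self d
  have hd1 : (1 : ℝ) ≤ d := by exact_mod_cast (by omega : 1 ≤ d)
  have h0 : 0 ≤ lam := (le_max_right _ _).trans hlo
  have hL1 : (1 : ℝ) ≤ L := by exact_mod_cast hL
  have hp : (0 : ℝ) < (d : ℝ) ^ 2 := by positivity
  have hfl : (⌊lam * d ^ 2⌋₊ : ℝ) ≤ lam * d ^ 2 := Nat.floor_le (by positivity)
  have hfl' := Nat.lt_floor_add_one (lam * d ^ 2)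
  set m := ⌊lam * d ^ 2⌋₊
  have hη1 : ((d : ℝ) ^ 2)⁻¹ ≤ 1 := inv_le_one_of_one_le₀ (by nlinarith)
  have hη0 : 0 < ((d : ℝ) ^ 2)⁻¹ := by positivity
  have hmη : (m : ℝ) * ((d : ℝ) ^ 2)⁻¹ ≤ lam := by
    rw [← div_eq_mul_inv, div_le_iff₀ hp]; exact hfl
  refine ⟨m + 1, ?_, ?_, ?_, ?_, ?_, ?_⟩
  · have h5 : lam ≤ 2 * d * d := hhi.trans (by gcongr; exact_mod_cast hLd.trans hsqrtd)
    have : (m : ℝ) ≤ 2 * d ^ 4 := by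
      refine hfl.trans ?_
      calc lam * (d : ℝ) ^ 2 ≤ (2 * d * d) * (d : ℝ) ^ 2 := by gcongr
        _ = 2 * (d : ℝ) ^ 4 := by ring
    have : m ≤ 2 * d ^ 4 := by exact_mod_cast this
    omega
  · have : L ≤ d := by exact_mod_cast hLd.trans hsqrtd
    omega
  · rw [← div_eq_mul_inv, lt_div_iff₀ hp]; push_cast; exact hfl'
  · push_cast; linarith
  · push_cast; nlinarith [Nat.cast_nonneg (α := ℝ) m]
  · push_cast
    have : 1 ≤ 2 * L * Real.log d := by nlinarith
    linarith

/-- The exponential moment is taken at t = 1/(d^{3/4} log d), where the sub-Gaussian exponent equals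
the constant 1156. There are at most d⁸ pairs, which adds 8 log d. -/
theorem exists_grid_bound (hd : 2 ≤ d) (θ : Fin d → ℝ) :
    ∃ W : (Fin d → ℝ) → ℝ, Integrable W (noise d) ∧
      ∫ z, W z ∂(noise d)
        ≤ (d : ℝ) ^ (3 / 4 : ℝ) * Real.log d * (8 * Real.log d + 1157) ∧
      ∀ k L : ℕ, k < 2 * d ^ 4 + 2 → L < d + 1 → 1 ≤ L → (L : ℝ) ≤ √d →
        k * ((d : ℝ) ^ 2)⁻¹ ≤ 4 * L * Real.log d → ∀ z,
        ∑ b ∈ Finset.range (numBlocks d L), groupDev θ (block d L b) (k * ((d : ℝ) ^ 2)⁻¹) z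
        ≤ W z + 2 * ∫ y, noiseExcess (4 * Real.log d) y ∂(noise d)
          + 2 * noiseExcess (4 * Real.log d) z := by
  have hd0 : (0 : ℝ) < d := by exact_mod_cast (by omega : 0 < d)
  have hl2 := half_le_log hd
  have hl0 : 0 < Real.log d := by linarith
  have hDsq := rpow_three_quarters_sq hd0
  have hD0 : 0 < (d : ℝ) ^ (3 / 4 : ℝ) := Real.rpow_pos_of_pos hd0 _
  set D := (d : ℝ) ^ (3 / 4 : ℝ)
  set valid : ℕ × ℕ → Prop := fun p =>
    1 ≤ p.2 ∧ (p.2 : ℝ) ≤ √d ∧ (p.1 : ℝ) * ((d : ℝ) ^ 2)⁻¹ ≤ 4 * p.2 * Real.log d with hvalid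
  have hex := fun (p : ℕ × ℕ) (hp : valid p) =>
    exists_subGaussian_bound hd θ hp.1 hp.2.1
      (by positivity : 0 ≤ (p.1 : ℝ) * ((d : ℝ) ^ 2)⁻¹) hp.2.2
  choose! X hX1 hX2 hX3 using hex
  classical
  set S := (Finset.range (2 * d ^ 4 + 2) ×ˢ Finset.range (d + 1)).filter valid with hS
  have hcard : (S.card : ℝ) ≤ Real.exp (8 * Real.log d) := by
    have h1 : S.card ≤ (2 * d ^ 4 + 2) * (d + 1) := by
      refine (Finset.card_filter_le _ _).trans ?_
      rw [Finset.card_product]; simp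
    have h2 : (S.card : ℝ) ≤ (2 * d ^ 4 + 2) * (d + 1) := by exact_mod_cast h1
    refine (h2.trans (card_grid_le hd)).trans (le_of_eq ?_)
    rw [mul_comm, Real.exp_mul, Real.exp_log hd0]
    norm_cast
  obtain ⟨W, hWi, hWint, hW⟩ := exists_integrable_upper_bound (μ := noise d) S X
    (t := (D * Real.log d)⁻¹) (a := 8 * Real.log d + 1156) (κ := 1156) (by positivity)
    (fun j hj => hX1 j (Finset.mem_filter.1 hj).2 _)
    (fun j hj => (hX2 j (Finset.mem_filter.1 hj).2 _).trans (Real.exp_le_exp.2 (by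
      rw [← hDsq, inv_pow, mul_pow, mul_assoc, mul_inv_cancel₀ (by positivity), mul_one])))
    (by rw [Real.exp_add]; gcongr)
  refine ⟨W, hWi, ?_, fun k L hk hL hL1 hLd hkL z => ?_⟩
  · rw [inv_inv] at hWint
    refine hWint.trans (le_of_eq ?_)
    ring
  · have hv : valid (k, L) := ⟨hL1, hLd, hkL⟩
    have hmem : (k, L) ∈ S := by
      rw [hS, Finset.mem_filter, Finset.mem_product, Finset.mem_range, Finset.mem_range]
      exact ⟨⟨hk, hL⟩, hv⟩
    have h7 := hX3 (k, L) hv z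
    have h8 := hW (k, L) hmem z
    exact h7.trans (by linarith)

/-- The loss exceeds SURE, uniformly over the search range, by at most an integrable variable of
mean `O(d^{3/4} (log d)²)`. -/
theorem exists_envelope : ∃ C : ℝ, 0 < C ∧ ∀ d : ℕ, 2 ≤ d → ∀ θ : Fin d → ℝ,
    ∃ G : (Fin d → ℝ) → ℝ, Integrable G (noise d) ∧
      ∫ z, G z ∂(noise d) ≤ C * ((d : ℝ) ^ (3 / 4 : ℝ) * Real.log d ^ 2) ∧
      ∀ᵐ z ∂(noise d), ∀ lam L, InSearchRange d lam L →
        sqLoss (blockJS lam L) θ z ≤ sure (θ + z) lam L + G z := by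
  refine ⟨3000, by norm_num, fun d hd θ => ?_⟩
  have hd1 : (1 : ℝ) ≤ d := by exact_mod_cast (by omega : 1 ≤ d)
  have hl2 := half_le_log hd
  obtain ⟨W, hWi, hWint, hW⟩ := exists_grid_bound hd θ
  obtain ⟨hRi, hRint⟩ := integrable_gridError hd θ
  have hE := integral_noiseExcess_four_log_le hd
  have hEi := integrable_noiseExcess (d := d) (4 * Real.log d)
  set E := ∫ y, noiseExcess (4 * Real.log d) y ∂(noise d) with hEdef
  have i1 : Integrable (fun z => W z + 2 * E) (noise d) := hWi.add (integrable_const _)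
  have i2 : Integrable (fun z => W z + 2 * E + 2 * noiseExcess (4 * Real.log d) z) (noise d) :=
    i1.add (hEi.const_mul 2)
  refine ⟨fun z => W z + 2 * E + 2 * noiseExcess (4 * Real.log d) z + 2 * gridError θ z,
    i2.add (hRi.const_mul 2), ?_, ?_⟩
  · rw [integral_add i2 (hRi.const_mul 2), integral_add i1 (hEi.const_mul 2),
      integral_add hWi (integrable_const _)]
    simp only [integral_const_mul, integral_const, probReal_univ, one_smul, ← hEdef]
    have hDs := sqrt_le_rpow_three_quarters hd1
    have hD1 := (Real.one_le_sqrt.2 hd1).trans hDs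
    set D := (d : ℝ) ^ (3 / 4 : ℝ)
    set l := Real.log d
    have t1 : D ≤ 4 * (D * l ^ 2) := by
      nlinarith [mul_nonneg (zero_le_one.trans hD1) (show 0 ≤ 4 * l ^ 2 - 1 by nlinarith)]
    have t2 : D * l ≤ 2 * (D * l ^ 2) := by
      nlinarith [mul_nonneg (zero_le_one.trans hD1) (show 0 ≤ 2 * l ^ 2 - l by nlinarith)]
    have t3 : D * l * (8 * l + 1157) = 8 * (D * l ^ 2) + 1157 * (D * l) := by ring
    rw [t3] at hWint
    linarith
  · filter_upwards [ae_add_ne_zero θ] with z hz lam L hr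
    obtain ⟨k, hk, hLd1, h1, h2, h3, h4⟩ := exists_grid_point hd hr
    have hL := hr.1
    have h0 : 0 ≤ lam := (le_max_right _ _).trans hr.2.2.1
    rw [sqLoss_blockJS_eq_sure_add hL hz]
    have hsη : √((d : ℝ) ^ 2)⁻¹ = (d : ℝ)⁻¹ := by
      rw [← inv_pow, Real.sqrt_sq (by positivity)]
    have hstep : ∑ b ∈ Finset.range (numBlocks d L), groupDev θ (block d L b) lam z
        ≤ ∑ b ∈ Finset.range (numBlocks d L),
            groupDev θ (block d L b) (k * ((d : ℝ) ^ 2)⁻¹) z + 2 * gridError θ z := by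
      rw [gridError, ← sum_blocks hL, Finset.mul_sum, ← Finset.sum_add_distrib]
      refine Finset.sum_le_sum fun b hb => ?_
      have := groupDev_le_of_lt (block_nonempty hL (Finset.mem_range.1 hb)) hz h0 h1 h2 h3
      rwa [hsη] at this
    have h7 := hW k L hk hLd1 hL hr.2.1 h4 z
    linarith

end Envelope

/-! ### The hybrid estimator -/

section Hybrid

variable {d : ℕ}

/-- For x² > a put y = x - a/x, the estimate, and u = x + a/x. Then y + u = 2x and u² = y² + 4a, so
(y - θ)² - θ² = y(2z - u). For x > 0 this is nonpositive if 2z ≤ u; otherwise it is at most (2z -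
u)(2z + u) + y² = 4(z² - a), as y ≤ u. The case x < 0 is symmetric. -/
theorem garrote_sq_le {a x θ z : ℝ} (ha : 0 ≤ a) (hx : x ≠ 0) (hxz : x = θ + z) :
    (max (1 - a / x ^ 2) 0 * x - θ) ^ 2 ≤ θ ^ 2 + 4 * max (z ^ 2 - a) 0 := by
  have hx2 : 0 < x ^ 2 := by positivity
  have hm : 0 ≤ max (z ^ 2 - a) 0 := le_max_right _ _
  rcases le_or_gt (x ^ 2) a with h | h
  · rw [max_eq_right (by rw [sub_nonpos, one_le_div hx2]; exact h)]
    linarith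
  · rw [max_eq_left (by rw [sub_nonneg, div_le_one hx2]; exact h.le)]
    set y := (1 - a / x ^ 2) * x with hy
    set u := (1 + a / x ^ 2) * x with hu
    have hyx : 0 ≤ y * x := by
      have : y * x = x ^ 2 - a := by rw [hy]; field_simp
      linarith
    have huy : u ^ 2 = y ^ 2 + 4 * a := by rw [hu, hy]; field_simp; ring
    have hyu : y + u = 2 * x := by rw [hu, hy]; ring
    have hcross : y ^ 2 - 2 * θ * y = y * (2 * z - u) := by
      have : θ = x - z := by linarith
      rw [this]; linear_combination y * hyu
    have huy' : |y| ≤ |u| := by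
      refine sq_le_sq.1 ?_
      linarith
    have key : y * (2 * z - u) ≤ 4 * max (z ^ 2 - a) 0 := by
      have hz : z ^ 2 - a ≤ max (z ^ 2 - a) 0 := le_max_left _ _
      have e : 4 * (z ^ 2 - a) = (2 * z - u) * (2 * z + u) + y ^ 2 := by
        linear_combination huy
      rcases lt_or_gt_of_ne hx with h0 | h0
      · have hy0 : y ≤ 0 := by by_contra hc; nlinarith
        have hu0 : u ≤ 0 := by
          rw [hu]; exact mul_nonpos_of_nonneg_of_nonpos (by positivity) h0.le
        rw [abs_of_nonpos hy0, abs_of_nonpos hu0] at huy'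
        rcases le_or_gt u (2 * z) with h1 | h1
        · nlinarith
        · nlinarith [mul_nonneg (sub_nonneg.2 h1.le) (show 0 ≤ y - 2 * z - u by linarith),
            sq_nonneg y]
      · have hy0 : 0 ≤ y := by by_contra hc; nlinarith
        have hu0 : 0 ≤ u := by rw [hu]; positivity
        rw [abs_of_nonneg hy0, abs_of_nonneg hu0] at huy'
        rcases le_or_gt (2 * z) u with h1 | h1
        · nlinarith
        · nlinarith [mul_nonneg (sub_nonneg.2 h1.le) (show 0 ≤ 2 * z + u - y by linarith),
            sq_nonneg y]
    nlinarith

theorem sqLoss_garrote_le (hd : 2 ≤ d) {θ z : Fin d → ℝ} (hx : ∀ i, (θ + z) i ≠ 0) :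
    sqLoss garrote θ z ≤ ∑ i, θ i ^ 2 + 4 * noiseExcess (2 * Real.log d) z := by
  have hl := half_le_log hd
  rw [sqLoss, noiseExcess, Finset.mul_sum, ← Finset.sum_add_distrib]
  exact Finset.sum_le_sum fun i _ => garrote_sq_le (by linarith) (hx i) rfl

theorem mul_sparsityStat (hd : 2 ≤ d) (θ z : Fin d → ℝ) :
    d * sparsityStat (θ + z)
      = ∑ i, (z i ^ 2 - 1) + 2 * ∑ i, z i * θ i + ∑ i, θ i ^ 2 := by
  have hd0 : (d : ℝ) ≠ 0 := by exact_mod_cast (by omega : d ≠ 0)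
  rw [sparsityStat, mul_inv_cancel_left₀ hd0, Finset.mul_sum, ← Finset.sum_add_distrib,
    ← Finset.sum_add_distrib]
  exact Finset.sum_congr rfl fun i _ => by simp only [Pi.add_apply]; ring

theorem mul_sparsityLevel (hd : 2 ≤ d) :
    d * sparsityLevel d = √d * Real.logb 2 d ^ (3 / 2 : ℝ) := by
  have hd0 : (0 : ℝ) < d := by exact_mod_cast (by omega : 0 < d)
  rw [sparsityLevel, ← mul_assoc, Real.sqrt_eq_rpow]
  congr 1
  nth_rewrite 1 [← Real.rpow_one (d : ℝ)]
  rw [← Real.rpow_add hd0]; norm_num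

theorem logb_nonneg_of_two_le (hd : 2 ≤ d) : 0 ≤ Real.logb 2 d :=
  Real.logb_nonneg (by norm_num) (by exact_mod_cast (by omega : 1 ≤ d))

theorem sparsityLevel_nonneg (hd : 2 ≤ d) : 0 ≤ sparsityLevel d :=
  mul_nonneg (Real.rpow_nonneg (Nat.cast_nonneg _) _) (Real.rpow_nonneg (logb_nonneg_of_two_le hd) _)

theorem logb_rpow_le (hd : 2 ≤ d) : Real.logb 2 d ^ (3 / 2 : ℝ) ≤ 4 * Real.log d ^ 2 := by
  have hl := half_le_log hd
  have h0 := logb_nonneg_of_two_le hd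
  have h2 : Real.logb 2 d ≤ 2 * Real.log d := by
    have := Real.log_two_gt_d9
    rw [Real.logb, div_le_iff₀ (by linarith)]
    nlinarith
  calc Real.logb 2 d ^ (3 / 2 : ℝ) ≤ (2 * Real.log d) ^ (3 / 2 : ℝ) :=
        Real.rpow_le_rpow h0 h2 (by norm_num)
    _ ≤ (2 * Real.log d) ^ (2 : ℝ) :=
        Real.rpow_le_rpow_of_exponent_le (by linarith) (by norm_num)
    _ = 4 * Real.log d ^ 2 := by norm_cast; ring

/-- An upper bound for the loss of the hybrid estimator where it falls back on the garrote. -/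
def fallbackBound (θ z : Fin d → ℝ) : ℝ :=
  2 * (d * sparsityLevel d) + 2 * |∑ i, (z i ^ 2 - 1)|
    + 4 * ((∑ i, z i * θ i) ^ 2 / ∑ i, θ i ^ 2) + 4 * noiseExcess (2 * Real.log d) z

theorem noiseExcess_nonneg (a : ℝ) (z : Fin d → ℝ) : 0 ≤ noiseExcess a z :=
  Finset.sum_nonneg fun _ _ => le_max_right _ _

theorem fallbackBound_nonneg (hd : 2 ≤ d) (θ z : Fin d → ℝ) : 0 ≤ fallbackBound θ z := by
  have h1 := sparsityLevel_nonneg hd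
  have h2 := noiseExcess_nonneg (2 * Real.log d) z
  have h3 : 0 ≤ ∑ i, θ i ^ 2 := Finset.sum_nonneg fun _ _ => sq_nonneg _
  unfold fallbackBound
  positivity

/-- With A = ‖θ‖², Y = ∑(zᵢ² - 1) and W = ⟨z, θ⟩, the failed test reads A + 2W + Y ≤ d γ_d.
Absorbing -2W ≤ A/2 + 2W²/A gives A ≤ 2dγ_d + 2|Y| + 4W²/A, a bound without θ in the mean, since E
W² = A. For θ = 0 the quotient is 0 and so is W. -/
theorem sqLoss_garrote_le_fallbackBound (hd : 2 ≤ d) {θ z : Fin d → ℝ} (hx : ∀ i, (θ + z) i ≠ 0)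
    (hT : sparsityStat (θ + z) ≤ sparsityLevel d) : sqLoss garrote θ z ≤ fallbackBound θ z := by
  have hd0 : (0 : ℝ) < d := by exact_mod_cast (by omega : 0 < d)
  have h1 := sqLoss_garrote_le hd hx
  have h2 := mul_le_mul_of_nonneg_left hT hd0.le
  rw [mul_sparsityStat hd] at h2
  have hcs := Finset.sum_mul_sq_le_sq_mul_sq Finset.univ z θ
  have hA : 0 ≤ ∑ i, θ i ^ 2 := Finset.sum_nonneg fun _ _ => sq_nonneg _
  unfold fallbackBound
  set A := ∑ i, θ i ^ 2
  set W := ∑ i, z i * θ i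
  set Y := ∑ i, (z i ^ 2 - 1)
  have hY := neg_abs_le Y
  have hW : -(2 * W) ≤ A / 2 + 2 * (W ^ 2 / A) := by
    rcases hA.eq_or_lt with h0 | h0
    · rw [← h0, mul_zero] at hcs
      have : W = 0 := by nlinarith [sq_nonneg W]
      rw [← h0, this]; simp
    · have e : A / 2 + 2 * (W ^ 2 / A) + 2 * W = (A + 2 * W) ^ 2 / (2 * A) := by field_simp; ring
      have : 0 ≤ (A + 2 * W) ^ 2 / (2 * A) := by positivity
      linarith
  linarith

/-- The true order is √d (log d)²: d γ_d = √d (log₂ d)^{3/2}, E|Y| = O(√d), and the other two terms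
have bounded means. The larger d^{3/4} matches the envelope. -/
theorem integral_fallbackBound_le (hd : 2 ≤ d) (θ : Fin d → ℝ) :
    Integrable (fallbackBound θ) (noise d) ∧
    ∫ z, fallbackBound θ z ∂(noise d)
      ≤ (192 + 4 * chiVar) * ((d : ℝ) ^ (3 / 4 : ℝ) * Real.log d ^ 2) := by
  have hd0 : (0 : ℝ) < d := by exact_mod_cast (by omega : 0 < d)
  have hd1 : (1 : ℝ) ≤ d := by exact_mod_cast (by omega : 1 ≤ d)
  have hl := half_le_log hd
  have hs0 : 0 < √(d : ℝ) := Real.sqrt_pos.2 hd0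
  obtain ⟨iY, hY⟩ := integral_sq_chi (d := d) Finset.univ
  obtain ⟨iW, hW⟩ := integral_sq_lin θ Finset.univ
  have iE := integrable_noiseExcess (d := d) (2 * Real.log d)
  have iYa : Integrable (fun z : Fin d → ℝ => |∑ i, (z i ^ 2 - 1)|) (noise d) :=
    (integrable_finsetSum _ fun i _ => (integrable_noise_eval (integrable_pow_stdNormal 2) i).sub
      (integrable_const 1)).abs
  have iYs : Integrable (fun z : Fin d → ℝ => (√d + (∑ i, (z i ^ 2 - 1)) ^ 2 / √d) / 2)
      (noise d) := ((integrable_const _).add (iY.div_const _)).div_const 2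
  have hYa : ∫ z : Fin d → ℝ, |∑ i, (z i ^ 2 - 1)| ∂(noise d) ≤ √d * (1 + chiVar) / 2 := by
    calc _ ≤ ∫ z : Fin d → ℝ, (√d + (∑ i, (z i ^ 2 - 1)) ^ 2 / √d) / 2 ∂(noise d) := by
          refine integral_mono iYa iYs fun z => ?_
          simp only
          set Y := ∑ i, (z i ^ 2 - 1)
          have e : (√d + Y ^ 2 / √d) / 2 - |Y| = (√d - |Y|) ^ 2 / (2 * √d) := by
            field_simp; rw [← sq_abs Y]; ring
          have : 0 ≤ (√d - |Y|) ^ 2 / (2 * √d) := by positivity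
          linarith
      _ = √d * (1 + chiVar) / 2 := by
          rw [integral_div, integral_add (integrable_const _) (iY.div_const _), integral_div, hY]
          simp only [integral_const, probReal_univ, one_smul, Finset.card_univ, Fintype.card_fin]
          have : (d : ℝ) * chiVar / √d = √d * chiVar := by
            rw [mul_div_right_comm, Real.div_sqrt]
          rw [this]; ring
  have hWa : ∫ z : Fin d → ℝ, (∑ i, z i * θ i) ^ 2 / ∑ i, θ i ^ 2 ∂(noise d) ≤ 1 := by
    rw [integral_div, hW]
    exact div_self_le_one _
  have hEx : ∫ z, noiseExcess (2 * Real.log d) z ∂(noise d) ≤ 10 := by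
    refine (integral_noiseExcess_le (by linarith)).trans ?_
    have e1 : Real.exp (-(2 * Real.log d / 2)) = (d : ℝ)⁻¹ := by
      rw [mul_div_cancel_left₀ _ two_ne_zero, Real.exp_neg, Real.exp_log hd0]
    have e2 : 1 ≤ √(2 * Real.log d) := Real.one_le_sqrt.2 (by linarith)
    rw [e1]
    calc d * (10 * (d : ℝ)⁻¹ / √(2 * Real.log d)) ≤ d * (10 * (d : ℝ)⁻¹) := by
          gcongr; exact div_le_self (by positivity) e2
      _ = 10 := by field_simp
  have i1 : Integrable (fun z : Fin d → ℝ => 2 * (d * sparsityLevel d)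
      + 2 * |∑ i, (z i ^ 2 - 1)|) (noise d) := (integrable_const _).add (iYa.const_mul 2)
  have i2 : Integrable (fun z : Fin d → ℝ => 2 * (d * sparsityLevel d)
      + 2 * |∑ i, (z i ^ 2 - 1)| + 4 * ((∑ i, z i * θ i) ^ 2 / ∑ i, θ i ^ 2)) (noise d) :=
    i1.add ((iW.div_const _).const_mul 4)
  refine ⟨i2.add (iE.const_mul 4), ?_⟩
  unfold fallbackBound
  rw [integral_add i2 (iE.const_mul 4), integral_add i1 ((iW.div_const _).const_mul 4),
    integral_add (integrable_const _) (iYa.const_mul 2)]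
  simp only [integral_const_mul, integral_const, probReal_univ, one_smul]
  rw [mul_sparsityLevel hd]
  have hγ : √(d : ℝ) * Real.logb 2 d ^ (3 / 2 : ℝ) ≤ √d * (4 * Real.log d ^ 2) := by
    gcongr; exact logb_rpow_le hd
  have hDs := sqrt_le_rpow_three_quarters hd1
  have hD1 := (Real.one_le_sqrt.2 hd1).trans hDs
  set D := (d : ℝ) ^ (3 / 4 : ℝ)
  set l := Real.log d
  have hc := chiVar_nonneg
  have hl4 : 1 ≤ 4 * l ^ 2 := by nlinarith
  have t1 : √(d : ℝ) * (4 * l ^ 2) ≤ D * (4 * l ^ 2) := by gcongr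
  have t2 : √(d : ℝ) ≤ D * (4 * l ^ 2) := by nlinarith
  have t3 : 1 ≤ D * (4 * l ^ 2) := by nlinarith
  have t4 : √(d : ℝ) * chiVar ≤ D * (4 * l ^ 2) * chiVar := by gcongr
  nlinarith

/-- The loss of a SureBlock estimator is at most SURE at every admissible pair of parameters, up
to an integrable variable of mean `O(d^{3/4} (log d)²)`. -/
theorem exists_sureBlock_envelope : ∃ C : ℝ, 0 < C ∧ ∀ d : ℕ, 2 ≤ d →
    ∀ est : (Fin d → ℝ) → (Fin d → ℝ), IsSureBlock est → ∀ θ : Fin d → ℝ,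
    ∃ K : (Fin d → ℝ) → ℝ, Integrable K (noise d) ∧
      ∫ z, K z ∂(noise d) ≤ C * ((d : ℝ) ^ (3 / 4 : ℝ) * Real.log d ^ 2) ∧
      ∀ᵐ z ∂(noise d), ∀ lam L, InSearchRange d lam L →
        sqLoss est θ z ≤ sure (θ + z) lam L + K z := by
  obtain ⟨C, hC, h⟩ := exists_envelope
  refine ⟨C + (192 + 4 * chiVar), by have := chiVar_nonneg; positivity, fun d hd est hest θ => ?_⟩
  obtain ⟨G, hGi, hG, hGz⟩ := h d hd θ
  obtain ⟨iF, hF⟩ := integral_fallbackBound_le hd θ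
  obtain ⟨lam, L, hmin, rfl⟩ := hest
  refine ⟨fun z => G z + fallbackBound θ z, hGi.add iF, ?_, ?_⟩
  · rw [integral_add hGi iF]; linarith
  · filter_upwards [hGz, ae_add_ne_zero θ] with z hz hx lam' L' hr
    have h1 := hz _ _ (hmin (θ + z)).1
    have h2 := (hmin (θ + z)).2 lam' L' hr
    have h3 := fallbackBound_nonneg hd θ z
    -- As this loss is nonnegative, so is SURE + G at every pair. Hence in the garrote case the
    -- fallback bound may simply be added.
    have h0 : 0 ≤ sqLoss (blockJS (lam (θ + z)) (L (θ + z))) θ z :=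
      Finset.sum_nonneg fun _ _ => sq_nonneg _
    by_cases hT : sparsityLevel d < sparsityStat (θ + z)
    · have e : sqLoss (hybrid lam L) θ z = sqLoss (blockJS (lam (θ + z)) (L (θ + z))) θ z := by
        simp only [sqLoss, hybrid, hT, if_true]
      rw [e]; linarith
    · have e : sqLoss (hybrid lam L) θ z = sqLoss garrote θ z := by
        simp only [sqLoss, hybrid, hT, if_false]
      have := sqLoss_garrote_le_fallbackBound hd hx (not_lt.1 hT)
      rw [e]; linarith

/-- Only the majorant has to be integrable: the lower Lebesgue integral is monotone for arbitrary
functions. The estimator may therefore depend on x in any way. -/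
theorem risk_le_of_ae_le {est : (Fin d → ℝ) → (Fin d → ℝ)} {θ : Fin d → ℝ} (hd : 2 ≤ d)
    {B : (Fin d → ℝ) → ℝ} (hB : Integrable B (noise d))
    (h : ∀ᵐ z ∂(noise d), sqLoss est θ z ≤ B z) :
    risk est θ ≤ ENNReal.ofReal ((d : ℝ)⁻¹ * ∫ z, B z ∂(noise d)) := by
  have hd0 : (0 : ℝ) < d := by exact_mod_cast (by omega : 0 < d)
  have hB0 : 0 ≤ᵐ[noise d] B := by
    filter_upwards [h] with z hz
    exact (Finset.sum_nonneg fun _ _ => sq_nonneg _ : 0 ≤ sqLoss est θ z).trans hz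
  rw [risk, ENNReal.ofReal_mul (by positivity), ENNReal.ofReal_inv_of_pos hd0,
    ENNReal.ofReal_natCast, ofReal_integral_eq_lintegral_ofReal hB hB0]
  refine mul_le_mul' le_rfl (lintegral_mono_ae ?_)
  filter_upwards [h] with z hz
  exact ENNReal.ofReal_le_ofReal hz

theorem risk_blockJS (hd : 2 ≤ d) (θ : Fin d → ℝ) {lam : ℝ} {L : ℕ} (hl : 0 ≤ lam) (hL : 1 ≤ L) :
    risk (blockJS lam L) θ
      = ENNReal.ofReal ((d : ℝ)⁻¹ * ∫ z, sqLoss (blockJS lam L) θ z ∂(noise d)) := by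
  have hd0 : (0 : ℝ) < d := by exact_mod_cast (by omega : 0 < d)
  rw [risk, ENNReal.ofReal_mul (by positivity), ENNReal.ofReal_inv_of_pos hd0,
    ENNReal.ofReal_natCast, ofReal_integral_eq_lintegral_ofReal (integrable_sqLoss_blockJS θ hl hL)
      (Filter.Eventually.of_forall fun z => Finset.sum_nonneg fun _ _ => sq_nonneg _)]
  rfl

/-- The remainder `d⁻¹ · d^{3/4} (log d)²` is of the order claimed. -/
theorem inv_mul_rpow_le (hd : 2 ≤ d) {C : ℝ} (hC : 0 ≤ C) :
    (d : ℝ)⁻¹ * (C * ((d : ℝ) ^ (3 / 4 : ℝ) * Real.log d ^ 2))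
      ≤ 2 * C * (d : ℝ) ^ (-(1 / 4) : ℝ) * Real.log d ^ (5 / 2 : ℝ) := by
  have hd0 : (0 : ℝ) < d := by exact_mod_cast (by omega : 0 < d)
  have hl := half_le_log hd
  have hl0 : 0 < Real.log d := by linarith
  have e1 : (d : ℝ)⁻¹ * (d : ℝ) ^ (3 / 4 : ℝ) = (d : ℝ) ^ (-(1 / 4) : ℝ) := by
    rw [← Real.rpow_neg_one, ← Real.rpow_add hd0]; norm_num
  have e2 : Real.log d ^ (5 / 2 : ℝ) = Real.log d ^ 2 * √(Real.log d) := by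
    rw [Real.sqrt_eq_rpow, ← Real.rpow_natCast, ← Real.rpow_add hl0]; norm_num
  have e3 : 1 / 2 ≤ √(Real.log d) := Real.le_sqrt_of_sq_le (by norm_num; linarith)
  calc (d : ℝ)⁻¹ * (C * ((d : ℝ) ^ (3 / 4 : ℝ) * Real.log d ^ 2))
      = 2 * C * ((d : ℝ)⁻¹ * (d : ℝ) ^ (3 / 4 : ℝ)) * (Real.log d ^ 2 * (1 / 2)) := by ring
    _ ≤ 2 * C * (d : ℝ) ^ (-(1 / 4) : ℝ) * (Real.log d ^ 2 * √(Real.log d)) := by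
        rw [e1]; gcongr
    _ = _ := by rw [e2]

end Hybrid

/-! ### Comparison with the oracles -/

section Oracles

variable {d : ℕ}

/-- Put Λ = 2 L log d. If 4‖z‖² ≤ Λ the reflection argument applies. Otherwise both losses at Λ are
at most 2‖z‖² + 2Λ ≤ 10‖z‖², while ‖z‖² > L log d / 2 makes the excess over the slightly lower level
log d / 2 - 1/4 at least ‖z‖²/(2 log d). -/
theorem groupLoss_symm_le_add_excess (hd : 2 ≤ d) {θ z : Fin d → ℝ} {B : Finset (Fin d)} {L : ℕ}
    {lam : ℝ} (hBL : B.card ≤ L) (hs : 0 < groupSq (θ + z) B) (hs' : 0 < groupSq (θ + -z) B)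
    (hlam : 2 * L * Real.log d ≤ lam) :
    groupLoss θ B (2 * L * Real.log d) z + groupLoss θ B (2 * L * Real.log d) (-z)
      ≤ groupLoss θ B lam z + groupLoss θ B lam (-z)
        + 40 * Real.log d * ∑ i ∈ B, max (z i ^ 2 - (Real.log d / 2 - 1 / 4)) 0 := by
  have hl := half_le_log hd
  have hE : 0 ≤ ∑ i ∈ B, max (z i ^ 2 - (Real.log d / 2 - 1 / 4)) 0 :=
    Finset.sum_nonneg fun _ _ => le_max_right _ _
  have hex := sum_sq_sub_le_excess (Real.log d / 2 - 1 / 4) z B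
  have hn1 := groupLoss_nonneg θ B lam z
  have hn2 := groupLoss_nonneg θ B lam (-z)
  have hL0 : (0 : ℝ) ≤ L := Nat.cast_nonneg L
  have hc : (B.card : ℝ) ≤ L := by exact_mod_cast hBL
  rcases le_or_gt (4 * ∑ i ∈ B, z i ^ 2) (2 * L * Real.log d) with h | h
  · have := groupLoss_symm_le hs hs' h hlam
    have : 0 ≤ 40 * Real.log d * ∑ i ∈ B, max (z i ^ 2 - (Real.log d / 2 - 1 / 4)) 0 := by
      have : 0 ≤ Real.log d := by linarith
      positivity
    linarith
  · have hΛ : 0 ≤ 2 * L * Real.log d := by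
      have : 0 ≤ Real.log d := by linarith
      positivity
    have h1 := groupLoss_le θ B hΛ z
    have h2 := groupLoss_le θ B hΛ (-z)
    simp only [Pi.neg_apply, even_two, Even.neg_pow] at h2
    set q := ∑ i ∈ B, z i ^ 2
    set l := Real.log d
    set E := ∑ i ∈ B, max (z i ^ 2 - (l / 2 - 1 / 4)) 0
    have h3 : q - L * (l / 2 - 1 / 4) ≤ E := by
      have : (B.card : ℝ) * (l / 2 - 1 / 4) ≤ L * (l / 2 - 1 / 4) :=
        mul_le_mul_of_nonneg_right hc (by linarith)
      linarith
    have h4 : q ≤ 2 * l * E := by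
      have : 2 * l * (q - L * (l / 2 - 1 / 4)) ≤ 2 * l * E :=
        mul_le_mul_of_nonneg_left h3 (by linarith)
      nlinarith [mul_nonneg (show 0 ≤ 2 * l - 1 by linarith)
        (show 0 ≤ q - L * l / 2 by linarith)]
    nlinarith

theorem integral_noiseExcess_half_log_le (hd : 2 ≤ d) :
    ∫ z, noiseExcess (Real.log d / 2 - 1 / 4) z ∂(noise d)
      ≤ 80 * (d : ℝ) ^ (3 / 4 : ℝ) := by
  have hd0 : (0 : ℝ) < d := by exact_mod_cast (by omega : 0 < d)
  -- The bound 1/2 is too weak here, since the level log d / 2 - 1/4 has to stay away from 0.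
  have hl : 0.69 ≤ Real.log d := by
    have h1 := Real.log_two_gt_d9
    have h2 : Real.log 2 ≤ Real.log d := Real.log_le_log (by norm_num) (by exact_mod_cast hd)
    linarith
  refine (integral_noiseExcess_le (by linarith)).trans ?_
  have e1 : Real.exp (-((Real.log d / 2 - 1 / 4) / 2))
      = Real.exp (1 / 8) * (d : ℝ) ^ (-(1 / 4) : ℝ) := by
    rw [Real.rpow_def_of_pos hd0, ← Real.exp_add]; congr 1; ring
  have e2 : 1 / 4 ≤ √(Real.log d / 2 - 1 / 4) := Real.le_sqrt_of_sq_le (by linarith)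
  have e3 : Real.exp (1 / 8) ≤ 2 := by
    have h1 : Real.exp (1 / 8) ≤ Real.exp (Real.log 2) :=
      Real.exp_le_exp.2 (by linarith [Real.log_two_gt_d9])
    rwa [Real.exp_log (by norm_num)] at h1
  have e4 : (d : ℝ) * (d : ℝ) ^ (-(1 / 4) : ℝ) = (d : ℝ) ^ (3 / 4 : ℝ) := by
    nth_rewrite 1 [← Real.rpow_one (d : ℝ)]
    rw [← Real.rpow_add hd0]; norm_num
  have hp : 0 < (d : ℝ) ^ (-(1 / 4) : ℝ) := Real.rpow_pos_of_pos hd0 _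
  rw [e1]
  calc d * (10 * (Real.exp (1 / 8) * (d : ℝ) ^ (-(1 / 4) : ℝ)) / √(Real.log d / 2 - 1 / 4))
      ≤ d * (10 * (2 * (d : ℝ) ^ (-(1 / 4) : ℝ)) / (1 / 4)) := by gcongr
    _ = 80 * ((d : ℝ) * (d : ℝ) ^ (-(1 / 4) : ℝ)) := by ring
    _ = 80 * (d : ℝ) ^ (3 / 4 : ℝ) := by rw [e4]

/-- Thresholds above `2 L log d` hardly improve on the threshold `2 L log d`. -/
theorem integral_sqLoss_le_of_large_threshold (hd : 2 ≤ d) (θ : Fin d → ℝ) {L : ℕ} {lam : ℝ}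
    (hL : 1 ≤ L) (hlam : 2 * L * Real.log d ≤ lam) :
    ∫ z, sqLoss (blockJS (2 * L * Real.log d) L) θ z ∂(noise d)
      ≤ ∫ z, sqLoss (blockJS lam L) θ z ∂(noise d)
        + 3200 * ((d : ℝ) ^ (3 / 4 : ℝ) * Real.log d ^ 2) := by
  have hl := half_le_log hd
  have hΛ : 0 ≤ 2 * L * Real.log d := by
    have : 0 ≤ Real.log d := by linarith
    positivity
  set Λ := 2 * L * Real.log d with hΛdef
  have iΛ := integrable_sqLoss_blockJS θ hΛ hL
  have iM := integrable_sqLoss_blockJS θ (hΛ.trans hlam) hL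
  have hneg := measurePreserving_neg_noise (d := d)
  have iΛ' : Integrable (fun z => sqLoss (blockJS Λ L) θ (-z)) (noise d) :=
    hneg.integrable_comp_of_integrable iΛ
  have iM' : Integrable (fun z => sqLoss (blockJS lam L) θ (-z)) (noise d) :=
    hneg.integrable_comp_of_integrable iM
  have iE := (integrable_noiseExcess (d := d) (Real.log d / 2 - 1 / 4)).const_mul (40 * Real.log d)
  have hae : ∀ᵐ z ∂(noise d), sqLoss (blockJS Λ L) θ z + sqLoss (blockJS Λ L) θ (-z)
      ≤ sqLoss (blockJS lam L) θ z + sqLoss (blockJS lam L) θ (-z)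
        + 40 * Real.log d * noiseExcess (Real.log d / 2 - 1 / 4) z := by
    filter_upwards [ae_add_ne_zero θ, hneg.quasiMeasurePreserving.ae (ae_add_ne_zero θ)]
      with z hz hz'
    rw [sqLoss_blockJS hL hz, sqLoss_blockJS hL hz', sqLoss_blockJS hL hz, sqLoss_blockJS hL hz',
      noiseExcess, ← sum_blocks hL, Finset.mul_sum, ← Finset.sum_add_distrib,
      ← Finset.sum_add_distrib, ← Finset.sum_add_distrib]
    refine Finset.sum_le_sum fun b hb => ?_
    have hb' := block_nonempty hL (Finset.mem_range.1 hb)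
    exact groupLoss_symm_le_add_excess hd (block_card_le hL b) (groupSq_pos hb' hz)
      (groupSq_pos hb' hz') hlam
  -- By the invariance of the noise under reflection each side doubles; half of 40 · 80 · d^{3/4}
  -- log d is at most 3200 d^{3/4} (log d)².
  have hint := integral_mono_ae (iΛ.add iΛ') ((iM.add iM').add iE) hae
  simp only [Pi.add_apply] at hint
  rw [integral_add iΛ iΛ', integral_add (by exact iM.add iM') iE, integral_add iM iM',
    integral_noise_neg (sqLoss (blockJS Λ L) θ), integral_noise_neg (sqLoss (blockJS lam L) θ),
    integral_const_mul] at hint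
  have hE := integral_noiseExcess_half_log_le hd
  have hD : 0 ≤ (d : ℝ) ^ (3 / 4 : ℝ) := by positivity
  set D := (d : ℝ) ^ (3 / 4 : ℝ)
  set l := Real.log d
  have h1 : 40 * l * ∫ z, noiseExcess (l / 2 - 1 / 4) z ∂(noise d) ≤ 40 * l * (80 * D) :=
    mul_le_mul_of_nonneg_left hE (by linarith)
  have h2 : D * l ≤ 2 * (D * l ^ 2) := by
    nlinarith [mul_nonneg hD (show 0 ≤ 2 * l ^ 2 - l by nlinarith)]
  linarith

theorem sureBlock_le_blockOracle : ∃ c : ℝ, 0 < c ∧ ∀ d : ℕ, 2 ≤ d →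
    ∀ est : (Fin d → ℝ) → (Fin d → ℝ), IsSureBlock est → ∀ θ : Fin d → ℝ,
      risk est θ ≤ blockOracle θ +
        ENNReal.ofReal (c * (d : ℝ) ^ (-(1 / 4) : ℝ) * Real.log d ^ (5 / 2 : ℝ)) := by
  obtain ⟨C, hC, h⟩ := exists_sureBlock_envelope
  refine ⟨2 * (C + 3200), by positivity, fun d hd est hest θ => ?_⟩
  obtain ⟨K, hKi, hK, hKz⟩ := h d hd est hest θ
  have hd0 : (0 : ℝ) < d := by exact_mod_cast (by omega : 0 < d)
  have hl := half_le_log hd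
  rw [← tsub_le_iff_right]
  refine le_iInf fun L => le_iInf fun lam => le_iInf fun hr => ?_
  rw [tsub_le_iff_right]
  obtain ⟨hL, hLd, hlo⟩ := hr
  have hlam0 : 0 ≤ lam := (le_max_right _ _).trans hlo
  have hL1 : (1 : ℝ) ≤ L := by exact_mod_cast hL
  -- The oracle ranges over unbounded thresholds but the search does not, so the oracle's threshold
  -- is capped.
  set lam' := min lam (2 * L * Real.log d) with hlam'
  have hΛ : max ((L : ℝ) - 2) 0 ≤ 2 * L * Real.log d := by
    refine max_le ?_ ?_ <;> nlinarith
  have hr' : InSearchRange d lam' L := ⟨hL, hLd, le_min hlo hΛ, min_le_right _ _⟩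
  have hlam0' : 0 ≤ lam' := (le_max_right _ _).trans hr'.2.2.1
  obtain ⟨hSi, hS⟩ := integral_sure θ hlam0' hL
  have h1 := risk_le_of_ae_le hd (hSi.add hKi) (by
    filter_upwards [hKz] with z hz
    exact hz lam' L hr')
  have h2 : ∫ z, sqLoss (blockJS lam' L) θ z ∂(noise d)
      ≤ ∫ z, sqLoss (blockJS lam L) θ z ∂(noise d)
        + 3200 * ((d : ℝ) ^ (3 / 4 : ℝ) * Real.log d ^ 2) := by
    rcases le_total lam (2 * L * Real.log d) with h | h
    · rw [hlam', min_eq_left h]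
      have : 0 ≤ (d : ℝ) ^ (3 / 4 : ℝ) * Real.log d ^ 2 := by positivity
      linarith
    · rw [hlam', min_eq_right h]
      exact integral_sqLoss_le_of_large_threshold hd θ hL h
  refine h1.trans ?_
  have hR : 0 ≤ (d : ℝ)⁻¹ * ∫ z, sqLoss (blockJS lam L) θ z ∂(noise d) :=
    mul_nonneg (by positivity) (integral_nonneg fun z => Finset.sum_nonneg fun _ _ => sq_nonneg _)
  rw [risk_blockJS hd θ hlam0 hL, ← ENNReal.ofReal_add hR (by positivity)]
  refine ENNReal.ofReal_le_ofReal ?_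
  refine le_trans ?_ (add_le_add_right (inv_mul_rpow_le hd (by positivity : 0 ≤ C + 3200)) _)
  rw [← mul_add]
  refine mul_le_mul_of_nonneg_left ?_ (by positivity)
  simp only [Pi.add_apply]
  rw [integral_add hSi hKi, hS]
  linarith

/-- The left side is ab/(a + b), the minimum over t of squared bias plus variance for shrinkage by 1
- t. It lets all blocks use one common t instead of their own optimum. -/
theorem mul_div_add_le {a b t : ℝ} (ha : 0 ≤ a) (hb : 0 < b) :
    b - b ^ 2 / (a + b) ≤ a * t ^ 2 + b * (1 - t) ^ 2 := by
  have hab : 0 < a + b := by linarith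
  have e : a * t ^ 2 + b * (1 - t) ^ 2 - (b - b ^ 2 / (a + b)) = ((a + b) * t - b) ^ 2 / (a + b) := by
    field_simp; ring
  have : 0 ≤ ((a + b) * t - b) ^ 2 / (a + b) := by positivity
  linarith

theorem sureTerm_self_le {l s : ℝ} (hs : 0 < s) :
    sureTerm l s l ≤ max (l - l ^ 2 / s) 0 + 4 := by
  rw [sureTerm]
  rcases le_or_gt s l with h | h
  · simp only [h, not_lt.2 h, if_true, if_false]
    linarith [le_max_right (l - l ^ 2 / s) 0]
  · simp only [h, not_le.2 h, if_true, if_false]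
    have e : l + (l ^ 2 - 2 * l * (l - 2)) / s + 0 = (l - l ^ 2 / s) + 4 * (l / s) := by
      field_simp; ring
    rw [e]
    have : l / s ≤ 1 := (div_le_one hs).2 h.le
    linarith [le_max_left (l - l ^ 2 / s) 0]

theorem sureTerm_le_of_card_le {l s lam : ℝ} (hl : 0 ≤ l) (hs : 0 < s) (hlam : l ≤ lam) :
    sureTerm l s lam ≤ 2 * lam + 4 := by
  rw [sureTerm]
  rcases le_or_gt s lam with h | h
  · simp only [h, not_lt.2 h, if_true, if_false]
    linarith
  · simp only [h, not_le.2 h, if_true, if_false]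
    have : (lam ^ 2 - 2 * lam * (l - 2)) / s ≤ lam + 4 := by
      rw [div_le_iff₀ hs]
      nlinarith [mul_nonneg hl (hl.trans hlam)]
    linarith

/-- The function s ↦ l - l²/s is concave and so lies below its tangent at s₀, whose slope is (l/s₀)²
≤ l/s₀. The slope decreases as the signal grows, which offsets the growing fluctuations of s. -/
theorem max_sub_div_le {l s s₀ : ℝ} (hl : 0 < l) (hs : 0 < s) (hs0 : l ≤ s₀) :
    max (l - l ^ 2 / s) 0 ≤ l - l ^ 2 / s₀ + l / s₀ * |s - s₀| := by
  have hp : 0 < s₀ := hl.trans_le hs0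
  have h0 : 0 ≤ l - l ^ 2 / s₀ := by
    rw [sub_nonneg, div_le_iff₀ hp]; nlinarith
  have h1 : 0 ≤ l / s₀ * |s - s₀| := by positivity
  have hr : l / s₀ ≤ 1 := (div_le_one hp).2 hs0
  refine max_le ?_ (by linarith)
  have e : l - l ^ 2 / s = l - l ^ 2 / s₀ + (l / s₀) ^ 2 * (s - s₀)
      - l ^ 2 * (s - s₀) ^ 2 / (s * s₀ ^ 2) := by field_simp; ring
  have h2 : 0 ≤ l ^ 2 * (s - s₀) ^ 2 / (s * s₀ ^ 2) := by positivity
  have h3 : (l / s₀) ^ 2 * (s - s₀) ≤ l / s₀ * |s - s₀| := by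
    calc (l / s₀) ^ 2 * (s - s₀) ≤ (l / s₀) ^ 2 * |s - s₀| := by
          gcongr; exact le_abs_self _
      _ ≤ l / s₀ * |s - s₀| := by
          gcongr
          rw [sq]; exact mul_le_of_le_one_left (by positivity) hr
  linarith

/-- The expected SURE of one block at threshold equal to the block size. -/
theorem exists_sureTerm_bound (θ : Fin d → ℝ) {L b : ℕ} (hL : 1 ≤ L) (hb : b < numBlocks d L)
    (t : ℝ) : ∃ β : (Fin d → ℝ) → ℝ, Integrable β (noise d) ∧
      ∫ z, β z ∂(noise d) ≤ (∑ i ∈ block d L b, θ i ^ 2) * t ^ 2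
        + ((block d L b).card : ℝ) * (1 - t) ^ 2 + (7 + chiVar) * √L
        + (if (b + 1) * L ≤ d then 0 else 6 * (L : ℝ)) ∧
      ∀ z, (∀ i, (θ + z) i ≠ 0) →
        sureTerm (block d L b).card (groupSq (θ + z) (block d L b)) L ≤ β z := by
  have hne := block_nonempty hL hb
  have hL1 : (1 : ℝ) ≤ L := by exact_mod_cast hL
  have hLs : 1 ≤ √(L : ℝ) := Real.one_le_sqrt.2 hL1
  have hχ := chiVar_nonneg
  have hcard : ((block d L b).card : ℝ) ≤ L := by exact_mod_cast block_card_le hL b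
  have hA : 0 ≤ ∑ i ∈ block d L b, θ i ^ 2 := Finset.sum_nonneg fun _ _ => sq_nonneg _
  by_cases hfull : (b + 1) * L ≤ d
  · have hc : ((block d L b).card : ℝ) = L := by exact_mod_cast block_card_of_le hL hfull
    rw [hc, if_pos hfull]
    obtain ⟨iY, hY⟩ := integral_sq_chi (block d L b)
    obtain ⟨iW, hW⟩ := integral_sq_lin θ (block d L b)
    rw [hc] at hY
    set A := ∑ i ∈ block d L b, θ i ^ 2
    set r := √(L : ℝ) with hr
    have hr0 : 0 < r := by linarith
    have hr2 : r ^ 2 = L := Real.sq_sqrt (by linarith)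
    have hs0 : 0 < A + L := by linarith
    set ρ := (L : ℝ) / (A + L) with hρ
    have hρ0 : 0 ≤ ρ := by positivity
    have hρ1 : ρ ≤ 1 := (div_le_one hs0).2 (by linarith)
    have iY1 : Integrable (fun z : Fin d → ℝ =>
        (∑ i ∈ block d L b, (z i ^ 2 - 1)) ^ 2 / r) (noise d) := iY.div_const _
    have iY2 : Integrable (fun z : Fin d → ℝ =>
        (r + (∑ i ∈ block d L b, (z i ^ 2 - 1)) ^ 2 / r) / 2) (noise d) :=
      ((integrable_const _).add iY1).div_const 2
    have i1 : Integrable (fun z : Fin d → ℝ => (L - (L : ℝ) ^ 2 / (A + L)) + 4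
        + (r + (∑ i ∈ block d L b, (z i ^ 2 - 1)) ^ 2 / r) / 2) (noise d) :=
      (integrable_const _).add iY2
    have iW1 : Integrable (fun z : Fin d → ℝ =>
        ρ ^ 2 * (∑ i ∈ block d L b, z i * θ i) ^ 2 / r) (noise d) := (iW.const_mul _).div_const _
    have i2 : Integrable (fun z : Fin d → ℝ =>
        r + ρ ^ 2 * (∑ i ∈ block d L b, z i * θ i) ^ 2 / r) (noise d) :=
      (integrable_const _).add iW1
    refine ⟨fun z => (L - (L : ℝ) ^ 2 / (A + L)) + 4
        + (r + (∑ i ∈ block d L b, (z i ^ 2 - 1)) ^ 2 / r) / 2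
        + (r + ρ ^ 2 * (∑ i ∈ block d L b, z i * θ i) ^ 2 / r), i1.add i2, ?_, fun z hz => ?_⟩
    · rw [integral_add i1 i2, integral_add (integrable_const _) iY2, integral_div,
        integral_add (integrable_const _) iY1, integral_div,
        integral_add (integrable_const _) iW1, integral_div, integral_const_mul, hY, hW]
      simp only [integral_const, probReal_univ, one_smul]
      have h1 := mul_div_add_le (t := t) hA (show (0 : ℝ) < L by linarith)
      have h2 : (L : ℝ) * chiVar / r = r * chiVar := by rw [← hr2]; field_simp
      -- From ρ ≤ 1 and ρ A ≤ L: the linear fluctuation 2⟨z, θ⟩ costs only O(√L), however large θ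
      -- is.
      have h3 : ρ ^ 2 * A / r ≤ r := by
        rw [div_le_iff₀ hr0, ← sq, hr2]
        have h4 : ρ * A ≤ L := by
          rw [hρ, div_mul_eq_mul_div, div_le_iff₀ hs0]; nlinarith
        nlinarith [mul_le_mul hρ1 h4 (by positivity) zero_le_one]
      rw [h2]
      nlinarith
    · have hs := groupSq_pos hne hz
      have h1 := sureTerm_self_le (l := (L : ℝ)) hs
      have h2 := max_sub_div_le (s₀ := A + L) (by linarith : (0 : ℝ) < L) hs (by linarith)
      have hdiff : groupSq (θ + z) (block d L b) - (A + L)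
          = ∑ i ∈ block d L b, (z i ^ 2 - 1) + 2 * ∑ i ∈ block d L b, z i * θ i := by
        rw [groupSq_add, Finset.sum_sub_distrib]; simp only [Finset.sum_const, nsmul_eq_mul, hc]
        ring
      rw [hdiff] at h2
      set Y := ∑ i ∈ block d L b, (z i ^ 2 - 1)
      set W := ∑ i ∈ block d L b, z i * θ i
      have h3 : ρ * |Y + 2 * W| ≤ |Y| + 2 * (ρ * |W|) := by
        have h4 : |Y + 2 * W| ≤ |Y| + 2 * |W| := by
          refine (abs_add_le _ _).trans (le_of_eq ?_)
          rw [abs_mul, abs_two]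
        have h5 : ρ * |Y + 2 * W| ≤ ρ * (|Y| + 2 * |W|) := mul_le_mul_of_nonneg_left h4 hρ0
        have h6 : ρ * |Y| ≤ |Y| := mul_le_of_le_one_left (abs_nonneg _) hρ1
        linarith
      have h7 : |Y| ≤ (r + Y ^ 2 / r) / 2 := by
        have e : (r + Y ^ 2 / r) / 2 - |Y| = (r - |Y|) ^ 2 / (2 * r) := by
          field_simp; rw [← sq_abs Y]; ring
        have : 0 ≤ (r - |Y|) ^ 2 / (2 * r) := by positivity
        linarith
      have h8 : 2 * (ρ * |W|) ≤ r + ρ ^ 2 * W ^ 2 / r := by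
        have e : r + ρ ^ 2 * W ^ 2 / r - 2 * (ρ * |W|) = (r - ρ * |W|) ^ 2 / r := by
          field_simp; rw [← sq_abs W]; ring
        have : 0 ≤ (r - ρ * |W|) ^ 2 / r := by positivity
        linarith
      linarith
  · rw [if_neg hfull]
    -- The incomplete last block is bounded crudely, 2L + 4 ≤ 6L; this happens at most once.
    refine ⟨fun _ => 2 * (L : ℝ) + 4, integrable_const _, ?_, fun z hz => ?_⟩
    · simp only [integral_const, probReal_univ, one_smul]
      have : 0 ≤ ((block d L b).card : ℝ) * (1 - t) ^ 2 := by positivity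
      have : 0 ≤ (∑ i ∈ block d L b, θ i ^ 2) * t ^ 2 := by positivity
      have : 0 ≤ (7 + chiVar) * √(L : ℝ) := by positivity
      linarith
    · exact sureTerm_le_of_card_le (Nat.cast_nonneg _) (groupSq_pos hne hz) hcard

theorem sum_range_numBlocks_ite_le {L : ℕ} (hL : 1 ≤ L) :
    ∑ b ∈ Finset.range (numBlocks d L), (if (b + 1) * L ≤ d then 0 else 6 * (L : ℝ)) ≤ 6 * L := by
  have hsub : Finset.range (numBlocks d L) ⊆ Finset.range (d / L + 1) := by
    refine Finset.range_subset_range.2 ?_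
    rw [numBlocks, ← Nat.add_div_right d (by omega : 0 < L)]
    exact Nat.div_le_div_right (by omega)
  calc _ ≤ ∑ b ∈ Finset.range (d / L + 1), (if (b + 1) * L ≤ d then 0 else 6 * (L : ℝ)) :=
        Finset.sum_le_sum_of_subset_of_nonneg hsub fun b _ _ => by positivity
    _ ≤ 6 * L := by
        rw [Finset.sum_range_succ, Finset.sum_eq_zero fun b hb => ?_, zero_add]
        · split_ifs
          · positivity
          · exact le_rfl
        · rw [if_pos]
          exact (Nat.le_div_iff_mul_le (by omega)).1 (Finset.mem_range.1 hb)

/-- With blocks of length about `√d`, blockwise James–Stein shrinkage is almost as good as the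
linear oracle. -/
theorem exists_sure_le_linearOracle (hd : 2 ≤ d) (θ : Fin d → ℝ) : ∃ L : ℕ,
    InSearchRange d L L ∧ Integrable (fun z => sure (θ + z) L L) (noise d) ∧
    ∫ z, sure (θ + z) L L ∂(noise d) ≤ d * linearOracle θ
      + (136 + 16 * chiVar) * ((d : ℝ) ^ (3 / 4 : ℝ) * Real.log d ^ 2) := by
  have hd0 : (0 : ℝ) < d := by exact_mod_cast (by omega : 0 < d)
  have hd1 : (1 : ℝ) ≤ d := by exact_mod_cast (by omega : 1 ≤ d)
  have hl := half_le_log hd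
  have hχ := chiVar_nonneg
  set L := ⌊√(d : ℝ)⌋₊ with hLdef
  have hs1 : 1 ≤ √(d : ℝ) := Real.one_le_sqrt.2 hd1
  have hL : 1 ≤ L := Nat.le_floor (by simpa using hs1)
  have hL1 : (1 : ℝ) ≤ L := by exact_mod_cast hL
  have hLd : (L : ℝ) ≤ √d := Nat.floor_le (Real.sqrt_nonneg _)
  have hLd' : √(d : ℝ) ≤ 2 * L := by
    have := Nat.lt_floor_add_one (√(d : ℝ))
    rw [← hLdef] at this
    linarith
  refine ⟨L, ⟨hL, hLd, max_le (by linarith) (by linarith), by nlinarith⟩,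
    (integral_sure θ (Nat.cast_nonneg L) hL).1, ?_⟩
  have hN : 0 ≤ ∑ i, θ i ^ 2 := Finset.sum_nonneg fun _ _ => sq_nonneg _
  -- The optimal shrinkage for the whole vector, used in every block.
  set t := (d : ℝ) / (∑ i, θ i ^ 2 + d) with ht
  choose! β hβi hβ hβz using fun b (hb : b < numBlocks d L) => exists_sureTerm_bound θ hL hb t
  have hle : ∀ᵐ z ∂(noise d), sure (θ + z) L L ≤ ∑ b ∈ Finset.range (numBlocks d L), β b z := by
    filter_upwards [ae_add_ne_zero θ] with z hz
    exact Finset.sum_le_sum fun b hb => hβz b (Finset.mem_range.1 hb) z hz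
  refine (integral_mono_ae (integral_sure θ (Nat.cast_nonneg L) hL).1
    (integrable_finsetSum _ fun b hb => hβi b (Finset.mem_range.1 hb)) hle).trans ?_
  rw [integral_finsetSum _ fun b hb => hβi b (Finset.mem_range.1 hb)]
  refine (Finset.sum_le_sum fun b hb => hβ b (Finset.mem_range.1 hb)).trans ?_
  rw [Finset.sum_add_distrib, Finset.sum_add_distrib, Finset.sum_add_distrib, ← Finset.sum_mul,
    ← Finset.sum_mul, sum_blocks hL]
  have hcardsum : ∑ b ∈ Finset.range (numBlocks d L), ((block d L b).card : ℝ) = d := by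
    have := sum_blocks (d := d) hL fun _ => (1 : ℝ)
    simpa using this
  rw [hcardsum]
  have hmain : (∑ i, θ i ^ 2) * t ^ 2 + d * (1 - t) ^ 2 = d * linearOracle θ := by
    rw [linearOracle, ht]; field_simp; ring
  have hlast := sum_range_numBlocks_ite_le (d := d) hL
  have hDs := sqrt_le_rpow_three_quarters hd1
  have hD0 : 0 < (d : ℝ) ^ (3 / 4 : ℝ) := Real.rpow_pos_of_pos hd0 _
  -- The accumulated error is of order d/√L, and L is at least √d/2.
  have hnb : (numBlocks d L : ℝ) * √L ≤ 4 * (d : ℝ) ^ (3 / 4 : ℝ) := by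
    have hq0 : 0 < (d : ℝ) ^ (1 / 4 : ℝ) := Real.rpow_pos_of_pos hd0 _
    have hq2 : ((d : ℝ) ^ (1 / 4 : ℝ)) ^ 2 = √d := by
      rw [← Real.rpow_natCast, ← Real.rpow_mul hd0.le, Real.sqrt_eq_rpow]; norm_num
    have hqD : (d : ℝ) ^ (1 / 4 : ℝ) * (d : ℝ) ^ (3 / 4 : ℝ) = d := by
      rw [← Real.rpow_add hd0]; norm_num
    have hqL : (d : ℝ) ^ (1 / 4 : ℝ) / 2 ≤ √L := by
      refine Real.le_sqrt_of_sq_le ?_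
      rw [div_pow, hq2]; linarith
    have hmul : (numBlocks d L : ℝ) * √L * √L ≤ 2 * d := by
      rw [mul_assoc, Real.mul_self_sqrt (by linarith)]
      have h2 := numBlocks_mul_le d L
      have h3 : L ≤ d := by exact_mod_cast hLd.trans (sqrt_natCast_le_self d)
      exact_mod_cast (by omega : numBlocks d L * L ≤ 2 * d)
    have hnn : 0 ≤ (numBlocks d L : ℝ) * √L := by positivity
    have h5 : (numBlocks d L : ℝ) * √L * ((d : ℝ) ^ (1 / 4 : ℝ) / 2)
        ≤ 4 * (d : ℝ) ^ (3 / 4 : ℝ) * ((d : ℝ) ^ (1 / 4 : ℝ) / 2) := by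
      calc _ ≤ (numBlocks d L : ℝ) * √L * √L := mul_le_mul_of_nonneg_left hqL hnn
        _ ≤ 2 * d := hmul
        _ = 2 * ((d : ℝ) ^ (1 / 4 : ℝ) * (d : ℝ) ^ (3 / 4 : ℝ)) := by rw [hqD]
        _ = _ := by ring
    exact le_of_mul_le_mul_right h5 (by positivity)
  rw [Finset.sum_const, Finset.card_range, nsmul_eq_mul]
  set D := (d : ℝ) ^ (3 / 4 : ℝ)
  set l := Real.log d
  have t1 : D ≤ 4 * (D * l ^ 2) := by
    nlinarith [mul_nonneg hD0.le (show 0 ≤ 4 * l ^ 2 - 1 by nlinarith)]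
  have t2 : (numBlocks d L : ℝ) * ((7 + chiVar) * √L) ≤ (7 + chiVar) * (4 * D) := by
    calc _ = (7 + chiVar) * ((numBlocks d L : ℝ) * √L) := by ring
      _ ≤ _ := by gcongr
  have t3 : (7 + chiVar) * (4 * D) ≤ (7 + chiVar) * (4 * (4 * (D * l ^ 2))) := by gcongr
  linarith

theorem sureBlock_le_linearOracle : ∃ c : ℝ, 0 < c ∧ ∀ d : ℕ, 2 ≤ d →
    ∀ est : (Fin d → ℝ) → (Fin d → ℝ), IsSureBlock est → ∀ θ : Fin d → ℝ,
      risk est θ ≤ ENNReal.ofReal (linearOracle θ +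
        c * (d : ℝ) ^ (-(1 / 4) : ℝ) * Real.log d ^ (5 / 2 : ℝ)) := by
  obtain ⟨C, hC, h⟩ := exists_sureBlock_envelope
  have hχ := chiVar_nonneg
  refine ⟨2 * (C + (136 + 16 * chiVar)), by positivity, fun d hd est hest θ => ?_⟩
  obtain ⟨K, hKi, hK, hKz⟩ := h d hd est hest θ
  obtain ⟨L, hr, hSi, hS⟩ := exists_sure_le_linearOracle hd θ
  have hd0 : (0 : ℝ) < d := by exact_mod_cast (by omega : 0 < d)
  refine (risk_le_of_ae_le hd (hSi.add hKi) (by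
    filter_upwards [hKz] with z hz
    exact hz L L hr)).trans (ENNReal.ofReal_le_ofReal ?_)
  refine le_trans ?_ (add_le_add_right
    (inv_mul_rpow_le hd (by positivity : 0 ≤ C + (136 + 16 * chiVar))) _)
  simp only [Pi.add_apply]
  rw [integral_add hSi hKi]
  have e : linearOracle θ = (d : ℝ)⁻¹ * (d * linearOracle θ) := by
    rw [inv_mul_cancel_left₀ hd0.ne']
  rw [e, ← mul_add]
  refine mul_le_mul_of_nonneg_left ?_ (by positivity)
  linarith

end Oracles

/-! ### The sparse case -/

section Sparse

variable {d : ℕ}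

theorem sqLoss_garrote {θ z : Fin d → ℝ} (hx : ∀ i, (θ + z) i ≠ 0) :
    sqLoss garrote θ z = ∑ i, groupLoss θ {i} (2 * Real.log d) z := by
  rw [sqLoss]
  refine Finset.sum_congr rfl fun i _ => ?_
  have hs : 0 < (θ + z) i ^ 2 := by have := hx i; positivity
  rw [garrote, max_one_sub_div hs]
  simp only [groupLoss, groupSq, Finset.sum_singleton, Pi.add_apply]
  ring

theorem sureTerm_one_le {s lam : ℝ} (hl : 0 ≤ lam) (hs : 0 < s) : sureTerm 1 s lam ≤ 3 + lam := by
  rw [sureTerm]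
  rcases le_or_gt s lam with h | h
  · simp only [h, not_lt.2 h, if_true, if_false]
    linarith
  · simp only [h, not_le.2 h, if_true, if_false]
    have : (lam ^ 2 - 2 * lam * (1 - 2)) / s ≤ lam + 2 := by
      rw [div_le_iff₀ hs]; nlinarith
    linarith

/-- With λ = r², SURE is 1 + (λ² + 2λ)/s, and s ≥ (r + 1)² lowers λ²/s below λ by about 2r. A gain
of r is all that is needed. -/
theorem sureTerm_one_le_of_large {s r : ℝ} (hr : 2 ≤ r) (hs : (r + 1) ^ 2 ≤ s) :
    sureTerm 1 s (r ^ 2) ≤ 3 + r ^ 2 - r := by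
  have h1 : r ^ 2 < s := by nlinarith
  have hs0 : 0 < s := by nlinarith
  rw [sureTerm]
  simp only [h1, not_le.2 h1, if_true, if_false]
  have : ((r ^ 2) ^ 2 - 2 * r ^ 2 * (1 - 2)) / s ≤ r ^ 2 - r + 2 := by
    rw [div_le_iff₀ hs0]
    have h2 : 0 ≤ r ^ 2 - r + 2 := by nlinarith
    refine le_trans ?_ (mul_le_mul_of_nonneg_left hs h2)
    nlinarith [pow_nonneg (show 0 ≤ r by linarith) 3]
  linarith

/-- A lower bound for the probability that a standard normal variable exceeds `1` in a given
direction. -/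
def tailMass : ℝ :=
  min ((gaussianReal 0 1).real (Set.Ici 1)) ((gaussianReal 0 1).real (Set.Iic (-1)))

theorem tailMass_pos : 0 < tailMass := by
  have h : ∀ s : Set ℝ, volume s ≠ 0 → 0 < (gaussianReal 0 1).real s := by
    intro s hs
    rw [measureReal_def, ENNReal.toReal_pos_iff]
    refine ⟨pos_iff_ne_zero.2 fun h0 => hs ?_, measure_lt_top _ _⟩
    exact gaussianReal_absolutelyContinuous' 0 one_ne_zero h0
  exact lt_min (h _ (by simp)) (h _ (by simp))

theorem integral_groupLoss_singleton_le (θ : Fin d → ℝ) (i : Fin d) {lam : ℝ} (hl : 0 ≤ lam) :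
    ∫ z, groupLoss θ {i} lam z ∂(noise d) ≤ 3 + lam := by
  have hae : ∀ᵐ z ∂(noise d), groupLoss θ {i} lam z ≤ 3 + lam + groupDev θ {i} lam z := by
    filter_upwards [ae_add_ne_zero θ] with z hz
    have hs := groupSq_pos (Finset.singleton_nonempty i) hz
    rw [groupLoss_eq_sureTerm_add hs]
    simp only [Finset.card_singleton, Nat.cast_one]
    linarith [sureTerm_one_le hl hs]
  have iD := integrable_groupDev θ {i} hl
  refine (integral_mono_ae (integrable_groupLoss θ {i} hl)
    ((integrable_const _).add iD) hae).trans ?_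
  simp only [Pi.add_apply]
  rw [integral_add (integrable_const _) iD, integral_groupDev θ (Finset.singleton_nonempty i) hl]
  simp

/-- With probability at least `tailMass` the noise pushes the observation away from 0 by at least 1,
in the direction of the sign of θ_i. Then |x_i| ≥ r + 1 and SURE gains r; unbiasedness turns this
into a gain in risk. -/
theorem integral_groupLoss_singleton_le_of_large (θ : Fin d → ℝ) (i : Fin d) {r : ℝ} (hr : 2 ≤ r)
    (hθ : r ≤ |θ i|) :
    ∫ z, groupLoss θ {i} (r ^ 2) z ∂(noise d) ≤ 3 + r ^ 2 - r * tailMass := by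
  have hl : 0 ≤ r ^ 2 := sq_nonneg r
  obtain ⟨s, hsm, hsp, hsθ⟩ : ∃ s : Set ℝ, MeasurableSet s ∧ tailMass ≤ (gaussianReal 0 1).real s ∧
      ∀ x ∈ s, r + 1 ≤ |θ i + x| := by
    rcases le_total 0 (θ i) with h | h
    · rw [abs_of_nonneg h] at hθ
      refine ⟨Set.Ici 1, measurableSet_Ici, min_le_left _ _, fun x hx => ?_⟩
      rw [Set.mem_Ici] at hx
      exact le_trans (by linarith) (le_abs_self _)
    · rw [abs_of_nonpos h] at hθ
      refine ⟨Set.Iic (-1), measurableSet_Iic, min_le_right _ _, fun x hx => ?_⟩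
      rw [Set.mem_Iic] at hx
      exact le_trans (by linarith) (neg_le_abs _)
  have hsm' : MeasurableSet {z : Fin d → ℝ | z i ∈ s} := measurable_pi_apply i hsm
  have iI : Integrable ({z : Fin d → ℝ | z i ∈ s}.indicator fun _ => r) (noise d) :=
    (integrable_const r).indicator hsm'
  have hae : ∀ᵐ z ∂(noise d), groupLoss θ {i} (r ^ 2) z
      ≤ 3 + r ^ 2 - {z : Fin d → ℝ | z i ∈ s}.indicator (fun _ => r) z
        + groupDev θ {i} (r ^ 2) z := by
    filter_upwards [ae_add_ne_zero θ] with z hz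
    have hs := groupSq_pos (Finset.singleton_nonempty i) hz
    rw [groupLoss_eq_sureTerm_add hs]
    simp only [Finset.card_singleton, Nat.cast_one]
    by_cases h : z i ∈ s
    · rw [Set.indicator_of_mem (show z ∈ {z : Fin d → ℝ | z i ∈ s} from h)]
      have h2 : (r + 1) ^ 2 ≤ groupSq (θ + z) {i} := by
        simp only [groupSq, Finset.sum_singleton, Pi.add_apply]
        rw [← sq_abs (θ i + z i)]
        exact pow_le_pow_left₀ (by linarith) (hsθ _ h) 2
      linarith [sureTerm_one_le_of_large hr h2]
    · rw [Set.indicator_of_notMem (show z ∉ {z : Fin d → ℝ | z i ∈ s} from h)]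
      linarith [sureTerm_one_le hl hs]
  have iD := integrable_groupDev θ {i} hl
  have iC : Integrable (fun z => 3 + r ^ 2 - {z : Fin d → ℝ | z i ∈ s}.indicator (fun _ => r) z)
      (noise d) := (integrable_const _).sub iI
  refine (integral_mono_ae (integrable_groupLoss θ {i} hl) (iC.add iD) hae).trans ?_
  simp only [Pi.add_apply]
  rw [integral_add iC iD, integral_groupDev θ (Finset.singleton_nonempty i) hl,
    integral_sub (integrable_const _) iI, integral_indicator_const _ hsm', noise_real_eval hsm]
  simp only [integral_const, probReal_univ, smul_eq_mul]
  nlinarith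

/-- In each coordinate, the risk of the garrote is close to that of the best of keeping and
killing the observation. -/
theorem exists_integral_groupLoss_singleton_le : ∃ K : ℝ, 0 < K ∧ ∀ d : ℕ, 2 ≤ d →
    ∀ (θ : Fin d → ℝ) (i : Fin d), ∫ z, groupLoss θ {i} (2 * Real.log d) z ∂(noise d)
      ≤ min (θ i ^ 2) (2 * Real.log d) + K * (d : ℝ)⁻¹ * Real.log d ^ (-(1 / 2) : ℝ) := by
  -- For √(2 log d) ≥ R the gain r · `tailMass` outweighs the constant 3, and the risk is at most 2
  -- log d with no remainder. Below R the dimension is bounded, d² ≤ e^{R²}, and the constant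
  -- absorbs the 3.
  set R := max 2 (3 / tailMass) with hR
  refine ⟨40 + 3 * Real.exp (R ^ 2), by positivity, fun d hd θ i => ?_⟩
  have hd0 : (0 : ℝ) < d := by exact_mod_cast (by omega : 0 < d)
  have hd1 : (1 : ℝ) ≤ d := by exact_mod_cast (by omega : 1 ≤ d)
  have hl := half_le_log hd
  have hl0 : 0 < Real.log d := by linarith
  have hlam : 0 ≤ 2 * Real.log d := by linarith
  have hroot : Real.log d ^ (-(1 / 2) : ℝ) = (√(Real.log d))⁻¹ := by
    rw [Real.rpow_neg hl0.le, Real.sqrt_eq_rpow]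
  have hq0 : 0 < √(Real.log d) := Real.sqrt_pos.2 hl0
  rw [hroot]
  rcases le_or_gt (θ i ^ 2) (2 * Real.log d) with h | h
  · rw [min_eq_left h]
    have iE := integrable_noise_eval (d := d) (integrable_max_sq_sub (2 * Real.log d)) i
    have hae : ∀ᵐ z ∂(noise d), groupLoss θ {i} (2 * Real.log d) z
        ≤ θ i ^ 2 + 4 * max (z i ^ 2 - 2 * Real.log d) 0 := by
      filter_upwards [ae_add_ne_zero θ] with z hz
      have hs : 0 < (θ + z) i ^ 2 := by have := hz i; positivity
      refine le_of_eq_of_le ?_ (garrote_sq_le hlam (hz i) rfl)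
      rw [max_one_sub_div hs]
      simp only [groupLoss, groupSq, Finset.sum_singleton, Pi.add_apply]
      ring
    refine (integral_mono_ae (integrable_groupLoss θ {i} hlam)
      ((integrable_const _).add (iE.const_mul 4)) hae).trans ?_
    simp only [Pi.add_apply]
    rw [integral_add (integrable_const _) (iE.const_mul 4), integral_const_mul,
      integral_noise_eval (f := fun x => max (x ^ 2 - 2 * Real.log d) 0) (by fun_prop) i]
    simp only [integral_const, probReal_univ, one_smul]
    have h1 := integral_max_sq_sub_le (show 0 < 2 * Real.log d by linarith)
    have h2 : Real.exp (-(2 * Real.log d / 2)) = (d : ℝ)⁻¹ := by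
      rw [mul_div_cancel_left₀ _ two_ne_zero, Real.exp_neg, Real.exp_log hd0]
    have h3 : 10 * (d : ℝ)⁻¹ / √(2 * Real.log d) ≤ 10 * (d : ℝ)⁻¹ * (√(Real.log d))⁻¹ := by
      rw [div_eq_mul_inv]
      have : √(Real.log d) ≤ √(2 * Real.log d) := Real.sqrt_le_sqrt (by linarith)
      gcongr
    rw [h2] at h1
    have h4 : 0 ≤ 3 * Real.exp (R ^ 2) * (d : ℝ)⁻¹ * (√(Real.log d))⁻¹ := by positivity
    linarith
  · rw [min_eq_right h.le]
    set r := √(2 * Real.log d) with hr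
    have hr2 : r ^ 2 = 2 * Real.log d := Real.sq_sqrt hlam
    have hnn : 0 ≤ 40 * (d : ℝ)⁻¹ * (√(Real.log d))⁻¹ := by positivity
    rcases le_or_gt R r with hRr | hRr
    · have h1 := integral_groupLoss_singleton_le_of_large θ i ((le_max_left _ _).trans hRr)
        (Real.sqrt_le_iff.2 ⟨abs_nonneg _, by rw [sq_abs]; exact h.le⟩)
      rw [hr2] at h1
      have h2 : 3 ≤ r * tailMass :=
        (div_le_iff₀ tailMass_pos).1 ((le_max_right _ _).trans hRr)
      have h4 : 0 ≤ 3 * Real.exp (R ^ 2) * (d : ℝ)⁻¹ * (√(Real.log d))⁻¹ := by positivity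
      linarith
    · have h1 := integral_groupLoss_singleton_le θ i hlam
      have h2 : (d : ℝ) ^ 2 ≤ Real.exp (R ^ 2) := by
        have e : (d : ℝ) ^ 2 = Real.exp (r ^ 2) := by
          rw [hr2, two_mul, Real.exp_add, Real.exp_log hd0, sq]
        rw [e]
        exact Real.exp_le_exp.2 (pow_le_pow_left₀ (Real.sqrt_nonneg _) hRr.le 2)
      have h3 : √(Real.log d) ≤ d :=
        (Real.sqrt_le_sqrt (log_le_self hd)).trans (sqrt_natCast_le_self d)
      have h4 : 1 ≤ Real.exp (R ^ 2) * (d : ℝ)⁻¹ * (√(Real.log d))⁻¹ := by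
        rw [← div_eq_mul_inv, ← div_eq_mul_inv, le_div_iff₀ hq0, le_div_iff₀ hd0]
        nlinarith
      linarith

theorem integral_sqLoss_garrote_le {K : ℝ} (hd : 2 ≤ d) (θ : Fin d → ℝ)
    (h : ∀ i, ∫ z, groupLoss θ {i} (2 * Real.log d) z ∂(noise d)
      ≤ min (θ i ^ 2) (2 * Real.log d) + K * (d : ℝ)⁻¹ * Real.log d ^ (-(1 / 2) : ℝ)) :
    Integrable (sqLoss garrote θ) (noise d) ∧
    ∫ z, sqLoss garrote θ z ∂(noise d)
      ≤ ∑ i, min (θ i ^ 2) (2 * Real.log d) + K * Real.log d ^ (-(1 / 2) : ℝ) := by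
  have hd0 : (d : ℝ) ≠ 0 := by exact_mod_cast (by omega : d ≠ 0)
  have hlam : 0 ≤ 2 * Real.log d := by linarith [half_le_log hd]
  have hi := fun i : Fin d => integrable_groupLoss θ {i} hlam
  have hae : (fun z => ∑ i, groupLoss θ {i} (2 * Real.log d) z)
      =ᵐ[noise d] sqLoss garrote θ := by
    filter_upwards [ae_add_ne_zero θ] with z hz
    exact (sqLoss_garrote hz).symm
  refine ⟨(integrable_finsetSum _ fun i _ => hi i).congr hae, ?_⟩
  rw [← integral_congr_ae hae, integral_finsetSum _ fun i _ => hi i]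
  refine (Finset.sum_le_sum fun i _ => h i).trans (le_of_eq ?_)
  rw [Finset.sum_add_distrib]
  simp only [Finset.sum_const, Finset.card_univ, Fintype.card_fin, nsmul_eq_mul]
  field_simp

/-- A bound for the indicator function of the event that the sparsity test fails. -/
def detectionBound (θ z : Fin d → ℝ) : ℝ :=
  Real.exp ((4 * √(d : ℝ))⁻¹ * (∑ i, (z i ^ 2 - 1) - d * sparsityLevel d / 3))
    + Real.exp ((4 * √(d : ℝ))⁻¹ * (2 * ∑ i, z i * θ i - d * sparsityLevel d / 3))

theorem one_le_detectionBound (hd : 2 ≤ d) {θ z : Fin d → ℝ}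
    (hθ : (∑ i, θ i ^ 2) / d ≤ sparsityLevel d / 3)
    (hT : sparsityLevel d < sparsityStat (θ + z)) : 1 ≤ detectionBound θ z := by
  have hd0 : (0 : ℝ) < d := by exact_mod_cast (by omega : 0 < d)
  have h1 := mul_lt_mul_of_pos_left hT hd0
  rw [mul_sparsityStat hd] at h1
  rw [div_le_iff₀ hd0] at hθ
  have ht : 0 ≤ (4 * √(d : ℝ))⁻¹ := by positivity
  unfold detectionBound
  -- Of the three parts of d T_d, the signal ‖θ‖² takes at most a third of d γ_d. So ∑(zᵢ² - 1) or
  -- 2⟨z, θ⟩ reaches another third, and the corresponding exponential is at least 1.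
  rcases le_or_gt (d * sparsityLevel d / 3) (∑ i, (z i ^ 2 - 1)) with h | h
  · have := Real.one_le_exp (mul_nonneg ht (sub_nonneg.2 h))
    linarith [Real.exp_pos ((4 * √(d : ℝ))⁻¹ * (2 * ∑ i, z i * θ i - d * sparsityLevel d / 3))]
  · have h2 : d * sparsityLevel d / 3 ≤ 2 * ∑ i, z i * θ i := by linarith
    have := Real.one_le_exp (mul_nonneg ht (sub_nonneg.2 h2))
    linarith [Real.exp_pos ((4 * √(d : ℝ))⁻¹ * (∑ i, (z i ^ 2 - 1) - d * sparsityLevel d / 3))]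

theorem detectionBound_nonneg (θ z : Fin d → ℝ) : 0 ≤ detectionBound θ z := by
  unfold detectionBound; positivity

/-- The power 3/2 > 1 of log₂ d beats any multiple of log d. With u = √(log₂ d), 4u² - u³/24
vanishes at u = 96 and never exceeds 4 · 96² = 36864. The exponent 4 serves to outweigh a factor d³
later. -/
theorem exp_neg_rpow_le (hd : 2 ≤ d) :
    Real.exp (1 / 8 - Real.logb 2 d ^ (3 / 2 : ℝ) / 24) ≤ Real.exp 36865 * ((d : ℝ) ^ 4)⁻¹ := by
  have hd0 : (0 : ℝ) < d := by exact_mod_cast (by omega : 0 < d)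
  have h0 := logb_nonneg_of_two_le hd
  have hlog : Real.log d ≤ Real.logb 2 d := by
    have := Real.log_two_lt_d9
    have h2 := Real.log_two_gt_d9
    rw [Real.logb, le_div_iff₀ (by linarith)]
    nlinarith [half_le_log hd]
  have e : ((d : ℝ) ^ 4)⁻¹ = Real.exp (-(4 * Real.log d)) := by
    rw [Real.exp_neg, show (4 : ℝ) * Real.log d = (4 : ℕ) * Real.log d by norm_num,
      Real.exp_nat_mul, Real.exp_log hd0]
  rw [e, ← Real.exp_add]
  refine Real.exp_le_exp.2 ?_
  set u := √(Real.logb 2 d) with hu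
  have hu0 : 0 ≤ u := Real.sqrt_nonneg _
  have hu2 : u ^ 2 = Real.logb 2 d := Real.sq_sqrt h0
  have hu3 : Real.logb 2 d ^ (3 / 2 : ℝ) = u ^ 3 := by
    rw [hu, Real.sqrt_eq_rpow, ← Real.rpow_natCast, ← Real.rpow_mul h0]; norm_num
  rw [hu3]
  have : 4 * u ^ 2 - u ^ 3 / 24 ≤ 36864 := by
    rcases le_or_gt u 96 with h | h
    · nlinarith [pow_nonneg hu0 3]
    · nlinarith [mul_nonneg (sq_nonneg u) (show 0 ≤ u - 96 by linarith)]
  linarith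

/-- Chernoff's bound at t = 1/(4√d), with ℓ = (log₂ d)^{3/2}. The threshold contributes e^{-ℓ/12},
the chi-square part at most e^{2t²d} = e^{1/8}, and the linear part e^{2t²‖θ‖²} ≤ e^{ℓ/24} by
sparsity. -/
theorem integral_detectionBound_le (hd : 2 ≤ d) {θ : Fin d → ℝ}
    (hθ : (∑ i, θ i ^ 2) / d ≤ sparsityLevel d / 3) :
    Integrable (detectionBound θ) (noise d) ∧
    ∫ z, detectionBound θ z ∂(noise d) ≤ 2 * (Real.exp 36865 * ((d : ℝ) ^ 4)⁻¹) := by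
  have hd0 : (0 : ℝ) < d := by exact_mod_cast (by omega : 0 < d)
  have hd1 : (1 : ℝ) ≤ d := by exact_mod_cast (by omega : 1 ≤ d)
  have hs0 : 0 < √(d : ℝ) := Real.sqrt_pos.2 hd0
  have hs1 : 1 ≤ √(d : ℝ) := Real.one_le_sqrt.2 hd1
  have hs2 : √(d : ℝ) ^ 2 = d := Real.sq_sqrt hd0.le
  set t := (4 * √(d : ℝ))⁻¹ with ht
  have ht0 : 0 ≤ t := by positivity
  have ht4 : t ≤ 1 / 4 := by
    rw [ht, inv_le_comm₀ (by positivity) (by norm_num)]; linarith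
  have htd : t ^ 2 * d = 1 / 16 := by rw [ht, inv_pow, mul_pow, hs2, mul_inv, mul_assoc, inv_mul_cancel₀ hd0.ne']; norm_num
  set ℓ := Real.logb 2 d ^ (3 / 2 : ℝ) with hℓ
  have hℓ0 : 0 ≤ ℓ := Real.rpow_nonneg (logb_nonneg_of_two_le hd) _
  have hta : t * (d * sparsityLevel d / 3) = ℓ / 12 := by
    rw [mul_sparsityLevel hd, ht]; field_simp; ring
  have hN : t ^ 2 * ∑ i, θ i ^ 2 ≤ ℓ / 48 := by
    have h1 : ∑ i, θ i ^ 2 ≤ d * (ℓ / 3) := by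
      rw [div_le_iff₀ hd0] at hθ
      have h2 : d * sparsityLevel d ≤ d * ℓ := by
        rw [mul_sparsityLevel hd]
        exact mul_le_mul_of_nonneg_right (sqrt_natCast_le_self d) hℓ0
      linarith
    calc t ^ 2 * ∑ i, θ i ^ 2 ≤ t ^ 2 * (d * (ℓ / 3)) := by gcongr
      _ = ℓ / 48 := by rw [← mul_assoc, htd]; ring
  have e1 : ∀ z : Fin d → ℝ, Real.exp (t * (∑ i, (z i ^ 2 - 1) - d * sparsityLevel d / 3))
      = Real.exp (-(ℓ / 12)) * Real.exp (∑ i, t * (z i ^ 2 - 1)) := fun z => by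
    rw [← Real.exp_add, ← Finset.mul_sum, mul_sub, hta]; congr 1; ring
  have e2 : ∀ z : Fin d → ℝ, Real.exp (t * (2 * ∑ i, z i * θ i - d * sparsityLevel d / 3))
      = Real.exp (-(ℓ / 12)) * Real.exp (∑ i, (2 * t * θ i) * z i) := fun z => by
    rw [← Real.exp_add, mul_sub, hta, Finset.mul_sum, Finset.mul_sum, sub_eq_neg_add]
    congr 2
    exact Finset.sum_congr rfl fun i _ => by ring
  have i1 : Integrable (fun z : Fin d → ℝ =>
      Real.exp (t * (∑ i, (z i ^ 2 - 1) - d * sparsityLevel d / 3))) (noise d) := by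
    simp_rw [e1]
    exact (integrable_exp_sum_noise (f := fun _ x => t * (x ^ 2 - 1))
      fun _ => (integral_exp_sq_le ht0 ht4).1).const_mul _
  have i2 : Integrable (fun z : Fin d → ℝ =>
      Real.exp (t * (2 * ∑ i, z i * θ i - d * sparsityLevel d / 3))) (noise d) := by
    simp_rw [e2]
    exact (integrable_exp_sum_noise (f := fun i x => (2 * t * θ i) * x)
      fun i => integrable_exp_mul_gaussianReal _).const_mul _
  have h1 : ∫ z : Fin d → ℝ, Real.exp (t * (∑ i, (z i ^ 2 - 1) - d * sparsityLevel d / 3))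
      ∂(noise d) ≤ Real.exp (1 / 8 - ℓ / 24) := by
    simp_rw [e1]
    rw [integral_const_mul, integral_exp_sum_noise fun _ x => t * (x ^ 2 - 1)]
    calc _ ≤ Real.exp (-(ℓ / 12)) * ∏ _i : Fin d, Real.exp (2 * t ^ 2) := by
          refine mul_le_mul_of_nonneg_left (Finset.prod_le_prod
            (fun _ _ => integral_nonneg fun _ => (Real.exp_pos _).le)
            fun _ _ => (integral_exp_sq_le ht0 ht4).2) (Real.exp_pos _).le
      _ ≤ _ := by
          rw [← Real.exp_sum, ← Real.exp_add]
          simp only [Finset.sum_const, Finset.card_univ, Fintype.card_fin, nsmul_eq_mul]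
          refine Real.exp_le_exp.2 ?_
          linarith
  have h2 : ∫ z : Fin d → ℝ, Real.exp (t * (2 * ∑ i, z i * θ i - d * sparsityLevel d / 3))
      ∂(noise d) ≤ Real.exp (1 / 8 - ℓ / 24) := by
    simp_rw [e2]
    rw [integral_const_mul, integral_exp_sum_noise fun i x => (2 * t * θ i) * x]
    have hm : ∀ c : ℝ, ∫ x, Real.exp (c * x) ∂(gaussianReal 0 1) = Real.exp (c ^ 2 / 2) := by
      intro c
      have := congrFun (mgf_id_gaussianReal (μ := 0) (v := 1)) c
      simpa [mgf] using this
    simp_rw [hm]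
    rw [← Real.exp_sum, ← Real.exp_add]
    refine Real.exp_le_exp.2 ?_
    have e : ∑ i, (2 * t * θ i) ^ 2 / 2 = 2 * (t ^ 2 * ∑ i, θ i ^ 2) := by
      rw [Finset.mul_sum, Finset.mul_sum]
      exact Finset.sum_congr rfl fun i _ => by ring
    rw [e]; linarith
  refine ⟨i1.add i2, ?_⟩
  unfold detectionBound
  rw [integral_add i1 i2]
  linarith [exp_neg_rpow_le hd]

theorem sqLoss_blockJS_le (hd : 2 ≤ d) {θ z : Fin d → ℝ} (hx : ∀ i, (θ + z) i ≠ 0) {lam : ℝ}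
    {L : ℕ} (h : InSearchRange d lam L) :
    sqLoss (blockJS lam L) θ z ≤ 2 * ∑ i, z i ^ 2 + 8 * d * Real.log d := by
  obtain ⟨hL, hLd, hlo, hhi⟩ := h
  have hl := half_le_log hd
  have hlam : 0 ≤ lam := (le_max_right _ _).trans hlo
  rw [sqLoss_blockJS hL hx]
  refine (Finset.sum_le_sum fun b _ => groupLoss_le θ (block d L b) hlam z).trans ?_
  rw [Finset.sum_add_distrib, ← Finset.mul_sum, sum_blocks hL fun i => z i ^ 2, Finset.sum_const,
    Finset.card_range, nsmul_eq_mul]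
  have hm : (numBlocks d L : ℝ) * L ≤ 2 * d := by
    have h2 := numBlocks_mul_le d L
    have h3 : L ≤ d := by exact_mod_cast hLd.trans (sqrt_natCast_le_self d)
    exact_mod_cast (by omega : numBlocks d L * L ≤ 2 * d)
  have : (numBlocks d L : ℝ) * (2 * lam) ≤ 8 * d * Real.log d := by
    calc (numBlocks d L : ℝ) * (2 * lam) ≤ numBlocks d L * (2 * (2 * L * Real.log d)) := by gcongr
      _ = 4 * (numBlocks d L * L) * Real.log d := by ring
      _ ≤ 4 * (2 * d) * Real.log d := by gcongr
      _ = _ := by ring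
  linarith

/-- When the test fires, the loss of the block estimator is at most 2‖z‖² + 8 d log d, whatever pair
is selected. This polynomial size meets an error probability of order d⁻⁴, so the event adds only
O(1/d) to the total loss. -/
theorem sureBlock_le_sparse : ∃ c : ℝ, 0 < c ∧ ∀ d : ℕ, 2 ≤ d →
    ∀ est : (Fin d → ℝ) → (Fin d → ℝ), IsSureBlock est → ∀ θ : Fin d → ℝ,
      (∑ i, θ i ^ 2) / d ≤ sparsityLevel d / 3 →
      risk est θ ≤ ENNReal.ofReal ((d : ℝ)⁻¹ * ∑ i, min (θ i ^ 2) (2 * Real.log d) +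
        c * (d : ℝ)⁻¹ * Real.log d ^ (-(1 / 2) : ℝ)) := by
  obtain ⟨K, hK, hg⟩ := exists_integral_groupLoss_singleton_le
  have hχ := chiVar_nonneg
  refine ⟨K + (2 * chiVar + 2) + 10 * Real.exp 36865, by positivity, fun d hd est hest θ hθ => ?_⟩
  obtain ⟨lam, L, hmin, rfl⟩ := hest
  have hd0 : (0 : ℝ) < d := by exact_mod_cast (by omega : 0 < d)
  have hd2 : (2 : ℝ) ≤ d := by exact_mod_cast hd
  have hl := half_le_log hd
  have hld := log_le_self hd
  obtain ⟨iG, hG⟩ := integral_sqLoss_garrote_le hd θ (hg d hd θ)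
  obtain ⟨iD, hD⟩ := integral_detectionBound_le hd hθ
  obtain ⟨iY, hY⟩ := integral_sq_chi (Finset.univ : Finset (Fin d))
  rw [Finset.card_univ, Fintype.card_fin] at hY
  have iQ : Integrable (fun z : Fin d → ℝ =>
      ((d : ℝ) ^ 3)⁻¹ * (2 * (∑ i, (z i ^ 2 - 1)) ^ 2 + 2 * d ^ 2)) (noise d) :=
    ((iY.const_mul 2).add (integrable_const _)).const_mul _
  have iD' : Integrable (fun z => 5 * (d : ℝ) ^ 3 * detectionBound θ z) (noise d) :=
    iD.const_mul _
  refine (risk_le_of_ae_le hd ((iG.add iQ).add iD') ?_).trans (ENNReal.ofReal_le_ofReal ?_)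
  · filter_upwards [ae_add_ne_zero θ] with z hz
    simp only [Pi.add_apply]
    have hG0 : 0 ≤ sqLoss garrote θ z := Finset.sum_nonneg fun _ _ => sq_nonneg _
    have hD0 := detectionBound_nonneg θ z
    have hQ0 : 0 ≤ ((d : ℝ) ^ 3)⁻¹ * (2 * (∑ i, (z i ^ 2 - 1)) ^ 2 + 2 * d ^ 2) := by positivity
    by_cases hT : sparsityLevel d < sparsityStat (θ + z)
    · have e : sqLoss (hybrid lam L) θ z = sqLoss (blockJS (lam (θ + z)) (L (θ + z))) θ z := by
        simp only [sqLoss, hybrid, hT, if_true]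
      rw [e]
      have h1 := sqLoss_blockJS_le hd hz (hmin (θ + z)).1
      have h2 := one_le_detectionBound hd hθ hT
      set Y := ∑ i, (z i ^ 2 - 1) with hYdef
      have hsum : ∑ i, z i ^ 2 = Y + d := by
        rw [hYdef, Finset.sum_sub_distrib]; simp
      rw [hsum] at h1
      -- Arithmetic–geometric mean with weight d³ replaces Cauchy–Schwarz on the event: the
      -- quadratic part has mean O(1/d) even without the indicator, and only d³ is left to multiply
      -- `detectionBound`.
      have h3 : 2 * (Y + d) ≤ ((d : ℝ) ^ 3)⁻¹ * (2 * Y ^ 2 + 2 * d ^ 2) + d ^ 3 := by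
        have e : ((d : ℝ) ^ 3)⁻¹ * (Y + d) ^ 2 + d ^ 3 - 2 * (Y + d)
            = ((d : ℝ) ^ 3)⁻¹ * (Y + d - d ^ 3) ^ 2 := by field_simp; ring
        have h4 : 0 ≤ ((d : ℝ) ^ 3)⁻¹ * (Y + d - d ^ 3) ^ 2 := by positivity
        have h5 : ((d : ℝ) ^ 3)⁻¹ * (Y + d) ^ 2 ≤ ((d : ℝ) ^ 3)⁻¹ * (2 * Y ^ 2 + 2 * d ^ 2) := by
          gcongr; nlinarith [sq_nonneg (Y - d)]
        linarith
      have h6 : (d : ℝ) ^ 3 + 8 * d * Real.log d ≤ 5 * d ^ 3 := by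
        have : 8 * d * Real.log d ≤ 4 * d ^ 3 := by
          calc 8 * d * Real.log d ≤ 8 * d * d := by gcongr
            _ ≤ 4 * d ^ 3 := by nlinarith [mul_pos hd0 hd0]
        linarith
      have h7 : 5 * (d : ℝ) ^ 3 ≤ 5 * d ^ 3 * detectionBound θ z :=
        le_mul_of_one_le_right (by positivity) h2
      linarith
    · have e : sqLoss (hybrid lam L) θ z = sqLoss garrote θ z := by
        simp only [sqLoss, hybrid, hT, if_false]
      have : 0 ≤ 5 * (d : ℝ) ^ 3 * detectionBound θ z := by positivity
      rw [e]; linarith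
  · simp only [Pi.add_apply]
    rw [integral_add (by exact iG.add iQ) iD', integral_add iG iQ, integral_const_mul, integral_const_mul,
      integral_add (iY.const_mul 2) (integrable_const _), integral_const_mul, hY]
    simp only [integral_const, probReal_univ, one_smul]
    set w := Real.log d ^ (-(1 / 2) : ℝ) with hw
    have hl0 : 0 < Real.log d := by linarith
    have hdw : (d : ℝ)⁻¹ ≤ w := by
      rw [hw, Real.rpow_neg hl0.le, ← Real.sqrt_eq_rpow]
      exact inv_anti₀ (Real.sqrt_pos.2 hl0)
        ((Real.sqrt_le_sqrt hld).trans (sqrt_natCast_le_self d))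
    have h1 : ((d : ℝ) ^ 3)⁻¹ * (2 * (d * chiVar) + 2 * d ^ 2) ≤ (2 * chiVar + 2) * w := by
      have : ((d : ℝ) ^ 3)⁻¹ * (2 * (d * chiVar) + 2 * d ^ 2) ≤ (2 * chiVar + 2) * (d : ℝ)⁻¹ := by
        have e : (2 * chiVar + 2) * (d : ℝ)⁻¹
            - ((d : ℝ) ^ 3)⁻¹ * (2 * (d * chiVar) + 2 * d ^ 2)
            = 2 * chiVar * (d - 1) * ((d : ℝ) ^ 2)⁻¹ := by field_simp; ring
        have : 0 ≤ 2 * chiVar * (d - 1) * ((d : ℝ) ^ 2)⁻¹ := by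
          have : (0 : ℝ) ≤ d - 1 := by linarith
          positivity
        linarith
      exact this.trans (by gcongr)
    have h2 : 5 * (d : ℝ) ^ 3 * ∫ z, detectionBound θ z ∂(noise d) ≤ 10 * Real.exp 36865 * w := by
      calc _ ≤ 5 * (d : ℝ) ^ 3 * (2 * (Real.exp 36865 * ((d : ℝ) ^ 4)⁻¹)) := by gcongr
        _ = 10 * Real.exp 36865 * (d : ℝ)⁻¹ := by field_simp; ring
        _ ≤ _ := by gcongr
    calc _ ≤ (d : ℝ)⁻¹ * (∑ i, min (θ i ^ 2) (2 * Real.log d) + K * w + (2 * chiVar + 2) * w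
          + 10 * Real.exp 36865 * w) := by gcongr
      _ = _ := by ring

end Sparse

end

end SureBlock

/-! ### The theorem -/

theorem theorem1 :
    (∃ c : ℝ, 0 < c ∧ ∀ (d : ℕ), 2 ≤ d →
      ∀ est : (Fin d → ℝ) → (Fin d → ℝ), SureBlock.IsSureBlock est → ∀ θ : Fin d → ℝ,
        SureBlock.risk est θ ≤ SureBlock.blockOracle θ +
          ENNReal.ofReal (c * (d : ℝ) ^ (-(1 / 4) : ℝ) * Real.log d ^ (5 / 2 : ℝ))) ∧
    (∃ c : ℝ, 0 < c ∧ ∀ (d : ℕ), 2 ≤ d →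
      ∀ est : (Fin d → ℝ) → (Fin d → ℝ), SureBlock.IsSureBlock est → ∀ θ : Fin d → ℝ,
        SureBlock.risk est θ ≤ ENNReal.ofReal (SureBlock.linearOracle θ +
          c * (d : ℝ) ^ (-(1 / 4) : ℝ) * Real.log d ^ (5 / 2 : ℝ))) ∧
    (∃ c : ℝ, 0 < c ∧ ∀ (d : ℕ), 2 ≤ d →
      ∀ est : (Fin d → ℝ) → (Fin d → ℝ), SureBlock.IsSureBlock est → ∀ θ : Fin d → ℝ,
        (∑ i, θ i ^ 2) / d ≤ SureBlock.sparsityLevel d / 3 →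
        SureBlock.risk est θ ≤ ENNReal.ofReal
          ((d : ℝ)⁻¹ * ∑ i, min (θ i ^ 2) (2 * Real.log d) +
            c * (d : ℝ)⁻¹ * Real.log d ^ (-(1 / 2) : ℝ))) :=
  ⟨SureBlock.sureBlock_le_blockOracle, SureBlock.sureBlock_le_linearOracle,
    SureBlock.sureBlock_le_sparse⟩
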